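/- For $z\in\mathbb C$ put $\langle z\rangle=(1+|z|^2)^{1/2}$. Let $\mathcal A$ be the set of smooth $f:\mathbb R\to\mathbb C$ for which there is $\beta<0$ such that for every $n\ge 0$ there is $c_n$ with $|f^{(n)}(x)|\le c_n\langle x\rangle^{\beta-n}$ for all $x$. Let $\mathcal A^+$ be the algebra (with pointwise operations) of smooth $f:[0,\infty)\to\mathbb C$ satisfying the same condition for all $x\ge 0$, with the norms $\|f\|_{\mathcal A^+_n}=\sum_{r=0}^n\int_0^\infty|f^{(r)}(x)|\langle x\rangle^{r-1}\,dx$. A *cut-off* is a smooth $\psi$ on $\mathbb R$ with $\psi(s)=1$ for $|s|\le1$ and $\psi(s)=0$ for $|s|\ge2$. For $f\in\mathcal A$, $n\in\mathbb N$ and a cut-off $\psi$ let $$\tilde f(x,y)=\Big(\sum_{r=0}^n f^{(r)}(x)\frac{(iy)^r}{r!}\Big)\psi\big(y/\langle x\rangle\big),\qquad \frac{\partial\tilde f}{\partial\bar z}=\frac12\Big(\frac{\partial\tilde f}{\partial x}+i\frac{\partial\tilde f}{\partial y}\Big).$$ *Seeley data* consist of real sequences $(a_k)$, $(b_k)$ with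 $b_k<0$, $b_k\to-\infty$, $\sum_k|a_k||b_k|^n<\infty$ and $\sum_k a_kb_k^n=1$ for all integers $n\ge0$, and a smooth $\varphi$ on $\mathbb R$ with $\varphi=1$ on $[0,1]$ and $\varphi=0$ on $(-\infty,-1]\cup[2,\infty)$. The corresponding *Seeley extension* of $f:[0,\infty)\to\mathbb C$ is $(\mathcal Ef)(x)=f(x)$ for $x\ge0$ and $(\mathcal Ef)(x)=\sum_k a_k\varphi(b_kx)f(b_kx)$ for $x<0$. **Theorem.** Let $H$ be a closed, densely defined operator on a complex Banach space $\mathcal B$ with spectrum $\sigma(H)\subseteq[0,\infty)$, and suppose that for some $c$ and some $\alpha\ge0$ $$\|(z-H)^{-1}\|\le c\,|\mathrm{Im}\,z|^{-1}\Big(\frac{\langle z\rangle}{|\mathrm{Im}\,z|}\Big)^{\alpha}\qquad\text{for all } z\notin\mathbb R .$$ Then there is a functional calculus $\gamma_H:\mathcal A^+\to B(\mathcal B)$, that is, a linear and multiplicative map such that * for every integer $n>\alpha$ there is a constant $C$ with $\|\gamma_H(f)\|\le C\|f\|_{\mathcal A^+_{n+1}}$ for all $f\in\mathcal A^+$; *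 for every $z\notin\mathbb R$ the function $g_z(x)=(z-x)^{-1}$, $x\ge0$, is in $\mathcal A^+$ and $\gamma_H(g_z)=(z-H)^{-1}$; * $\gamma_H(f)=0$ whenever $f\in\mathcal A^+$ has compact support disjoint from $\sigma(H)$; and such that: 1. $\gamma_H$ is given by the Helffer–Sjöstrand formula applied to a Seeley extension: Seeley data exist, and for all Seeley data and every $f\in\mathcal A^+$ one has $g:=\mathcal Ef\in\mathcal A$ and, for every integer $n>\alpha$ and every cut-off $\psi$, $$\gamma_H(f)=-\frac1\pi\iint_{\mathbb C}\frac{\partial\tilde g}{\partial\bar z}(z-H)^{-1}\,dx\,dy ,$$ where the integral converges in operator norm. 2. For every $f\in\mathcal A$ the restriction $f|_{[0,\infty)}$ is in $\mathcal A^+$ and, for every integer $n>\alpha$ and every cut-off $\psi$, $$\gamma_H\big(f|_{[0,\infty)}\big)=-\frac1\pi\iint_{\mathbb C}\frac{\partial\tilde f}{\partial\bar z}(z-H)^{-1}\,dx\,dy ,$$ where the integral converges in operator norm. -/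

import Mathlib

open Set Filter Topology MeasureTheory
open scoped ContDiff

noncomputable section

namespace HelfferSjostrand

/-- The bracket `⟨z⟩ = (1 + |z|²)^{1/2}` of a real or complex number. -/
def bracket {E : Type*} [Norm E] (z : E) : ℝ := Real.sqrt (1 + ‖z‖ ^ 2)

lemma bracket_pos {E : Type*} [Norm E] (z : E) : 0 < bracket z :=
  Real.sqrt_pos.2 (by positivity)

lemma one_le_bracket {E : Type*} [Norm E] (z : E) : 1 ≤ bracket z :=
  Real.one_le_sqrt.2 (by nlinarith [sq_nonneg ‖z‖])

/-! ### Slowly decreasing functions -/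

/-- `f ∈ S^β`: `f` is smooth on `ℝ` and `|f⁽ⁿ⁾(x)| ≤ cₙ ⟨x⟩^{β-n}` for every `n`. -/
def IsSymbol (β : ℝ) (f : ℝ → ℂ) : Prop :=
  ContDiff ℝ ∞ f ∧ ∀ n : ℕ, ∃ c : ℝ, ∀ x : ℝ,
    ‖iteratedDeriv n f x‖ ≤ c * bracket x ^ (β - n)

/-- The class `𝒜 = ⋃_{β < 0} S^β` of functions on the line. -/
def SlowDecay : Set (ℝ → ℂ) := {f | ∃ β : ℝ, β < 0 ∧ IsSymbol β f}

/-- The `n`-th derivative on `[0, ∞)` (one-sided at `0`) of a function on `[0, ∞)`.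
It only involves the values on `[0, ∞)`, not those of the auxiliary extension
`Set.IciExtend f`, which is constant on the negative half line. -/
def halfDeriv (n : ℕ) (f : Ici (0 : ℝ) → ℂ) (x : ℝ) : ℂ :=
  iteratedDerivWithin n (IciExtend f) (Ici 0) x

/-- `f ∈ S^β_+`: `f` is smooth on `[0, ∞)` and `|f⁽ⁿ⁾(x)| ≤ cₙ ⟨x⟩^{β-n}` for every `n`. -/
def IsHalfSymbol (β : ℝ) (f : Ici (0 : ℝ) → ℂ) : Prop :=
  ContDiffOn ℝ ∞ (IciExtend f) (Ici 0) ∧ ∀ n : ℕ, ∃ c : ℝ, ∀ x ∈ Ici (0 : ℝ),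
    ‖halfDeriv n f x‖ ≤ c * bracket x ^ (β - n)

lemma IsHalfSymbol.mono {β β' : ℝ} (h : β ≤ β') {f : Ici (0 : ℝ) → ℂ}
    (hf : IsHalfSymbol β f) : IsHalfSymbol β' f := by
  refine ⟨hf.1, fun n => ?_⟩
  obtain ⟨c, hc⟩ := hf.2 n
  refine ⟨|c|, fun x hx => (hc x hx).trans ?_⟩
  have h0 := Real.rpow_pos_of_pos (bracket_pos x) (β - n)
  have h1 : bracket x ^ (β - n) ≤ bracket x ^ (β' - n) :=
    Real.rpow_le_rpow_of_exponent_le (one_le_bracket x) (by linarith)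
  calc c * bracket x ^ (β - n) ≤ |c| * bracket x ^ (β - n) := by
        gcongr; exact le_abs_self c
    _ ≤ _ := by gcongr

lemma IsHalfSymbol.add {β : ℝ} {f g : Ici (0 : ℝ) → ℂ}
    (hf : IsHalfSymbol β f) (hg : IsHalfSymbol β g) : IsHalfSymbol β (f + g) := by
  have e : IciExtend (f + g) = IciExtend f + IciExtend g := rfl
  refine ⟨by rw [e]; exact hf.1.add hg.1, fun n => ?_⟩
  obtain ⟨c, hc⟩ := hf.2 n
  obtain ⟨d, hd⟩ := hg.2 n
  refine ⟨c + d, fun x hx => ?_⟩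
  have hn : (n : WithTop ℕ∞) ≤ ∞ := by exact_mod_cast le_top
  rw [halfDeriv, e, iteratedDerivWithin_add hx (uniqueDiffOn_Ici 0)
    ((hf.1 x hx).of_le hn) ((hg.1 x hx).of_le hn), add_mul]
  exact (norm_add_le _ _).trans (add_le_add (hc x hx) (hd x hx))

lemma IsHalfSymbol.smul {β : ℝ} (a : ℂ) {f : Ici (0 : ℝ) → ℂ}
    (hf : IsHalfSymbol β f) : IsHalfSymbol β (a • f) := by
  have e : IciExtend (a • f) = a • IciExtend f := rfl
  refine ⟨by rw [e]; exact hf.1.const_smul a, fun n => ?_⟩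
  obtain ⟨c, hc⟩ := hf.2 n
  refine ⟨‖a‖ * c, fun x hx => ?_⟩
  rw [halfDeriv, e, iteratedDerivWithin_const_smul_field, norm_smul, mul_assoc]
  exact mul_le_mul_of_nonneg_left (hc x hx) (norm_nonneg a)

lemma IsHalfSymbol.mul {β β' : ℝ} {f g : Ici (0 : ℝ) → ℂ}
    (hf : IsHalfSymbol β f) (hg : IsHalfSymbol β' g) : IsHalfSymbol (β + β') (f * g) := by
  have e : IciExtend (f * g) = IciExtend f * IciExtend g := rfl
  refine ⟨by rw [e]; exact hf.1.mul hg.1, fun n => ?_⟩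
  choose c hc using hf.2
  choose d hd using hg.2
  refine ⟨∑ i ∈ Finset.range (n + 1), (n.choose i : ℝ) * (c i * d (n - i)), fun x hx => ?_⟩
  have hn : (n : WithTop ℕ∞) ≤ ∞ := by exact_mod_cast le_top
  rw [halfDeriv, e, iteratedDerivWithin_mul hx (uniqueDiffOn_Ici 0)
    ((hf.1 x hx).of_le hn) ((hg.1 x hx).of_le hn), Finset.sum_mul]
  refine (norm_sum_le _ _).trans (Finset.sum_le_sum fun i hi => ?_)
  have hi' : i ≤ n := by simpa [Nat.lt_succ_iff] using hi
  have hp : bracket x ^ (β + β' - n) = bracket x ^ (β - i) * bracket x ^ (β' - (n - i : ℕ)) := by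
    rw [← Real.rpow_add (bracket_pos x), Nat.cast_sub hi']
    congr 1; ring
  have h1 := hc i x hx
  have h2 := hd (n - i) x hx
  rw [halfDeriv] at h1 h2
  rw [norm_mul, norm_mul, hp]
  have h3 := mul_le_mul h1 h2 (norm_nonneg _) ((norm_nonneg _).trans h1)
  have h4 : ‖((n.choose i : ℕ) : ℂ)‖ = (n.choose i : ℝ) := by simp
  rw [h4]
  calc _ = (n.choose i : ℝ) * (‖iteratedDerivWithin i (IciExtend f) (Ici 0) x‖ *
        ‖iteratedDerivWithin (n - i) (IciExtend g) (Ici 0) x‖) := by ring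
    _ ≤ (n.choose i : ℝ) * (c i * bracket x ^ (β - i) *
        (d (n - i) * bracket x ^ (β' - (n - i : ℕ)))) := by gcongr
    _ = _ := by ring

/-- The algebra `𝒜⁺ = ⋃_{β < 0} S^β_+` of functions on `[0, ∞)`, with pointwise operations. -/
def SlowDecayPlus : NonUnitalSubalgebra ℂ (Ici (0 : ℝ) → ℂ) where
  carrier := {f | ∃ β : ℝ, β < 0 ∧ IsHalfSymbol β f}
  zero_mem' := by
    have e : IciExtend (0 : Ici (0 : ℝ) → ℂ) = fun _ => 0 := rfl
    refine ⟨-1, by norm_num, by rw [e]; exact contDiffOn_const, fun n => ⟨0, fun x _ => ?_⟩⟩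
    simp [halfDeriv, e]
  add_mem' := by
    rintro f g ⟨β, hβ, hf⟩ ⟨β', hβ', hg⟩
    exact ⟨max β β', max_lt hβ hβ',
      (hf.mono (le_max_left _ _)).add (hg.mono (le_max_right _ _))⟩
  mul_mem' := by
    rintro f g ⟨β, hβ, hf⟩ ⟨β', hβ', hg⟩
    exact ⟨β + β', add_neg hβ hβ', hf.mul hg⟩
  smul_mem' := by
    rintro a f ⟨β, hβ, hf⟩
    exact ⟨β, hβ, hf.smul a⟩

/-- The norm `‖f‖_{𝒜⁺_n} = ∑_{r=0}^n ∫_0^∞ |f⁽ʳ⁾(x)| ⟨x⟩^{r-1} dx`; on `𝒜⁺` all these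
integrals converge. -/
def halfNorm (n : ℕ) (f : Ici (0 : ℝ) → ℂ) : ℝ :=
  ∑ r ∈ Finset.range (n + 1),
    ∫ x in Ici (0 : ℝ), ‖halfDeriv r f x‖ * bracket x ^ ((r : ℝ) - 1)

/-! ### Seeley's extension -/

/-- The data of a Seeley extension: sequences `a`, `b` with `b_k < 0`, `b_k → -∞`,
`∑ |a_k| |b_k|ⁿ < ∞` and `∑ a_k b_kⁿ = 1` for all `n`, and a test function `φ` with `φ = 1` on
`[0, 1]`, `φ = 0` on `[2, ∞)` and on `(-∞, -1]`. -/
structure IsSeeleyData (a b : ℕ → ℝ) (φ : ℝ → ℂ) : Prop where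
  neg : ∀ k, b k < 0
  summable : ∀ n : ℕ, Summable fun k => |a k| * |b k| ^ n
  moment : ∀ n : ℕ, ∑' k, a k * b k ^ n = 1
  tendsto : Tendsto b atTop atBot
  smooth : ContDiff ℝ ∞ φ
  one : ∀ x ∈ Icc (0 : ℝ) 1, φ x = 1
  zero_right : ∀ x, 2 ≤ x → φ x = 0
  zero_left : ∀ x, x ≤ -1 → φ x = 0

/-- Seeley's extension `ℰ f` of a function on `[0, ∞)` to the line. For `x < 0` the points `b_k x`
are positive and only finitely many terms of the sum are nonzero. -/
def seeley (a b : ℕ → ℝ) (φ : ℝ → ℂ) (f : Ici (0 : ℝ) → ℂ) (x : ℝ) : ℂ :=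
  if x < 0 then ∑' k, (a k : ℂ) * (φ (b k * x) * IciExtend f (b k * x)) else IciExtend f x

/-! ### Almost analytic extensions -/

/-- A cut-off: smooth, `1` for `|s| ≤ 1` and `0` for `|s| ≥ 2`. -/
structure IsCutoff (ψ : ℝ → ℂ) : Prop where
  smooth : ContDiff ℝ ∞ ψ
  one : ∀ s, |s| ≤ 1 → ψ s = 1
  zero : ∀ s, 2 ≤ |s| → ψ s = 0

/-- `f̃(x, y) = (∑_{r=0}^n f⁽ʳ⁾(x) (iy)^r / r!) ψ(y / ⟨x⟩)`. -/
def almostAnalytic (n : ℕ) (ψ : ℝ → ℂ) (f : ℝ → ℂ) (x y : ℝ) : ℂ :=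
  (∑ r ∈ Finset.range (n + 1),
    iteratedDeriv r f x * (Complex.I * y) ^ r / (r.factorial : ℂ)) * ψ (y / bracket x)

/-- `∂F/∂z̄ = ½ (∂F/∂x + i ∂F/∂y)` at `z = x + iy`. -/
def dbar (F : ℝ → ℝ → ℂ) (z : ℂ) : ℂ :=
  (1 / 2) * (deriv (fun x => F x z.im) z.re + Complex.I * deriv (fun y => F z.re y) z.im)

/-! ### Resolvents of unbounded operators -/

variable {X : Type*} [NormedAddCommGroup X] [NormedSpace ℂ X]

/-- `R` is a bounded two-sided inverse of `z - H : dom H → X`. -/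
def IsResolventAt (H : X →ₗ.[ℂ] X) (z : ℂ) (R : X →L[ℂ] X) : Prop :=
  (∀ u : H.domain, R (z • (u : X) - H u) = u) ∧
    ∀ v : X, ∃ u : H.domain, (u : X) = R v ∧ z • (u : X) - H u = v

/-- The spectrum `σ(H)`: those `z` for which `z - H` has no bounded inverse. -/
def spec (H : X →ₗ.[ℂ] X) : Set ℂ := {z | ¬ ∃ R : X →L[ℂ] X, IsResolventAt H z R}

open Classical in
/-- The resolvent `(z - H)⁻¹` for `z ∉ σ(H)`, and `0` for `z ∈ σ(H)`. -/
def resolv (H : X →ₗ.[ℂ] X) (z : ℂ) : X →L[ℂ] X :=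
  if h : ∃ R : X →L[ℂ] X, IsResolventAt H z R then h.choose else 0

/-- The integrand `∂f̃/∂z̄ (z - H)⁻¹` of the Helffer–Sjöstrand formula. -/
def hsIntegrand (H : X →ₗ.[ℂ] X) (n : ℕ) (ψ : ℝ → ℂ) (f : ℝ → ℂ) (z : ℂ) : X →L[ℂ] X :=
  dbar (almostAnalytic n ψ f) z • resolv H z

/-- The Helffer–Sjöstrand integral `-(1/π) ∬_ℂ ∂f̃/∂z̄ (z - H)⁻¹ dx dy`. -/
def hsIntegral (H : X →ₗ.[ℂ] X) (n : ℕ) (ψ : ℝ → ℂ) (f : ℝ → ℂ) : X →L[ℂ] X :=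
  (-(1 / Real.pi : ℝ) : ℂ) • ∫ z : ℂ, hsIntegrand H n ψ f z

/-- `T` is given by the Helffer–Sjöstrand formula for `f ∈ 𝒜`: for every order `n > α` and every
cut-off `ψ` the integral converges in operator norm and equals `T`. -/
def IsHelfferSjostrand (H : X →ₗ.[ℂ] X) (α : ℝ) (f : ℝ → ℂ) (T : X →L[ℂ] X) : Prop :=
  ∀ (n : ℕ) (ψ : ℝ → ℂ), α < n → IsCutoff ψ →
    Integrable (hsIntegrand H n ψ f) ∧ T = hsIntegral H n ψ f

/-- The properties that make an algebra homomorphism `γ : 𝒜⁺ → B(X)` (linear and multiplicative)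
a functional calculus for `H`: continuity in the norms of `𝒜⁺`, the right value on the resolvent
functions, and dependence on the spectrum only. -/
structure IsFunctionalCalculus (H : X →ₗ.[ℂ] X) (α : ℝ)
    (γ : SlowDecayPlus →ₙₐ[ℂ] (X →L[ℂ] X)) : Prop where
  bound : ∀ n : ℕ, α < n → ∃ C : ℝ, ∀ f : SlowDecayPlus,
    ‖γ f‖ ≤ C * halfNorm (n + 1) (f : Ici (0 : ℝ) → ℂ)
  resolvent : ∀ z : ℂ, z.im ≠ 0 →
    ∃ h : (fun x : Ici (0 : ℝ) => (z - ((x : ℝ) : ℂ))⁻¹) ∈ SlowDecayPlus,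
      γ ⟨_, h⟩ = resolv H z
  support : ∀ f : SlowDecayPlus, HasCompactSupport (f : Ici (0 : ℝ) → ℂ) →
    (∀ x ∈ tsupport (f : Ici (0 : ℝ) → ℂ), ((x : ℝ) : ℂ) ∉ spec H) → γ f = 0

end HelfferSjostrand

end

open HelfferSjostrand

/-!
Write `f(H)` for the Helffer–Sjöstrand integral of `f`, built from an almost analytic extension
`f̃`. The extension satisfies `∂̄f̃ = O(|Im z|ⁿ)`, which for `n > α` beats the growth of the
resolvent; an explicit integration in `Im z` bounds `‖f(H)‖` by the norm of order `n + 1` of `f`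
(`exists_norm_hsOp_le`).

The structural properties rest on one formula. Move the resolvent `R` away from the real axis by
`ε` in both half planes and apply Green's formula in each of them: for compactly supported `f`,
`f(H) = lim_{ε → 0} ∫ f(x) (2πi)⁻¹ (R(x - iε) - R(x + iε)) dx` (`tendsto_integral_smul_jump`). Any
compactly supported `C¹` extension of `f` for which the integral converges absolutely gives the
same limit. Consequences, extended from compact support to the whole class by dominated
convergence where needed:

* `f(H)` depends neither on the order nor on the cut-off (`hsOp_eq_hsOp`), and it vanishes when
  the support of `f` avoids the spectrum (`hsOp_eq_zero_of_continuousOn`). Translating by `δ → 0`,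
  it vanishes as soon as `f = 0` on `[0, ∞)` (`hsOp_eq_zero_of_eqOn_Ici`). So `f(H)` is a function
  of the restriction of `f` to `[0, ∞)`, and every extension from the half line may be used.
* For `R(z) = (z - t)⁻¹` the jump is the Poisson kernel, and the formula becomes the
  Cauchy–Pompeiu formula at a real point `t` (`integral_dbar_smul_inv_sub`).
* With an extension `f̃` vanishing near a nonreal `w`, `(w - z)⁻¹ f̃` is an extension of
  `r_w f`, where `r_w(x) = (w - x)⁻¹`, and the resolvent equation yields `(r_w f)(H) = R(w) f(H)`
  (`hsOp_resFun_mul`).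
* For a cut-off `χ`, `χ(H / L)` converges to the identity on the domain of `H`, by a scaling
  argument together with the Cauchy–Pompeiu formula at `-1`; as the domain is dense,
  `r_w(H) = R(w)` (`hsOp_resFun`).
* Multiplicativity (`hsOp_mul`): `R(z) g(H)` is the limit of the integrals of `(z - x)⁻¹ g(x)`
  against the jump of `R`. Insert this into the integral defining `f(H) g(H)`, exchange the
  integrations, and evaluate the integral over `z` by the Cauchy–Pompeiu formula.

What remains concerns the half line. Seeley's extension is smooth because the moment conditions
match all one-sided derivatives at `0`, and it is supported in `[-L, ∞)`, so it lies in the class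
on the line (`seeley_mem_slowDecay`), with norms controlled by those on the half line
(`exists_integral_symbolSum_seeley_le`). Seeley data are obtained with nodes `-8ᵏ` and weights
given by a two-term recurrence, which reduces the moments to telescoping sums
(`exists_isSeeleyData`). The calculus is `f ↦ (ℰf)(H)` for one fixed choice of data; since only
values on `[0, ∞)` matter, it is an algebra homomorphism although `ℰ` is not multiplicative.
-/

noncomputable section

namespace HelfferSjostrand

/-! ### The resolvent of an unbounded operator -/

section Resolvent

variable {X : Type*} [NormedAddCommGroup X] [NormedSpace ℂ X] {H : X →ₗ.[ℂ] X} {z w : ℂ}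

lemma IsResolventAt.unique {R R' : X →L[ℂ] X} (h : IsResolventAt H z R)
    (h' : IsResolventAt H z R') : R = R' := by
  ext v
  obtain ⟨u, hu, huv⟩ := h'.2 v
  rw [← hu, ← h.1 u, huv]

lemma IsResolventAt.resolv_eq {R : X →L[ℂ] X} (h : IsResolventAt H z R) : resolv H z = R := by
  have hex : ∃ R : X →L[ℂ] X, IsResolventAt H z R := ⟨R, h⟩
  rw [resolv, dif_pos hex]
  exact hex.choose_spec.unique h

lemma isResolventAt_resolv (hz : z ∉ spec H) : IsResolventAt H z (resolv H z) := by
  have hex : ∃ R : X →L[ℂ] X, IsResolventAt H z R := by simpa [spec] using hz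
  rw [resolv, dif_pos hex]
  exact hex.choose_spec

lemma resolv_sub_resolv (hz : z ∉ spec H) (hw : w ∉ spec H) :
    resolv H z - resolv H w = (w - z) • (resolv H z * resolv H w) := by
  ext v
  obtain ⟨u, hu, huv⟩ := (isResolventAt_resolv hw).2 v
  have h1 := (isResolventAt_resolv hz).1 u
  have h2 : v = (z • (u : X) - H u) + (w - z) • (u : X) := by
    rw [← huv, sub_smul]; abel
  have h3 : resolv H z v = u + (w - z) • resolv H z u := by
    conv_lhs => rw [h2]
    rw [map_add, h1, map_smul]
  simp [h3, ← hu]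

variable [CompleteSpace X]

/-- Neumann series: near a point of the resolvent set,
`R(w) = R(z) (1 + (w - z) R(z))⁻¹`. -/
lemma eventually_isResolventAt (hz : z ∉ spec H) : ∀ᶠ w in 𝓝 z,
    IsResolventAt H w (resolv H z * Ring.inverse (1 + (w - z) • resolv H z)) := by
  set R := resolv H z with hR
  have hc : Tendsto (fun w : ℂ => 1 + (w - z) • R) (𝓝 z) (𝓝 1) := by
    have : Continuous fun w : ℂ => 1 + (w - z) • R := by fun_prop
    simpa using this.tendsto z
  filter_upwards [hc.eventually (Units.nhds (1 : (X →L[ℂ] X)ˣ))] with w hw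
  obtain ⟨U, hU⟩ := hw
  rw [← hU, Ring.inverse_unit]
  have hRz := isResolventAt_resolv hz
  have hcomm : Commute R (U : X →L[ℂ] X) := by
    rw [hU]
    exact (Commute.one_right _).add_right ((Commute.refl R).smul_right _)
  have hcomm' : R * (U⁻¹ : (X →L[ℂ] X)ˣ) = (U⁻¹ : (X →L[ℂ] X)ˣ) * R := by
    exact (hcomm.units_inv_right)
  refine ⟨fun u => ?_, fun v => ?_⟩
  · have h1 : R (w • (u : X) - H u) = (U : X →L[ℂ] X) u := by
      have : w • (u : X) - H u = (z • (u : X) - H u) + (w - z) • (u : X) := by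
        rw [sub_smul]; abel
      rw [this, map_add, hRz.1 u, hU]
      simp
    rw [hcomm', mul_apply_eq_comp, h1, ← mul_apply_eq_comp,
      Units.inv_mul]
    rfl
  · set v' := (U⁻¹ : (X →L[ℂ] X)ˣ).1 v with hv'
    obtain ⟨u, hu, huv⟩ := hRz.2 v'
    refine ⟨u, hu, ?_⟩
    have : w • (u : X) - H u = (z • (u : X) - H u) + (w - z) • (u : X) := by
      rw [sub_smul]; abel
    rw [this, huv, hu]
    have h2 : v' + (w - z) • R v' = (U : X →L[ℂ] X) v' := by rw [hU]; simp
    rw [h2, hv', ← mul_apply_eq_comp]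
    simp

lemma isClosed_spec : IsClosed (spec H) := by
  rw [← isOpen_compl_iff, isOpen_iff_mem_nhds]
  intro z hz
  filter_upwards [eventually_isResolventAt hz] with w hw
  exact fun h => h ⟨_, hw⟩

lemma differentiableAt_resolv (hz : z ∉ spec H) : DifferentiableAt ℂ (resolv H) z := by
  have h : resolv H =ᶠ[𝓝 z] fun w => resolv H z * Ring.inverse (1 + (w - z) • resolv H z) := by
    filter_upwards [eventually_isResolventAt hz] with w hw
    exact hw.resolv_eq
  refine DifferentiableAt.congr_of_eventuallyEq ?_ h
  refine DifferentiableAt.const_mul ?_ _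
  have h1 : DifferentiableAt ℂ (Ring.inverse : (X →L[ℂ] X) → _) (1 + (z - z) • resolv H z) :=
    differentiableAt_inverse (by simp)
  exact DifferentiableAt.comp (f := fun w : ℂ => 1 + (w - z) • resolv H z) z h1
    (((differentiableAt_id.sub_const z).smul_const _).const_add _)

end Resolvent

/-! ### The `∂̄`-derivative of an almost analytic extension -/

/-- A smooth function on the line that is `1` for `|s| ≤ ρ` and `0` for `|s| ≥ 2`. A small `ρ`
allows the support of an almost analytic extension to be concentrated near the real axis. -/
structure IsCutoffAt (ρ : ℝ) (ψ : ℝ → ℂ) : Prop where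
  smooth : ContDiff ℝ ∞ ψ
  pos : 0 < ρ
  one : ∀ s, |s| ≤ ρ → ψ s = 1
  zero : ∀ s, 2 ≤ |s| → ψ s = 0

lemma IsCutoff.isCutoffAt {ψ : ℝ → ℂ} (h : IsCutoff ψ) : IsCutoffAt 1 ψ :=
  ⟨h.smooth, one_pos, h.one, h.zero⟩

lemma bracket_sq {E : Type*} [Norm E] (z : E) : bracket z ^ 2 = 1 + ‖z‖ ^ 2 :=
  Real.sq_sqrt (by positivity)

lemma norm_le_bracket {E : Type*} [NormedAddCommGroup E] (z : E) : ‖z‖ ≤ bracket z :=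
  Real.le_sqrt_of_sq_le (by linarith)

lemma hasDerivAt_bracket (x : ℝ) : HasDerivAt (fun x : ℝ => bracket x) (x / bracket x) x := by
  have h : (fun x : ℝ => bracket x) = fun x : ℝ => Real.sqrt (1 + x ^ 2) := by
    ext x; simp [bracket]
  have h1 : HasDerivAt (fun x : ℝ => 1 + x ^ 2) (2 * x) x := by
    simpa using (hasDerivAt_pow 2 x).const_add 1
  have h2 := h1.sqrt (by positivity)
  rw [h]
  convert h2 using 1
  simp only [bracket, Real.norm_eq_abs, sq_abs]
  field_simp

lemma contDiff_bracket : ContDiff ℝ ∞ (fun x : ℝ => bracket x) := by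
  have h : (fun x : ℝ => bracket x) = fun x : ℝ => Real.sqrt (1 + x ^ 2) := by
    ext x; simp [bracket]
  rw [h]
  exact ContDiff.sqrt (by fun_prop) (fun x => by positivity)

lemma continuous_bracket : Continuous (fun x : ℝ => bracket x) := contDiff_bracket.continuous

/-- The Taylor polynomial `∑_{r ≤ n} f⁽ʳ⁾(x) (iy)^r / r!` of `f` at `x`, evaluated at `x + iy`. -/
def imTaylor (n : ℕ) (f : ℝ → ℂ) (x y : ℝ) : ℂ :=
  ∑ r ∈ Finset.range (n + 1), iteratedDeriv r f x * (Complex.I * y) ^ r / (r.factorial : ℂ)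

lemma hasDerivAt_iteratedDeriv {f : ℝ → ℂ} (hf : ContDiff ℝ ∞ f) (r : ℕ) (x : ℝ) :
    HasDerivAt (iteratedDeriv r f) (iteratedDeriv (r + 1) f x) x := by
  rw [iteratedDeriv_succ]
  exact ((hf.differentiable_iteratedDeriv r (by exact_mod_cast WithTop.coe_lt_top _)) x).hasDerivAt

lemma contDiff_iteratedDeriv {f : ℝ → ℂ} (hf : ContDiff ℝ ∞ f) (r : ℕ) :
    ContDiff ℝ ∞ (iteratedDeriv r f) := by
  rw [iteratedDeriv_eq_iterate]
  exact hf.iterate_deriv r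

/-- `(∂/∂x + i ∂/∂y)` of the Taylor polynomial telescopes. -/
lemma exists_hasDerivAt_imTaylor {f : ℝ → ℂ} (hf : ContDiff ℝ ∞ f) (n : ℕ) (x y : ℝ) :
    ∃ dx dy : ℂ, HasDerivAt (fun x => imTaylor n f x y) dx x ∧
      HasDerivAt (fun y => imTaylor n f x y) dy y ∧
      dx + Complex.I * dy =
        iteratedDeriv (n + 1) f x * (Complex.I * y) ^ n / (n.factorial : ℂ) := by
  induction n with
  | zero =>
    refine ⟨iteratedDeriv 1 f x, 0, ?_, ?_, by simp⟩
    · simpa [imTaylor] using hasDerivAt_iteratedDeriv hf 0 x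
    · simpa [imTaylor] using hasDerivAt_const y (f x)
  | succ n ih =>
    obtain ⟨dx, dy, hx, hy, h⟩ := ih
    have e : ∀ x y, imTaylor (n + 1) f x y = imTaylor n f x y +
        iteratedDeriv (n + 1) f x * (Complex.I * y) ^ (n + 1) / ((n + 1).factorial : ℂ) :=
      fun x y => by rw [imTaylor, Finset.sum_range_succ]; rfl
    have hy' : HasDerivAt (fun y : ℝ => (Complex.I * (y : ℂ)) ^ (n + 1))
        ((n + 1 : ℕ) * (Complex.I * y) ^ n * Complex.I) y := by
      have h0 : HasDerivAt (fun y : ℝ => Complex.I * (y : ℂ)) Complex.I y := by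
        simpa using (Complex.ofRealCLM.hasDerivAt (x := y)).const_mul Complex.I
      simpa using h0.fun_pow (n + 1)
    have hx2 := hx.fun_add (((hasDerivAt_iteratedDeriv hf (n + 1) x).mul_const
      ((Complex.I * y) ^ (n + 1))).div_const ((n + 1).factorial : ℂ))
    have hy2 := hy.fun_add ((hy'.const_mul (iteratedDeriv (n + 1) f x)).div_const
      ((n + 1).factorial : ℂ))
    refine ⟨_, _, by simpa only [e] using hx2, by simpa only [e] using hy2, ?_⟩
    · rw [mul_add, add_add_add_comm, h, Nat.factorial_succ]
      have h1 : (n.factorial : ℂ) ≠ 0 := by exact_mod_cast n.factorial_ne_zero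
      have h2 : ((n : ℂ) + 1) ≠ 0 := by exact_mod_cast n.succ_ne_zero
      push_cast
      field_simp
      linear_combination (iteratedDeriv (n + 1) f x) * (n + 1) * Complex.I ^ n * y ^ n *
        Complex.I_sq

lemma contDiff_imTaylor {f : ℝ → ℂ} (hf : ContDiff ℝ ∞ f) (n : ℕ) :
    ContDiff ℝ ∞ (fun p : ℝ × ℝ => imTaylor n f p.1 p.2) := by
  unfold imTaylor
  refine ContDiff.sum fun r _ => ContDiff.div_const (ContDiff.mul ?_ (ContDiff.pow ?_ r)) _
  · exact (contDiff_iteratedDeriv hf r).comp contDiff_fst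
  · exact contDiff_const.mul (Complex.ofRealCLM.contDiff.comp contDiff_snd)

lemma contDiff_almostAnalytic {f ψ : ℝ → ℂ} (hf : ContDiff ℝ ∞ f) (hψ : ContDiff ℝ ∞ ψ) (n : ℕ) :
    ContDiff ℝ ∞ (fun p : ℝ × ℝ => almostAnalytic n ψ f p.1 p.2) := by
  refine (contDiff_imTaylor hf n).mul (hψ.comp (contDiff_snd.div ?_ fun p => (bracket_pos p.1).ne'))
  exact contDiff_bracket.comp contDiff_fst

lemma dbar_almostAnalytic {f ψ : ℝ → ℂ} (hf : ContDiff ℝ ∞ f) (hψ : ContDiff ℝ ∞ ψ) (n : ℕ)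
    (z : ℂ) :
    dbar (almostAnalytic n ψ f) z = 1 / 2 *
      (iteratedDeriv (n + 1) f z.re * (Complex.I * z.im) ^ n / (n.factorial : ℂ) *
        ψ (z.im / bracket z.re) +
      imTaylor n f z.re z.im * (deriv ψ (z.im / bracket z.re) *
        (-(z.im * z.re / bracket z.re ^ 3 : ℝ) + Complex.I * (1 / bracket z.re : ℝ)))) := by
  obtain ⟨dx, dy, hx, hy, h⟩ := exists_hasDerivAt_imTaylor hf n z.re z.im
  have hb := (bracket_pos z.re).ne'
  have hψ' : HasDerivAt ψ (deriv ψ (z.im / bracket z.re)) (z.im / bracket z.re) :=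
    (hψ.differentiable (by simp) _).hasDerivAt
  have h1 : HasDerivAt (fun x : ℝ => z.im / bracket x) (-(z.im * z.re / bracket z.re ^ 3))
      z.re := by
    have := (hasDerivAt_const z.re z.im).fun_div (hasDerivAt_bracket z.re) hb
    exact this.congr_deriv (by field_simp; ring)
  have h2 : HasDerivAt (fun y : ℝ => y / bracket z.re) (1 / bracket z.re) z.im :=
    (hasDerivAt_id z.im).div_const _
  have h3 := hx.mul (hψ'.scomp z.re h1)
  have h4 := hy.mul (hψ'.scomp z.im h2)
  have e : ∀ x y, almostAnalytic n ψ f x y = imTaylor n f x y * ψ (y / bracket x) :=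
    fun _ _ => rfl
  have e3 : deriv (fun x => almostAnalytic n ψ f x z.im) z.re = _ := h3.deriv
  have e4 : deriv (fun y => almostAnalytic n ψ f z.re y) z.im = _ := h4.deriv
  rw [dbar, e3, e4, ← h]
  simp only [Function.comp, Complex.real_smul]
  push_cast
  ring

/-- `∑_{r ≤ k} |f⁽ʳ⁾(x)| ⟨x⟩^{r-1}`, whose integral is the `k`-th norm of `f`. -/
def symbolSum (k : ℕ) (f : ℝ → ℂ) (x : ℝ) : ℝ :=
  ∑ r ∈ Finset.range (k + 1), ‖iteratedDeriv r f x‖ * bracket x ^ ((r : ℝ) - 1)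

lemma symbolSum_nonneg (k : ℕ) (f : ℝ → ℂ) (x : ℝ) : 0 ≤ symbolSum k f x :=
  Finset.sum_nonneg fun _ _ => mul_nonneg (norm_nonneg _) (Real.rpow_nonneg (bracket_pos x).le _)

lemma IsCutoffAt.hasCompactSupport {ρ : ℝ} {ψ : ℝ → ℂ} (h : IsCutoffAt ρ ψ) :
    HasCompactSupport ψ := by
  refine HasCompactSupport.intro (isCompact_Icc (a := -2) (b := 2)) fun x hx => h.zero x ?_
  by_contra! hlt
  exact hx ⟨(abs_lt.1 hlt).1.le, (abs_lt.1 hlt).2.le⟩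

lemma IsCutoffAt.deriv_eq_zero_of_lt {ρ : ℝ} {ψ : ℝ → ℂ} (h : IsCutoffAt ρ ψ) {s : ℝ}
    (hs : |s| < ρ) : deriv ψ s = 0 := by
  have : ψ =ᶠ[𝓝 s] fun _ => 1 := by
    filter_upwards [(continuous_abs.tendsto s).eventually_lt_const hs] with t ht using h.one t ht.le
  simpa using this.deriv_eq

lemma IsCutoffAt.deriv_eq_zero_of_gt {ρ : ℝ} {ψ : ℝ → ℂ} (h : IsCutoffAt ρ ψ) {s : ℝ}
    (hs : 2 < |s|) : deriv ψ s = 0 := by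
  have : ψ =ᶠ[𝓝 s] fun _ => 0 := by
    filter_upwards [(continuous_abs.tendsto s).eventually_const_lt hs] with t ht
      using h.zero t ht.le
  simpa using this.deriv_eq

lemma dbar_almostAnalytic_eq_zero {f ψ : ℝ → ℂ} {ρ : ℝ} (hf : ContDiff ℝ ∞ f)
    (hψ : IsCutoffAt ρ ψ) (n : ℕ) {z : ℂ} (hz : 2 * bracket z.re < |z.im|) :
    dbar (almostAnalytic n ψ f) z = 0 := by
  have h : 2 < |z.im / bracket z.re| := by
    rwa [abs_div, abs_of_pos (bracket_pos z.re), lt_div_iff₀ (bracket_pos z.re)]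
  rw [dbar_almostAnalytic hf hψ.smooth, hψ.zero _ h.le, hψ.deriv_eq_zero_of_gt h]
  simp

/-- An almost analytic extension is `∂̄`-closed to order `n` at the real axis. -/
lemma exists_norm_dbar_almostAnalytic_le {ψ : ℝ → ℂ} {ρ : ℝ} (hψ : IsCutoffAt ρ ψ) (n : ℕ) :
    ∃ A : ℝ, 0 ≤ A ∧ ∀ f : ℝ → ℂ, ContDiff ℝ ∞ f → ∀ z : ℂ, |z.im| ≤ 2 * bracket z.re →
      ‖dbar (almostAnalytic n ψ f) z‖ ≤
        A * symbolSum (n + 1) f z.re * (|z.im| / bracket z.re) ^ n := by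
  obtain ⟨M₀, hM₀⟩ := hψ.hasCompactSupport.exists_bound_of_continuous hψ.smooth.continuous
  obtain ⟨M₁, hM₁⟩ := hψ.hasCompactSupport.deriv.exists_bound_of_continuous
    (hψ.smooth.continuous_deriv (by simp))
  have hM₀' : 0 ≤ M₀ := (norm_nonneg _).trans (hM₀ 0)
  have hM₁' : 0 ≤ M₁ := (norm_nonneg _).trans (hM₁ 0)
  have hρ := hψ.pos
  refine ⟨M₀ + 3 * 2 ^ n * (M₁ / ρ ^ n), by positivity, fun f hf z hz => ?_⟩
  set x := z.re
  set y := z.im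
  set b := bracket x with hbdef
  have hb : 0 < b := bracket_pos x
  have hb1 : 1 ≤ b := one_le_bracket x
  have hxb : |x| ≤ b := norm_le_bracket x
  set s := |y| / b with hs
  have hs0 : 0 ≤ s := by positivity
  have hys : |y| = b * s := by rw [hs]; field_simp
  have hψ' : ‖deriv ψ (y / b)‖ ≤ M₁ / ρ ^ n * s ^ n := by
    have hab : |y / b| = s := by rw [abs_div, abs_of_pos hb]
    rcases lt_or_ge s ρ with h | h
    · rw [hψ.deriv_eq_zero_of_lt (by rwa [hab]), norm_zero]; positivity
    · refine (hM₁ _).trans ?_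
      rw [div_mul_eq_mul_div, le_div_iff₀ (by positivity)]
      gcongr
  have hT : ‖imTaylor n f x y‖ * b⁻¹ ≤ 2 ^ n * symbolSum n f x := by
    rw [imTaylor, symbolSum, Finset.mul_sum]
    refine (mul_le_mul_of_nonneg_right (norm_sum_le _ _) (by positivity)).trans ?_
    rw [Finset.sum_mul]
    refine Finset.sum_le_sum fun r hr => ?_
    have hr' : r ≤ n := by simpa [Nat.lt_succ_iff] using hr
    have h1 : ‖iteratedDeriv r f x * (Complex.I * y) ^ r / (r.factorial : ℂ)‖ ≤
        ‖iteratedDeriv r f x‖ * (2 ^ n * b ^ r) := by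
      rw [norm_div, norm_mul, norm_pow, norm_mul, Complex.norm_I, one_mul, Complex.norm_real,
        Real.norm_eq_abs]
      have : (1 : ℝ) ≤ ‖(r.factorial : ℂ)‖ := by
        rw [Complex.norm_natCast]; exact_mod_cast r.factorial_pos
      refine (div_le_self (by positivity) this).trans ?_
      gcongr
      calc |y| ^ r ≤ (2 * b) ^ r := by gcongr
        _ = 2 ^ r * b ^ r := mul_pow _ _ _
        _ ≤ 2 ^ n * b ^ r := by gcongr; norm_num
    refine (mul_le_mul_of_nonneg_right h1 (by positivity)).trans (le_of_eq ?_)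
    rw [Real.rpow_sub_one hb.ne', Real.rpow_natCast]
    field_simp
  have hQ : symbolSum n f x + ‖iteratedDeriv (n + 1) f x‖ * b ^ n = symbolSum (n + 1) f x := by
    rw [symbolSum, symbolSum, Finset.sum_range_succ _ (n + 1), ← Real.rpow_natCast]
    push_cast
    rw [add_sub_cancel_right]
  have hQ1 := symbolSum_nonneg n f x
  have hQ2 : ‖iteratedDeriv (n + 1) f x‖ * b ^ n ≤ symbolSum (n + 1) f x := by linarith
  have hQ3 : symbolSum n f x ≤ symbolSum (n + 1) f x := by
    have : 0 ≤ ‖iteratedDeriv (n + 1) f x‖ * b ^ n := by positivity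
    linarith
  rw [dbar_almostAnalytic hf hψ.smooth]
  have t1 : ‖iteratedDeriv (n + 1) f x * (Complex.I * y) ^ n / (n.factorial : ℂ) * ψ (y / b)‖ ≤
      M₀ * symbolSum (n + 1) f x * s ^ n := by
    rw [norm_mul, norm_div, norm_mul, norm_pow, norm_mul, Complex.norm_I, one_mul,
      Complex.norm_real, Real.norm_eq_abs, hys]
    have : (1 : ℝ) ≤ ‖(n.factorial : ℂ)‖ := by
      rw [Complex.norm_natCast]; exact_mod_cast n.factorial_pos
    calc _ ≤ ‖iteratedDeriv (n + 1) f x‖ * (b * s) ^ n * M₀ := by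
          gcongr
          · exact div_le_self (by positivity) this
          · exact hM₀ _
      _ = M₀ * (‖iteratedDeriv (n + 1) f x‖ * b ^ n) * s ^ n := by ring
      _ ≤ _ := by gcongr
  have t2 : ‖(-(y * x / b ^ 3 : ℝ) + Complex.I * (1 / b : ℝ) : ℂ)‖ ≤ 3 * b⁻¹ := by
    refine (norm_add_le _ _).trans ?_
    rw [norm_neg, norm_mul, Complex.norm_I, one_mul, Complex.norm_real, Complex.norm_real,
      Real.norm_eq_abs, Real.norm_eq_abs, abs_div, abs_mul, abs_of_pos (by positivity : 0 < b ^ 3),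
      abs_of_pos (by positivity : 0 < 1 / b)]
    have : |y| * |x| / b ^ 3 ≤ 2 * b * b / b ^ 3 := by gcongr
    have h2 : 2 * b * b / b ^ 3 = 2 * b⁻¹ := by field_simp
    rw [h2] at this
    rw [one_div]
    linarith
  have t3 : ‖imTaylor n f x y * (deriv ψ (y / b) *
      (-(y * x / b ^ 3 : ℝ) + Complex.I * (1 / b : ℝ)))‖ ≤
      3 * 2 ^ n * (M₁ / ρ ^ n) * symbolSum (n + 1) f x * s ^ n := by
    rw [norm_mul, norm_mul]
    calc _ ≤ ‖imTaylor n f x y‖ * (M₁ / ρ ^ n * s ^ n * (3 * b⁻¹)) := by gcongr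
      _ = 3 * (M₁ / ρ ^ n) * s ^ n * (‖imTaylor n f x y‖ * b⁻¹) := by ring
      _ ≤ 3 * (M₁ / ρ ^ n) * s ^ n * (2 ^ n * symbolSum n f x) := by gcongr
      _ ≤ 3 * (M₁ / ρ ^ n) * s ^ n * (2 ^ n * symbolSum (n + 1) f x) := by gcongr
      _ = _ := by ring
  rw [norm_mul]
  have h12 : ‖(1 / 2 : ℂ)‖ ≤ 1 := by norm_num
  calc _ ≤ 1 * _ := mul_le_mul_of_nonneg_right h12 (norm_nonneg _)
    _ ≤ _ := by
      rw [one_mul]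
      refine (norm_add_le _ _).trans ((add_le_add t1 t3).trans (le_of_eq ?_))
      ring

/-! ### Absolute convergence of the Helffer–Sjöstrand integral -/

/-- The resolvent growth bound `|Im z|⁻¹ (⟨z⟩ / |Im z|)^α`. -/
def weight (α : ℝ) (z : ℂ) : ℝ := |z.im|⁻¹ * (bracket z / |z.im|) ^ α

lemma weight_nonneg (α : ℝ) (z : ℂ) : 0 ≤ weight α z :=
  mul_nonneg (by positivity) (Real.rpow_nonneg (div_nonneg (bracket_pos z).le (abs_nonneg _)) _)

lemma measurable_weight (α : ℝ) : Measurable (weight α) := by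
  unfold weight bracket
  fun_prop

/-- The function `|s|^p` on `[-2, 2]`, extended by zero. -/
def truncPow (p s : ℝ) : ℝ := if |s| ≤ 2 then |s| ^ p else 0

lemma truncPow_nonneg (p s : ℝ) : 0 ≤ truncPow p s := by
  unfold truncPow
  split_ifs
  · positivity
  · rfl

lemma measurable_truncPow (p : ℝ) : Measurable (truncPow p) := by
  unfold truncPow
  exact Measurable.ite (measurableSet_le (by fun_prop) (by fun_prop)) (by fun_prop) (by fun_prop)

lemma integrable_truncPow {p : ℝ} (hp : -1 < p) : Integrable (truncPow p) := by
  have h0 : IntervalIntegrable (fun x : ℝ => |x| ^ p) volume 0 2 := by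
    refine (intervalIntegral.intervalIntegrable_rpow' hp (a := 0) (b := 2)).congr ?_
    intro x hx
    rw [uIoc_of_le (by norm_num)] at hx
    simp [abs_of_pos hx.1]
  have h1 : IntervalIntegrable (fun x : ℝ => |x| ^ p) volume (-2) 0 := by
    have := (IntervalIntegrable.iff_comp_neg).1 h0.symm
    simpa using this
  have h2 := (intervalIntegrable_iff_integrableOn_Icc_of_le (by norm_num)).1 (h1.trans h0)
  rw [← integrable_indicator_iff measurableSet_Icc] at h2
  refine h2.congr (ae_of_all _ fun x => ?_)
  simp only [indicator, truncPow, mem_Icc, ← abs_le]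

/-- Integrating out the imaginary part: `⟨x⟩⁻¹ |y / ⟨x⟩|^p` on `|y| ≤ 2⟨x⟩` has the same
integral over `y` for every `x`. -/
lemma integrable_mul_truncPow {p : ℝ} (hp : -1 < p) {Q : ℝ → ℝ} (hQ : Integrable Q) :
    Integrable (fun z : ℂ => Q z.re * ((bracket z.re)⁻¹ * truncPow p (z.im / bracket z.re))) ∧
      ∫ z : ℂ, Q z.re * ((bracket z.re)⁻¹ * truncPow p (z.im / bracket z.re)) =
        (∫ x, Q x) * ∫ s, truncPow p s := by
  set G : ℝ × ℝ → ℝ := fun q => Q q.1 * ((bracket q.1)⁻¹ * truncPow p (q.2 / bracket q.1)) with hG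
  have hy : ∀ x : ℝ, Integrable fun y => (bracket x)⁻¹ * truncPow p (y / bracket x) := fun x =>
    ((integrable_truncPow hp).comp_div (bracket_pos x).ne').const_mul _
  have hyi : ∀ x : ℝ, ∫ y, (bracket x)⁻¹ * truncPow p (y / bracket x) = ∫ s, truncPow p s := by
    intro x
    rw [integral_const_mul, Measure.integral_comp_div (truncPow p), abs_of_pos (bracket_pos x),
      smul_eq_mul, inv_mul_cancel_left₀ (bracket_pos x).ne']
  have hm : AEStronglyMeasurable G (volume.prod volume) := by
    refine AEStronglyMeasurable.mul hQ.1.comp_fst ?_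
    have hb : Measurable fun x : ℝ => bracket x := continuous_bracket.measurable
    have ht := measurable_truncPow p
    exact Measurable.aestronglyMeasurable (by fun_prop)
  have hi : Integrable G (volume.prod volume) := by
    refine (integrable_prod_iff hm).2 ⟨ae_of_all _ fun x => (hy x).const_mul (Q x), ?_⟩
    have : (fun x => ∫ y, ‖G (x, y)‖) = fun x => ‖Q x‖ * ∫ s, truncPow p s := by
      ext x
      rw [← hyi x, ← integral_const_mul]
      congr 1
      ext y
      rw [hG]
      simp only [norm_mul]
      rw [← norm_mul (bracket x)⁻¹, Real.norm_of_nonneg (r := (bracket x)⁻¹ * _)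
        (mul_nonneg (inv_nonneg.2 (bracket_pos x).le) (truncPow_nonneg _ _))]
    rw [this]
    exact hQ.norm.mul_const _
  have hmp := Complex.volume_preserving_equiv_real_prod
  constructor
  · exact (hmp.integrable_comp_emb Complex.measurableEquivRealProd.measurableEmbedding).2 hi
  · have := hmp.integral_comp Complex.measurableEquivRealProd.measurableEmbedding G
    refine Eq.trans this ?_
    rw [Measure.volume_eq_prod, integral_prod _ hi, ← integral_mul_const]
    congr 1
    ext x
    simp only [hG]
    rw [integral_const_mul, hyi]

lemma exists_norm_dbar_mul_weight_le {ψ : ℝ → ℂ} {ρ α : ℝ} (hα : 0 ≤ α) (hψ : IsCutoffAt ρ ψ)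
    (n : ℕ) :
    ∃ A : ℝ, 0 ≤ A ∧ ∀ f : ℝ → ℂ, ContDiff ℝ ∞ f → ∀ z : ℂ,
      ‖dbar (almostAnalytic n ψ f) z‖ * weight α z ≤
        A * (symbolSum (n + 1) f z.re *
          ((bracket z.re)⁻¹ * truncPow (n - 1 - α) (z.im / bracket z.re))) := by
  obtain ⟨A, hA, h⟩ := exists_norm_dbar_almostAnalytic_le hψ n
  refine ⟨A * 3 ^ α, by positivity, fun f hf z => ?_⟩
  have hb : 0 < bracket z.re := bracket_pos z.re
  have hQ := symbolSum_nonneg (n + 1) f z.re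
  have hR : 0 ≤ A * 3 ^ α * (symbolSum (n + 1) f z.re *
          ((bracket z.re)⁻¹ * truncPow (n - 1 - α) (z.im / bracket z.re))) := by
    have := truncPow_nonneg (n - 1 - α) (z.im / bracket z.re)
    positivity
  rcases lt_or_ge (2 * bracket z.re) |z.im| with h2 | h2
  · rwa [dbar_almostAnalytic_eq_zero hf hψ n h2, norm_zero, zero_mul]
  rcases eq_or_ne z.im 0 with h0 | h0
  · rwa [weight, show |z.im|⁻¹ = 0 by simp [h0], zero_mul, mul_zero]
  have hy : 0 < |z.im| := abs_pos.2 h0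
  have habs : |z.im / bracket z.re| = |z.im| / bracket z.re := by rw [abs_div, abs_of_pos hb]
  have ht : truncPow (n - 1 - α) (z.im / bracket z.re) =
      (|z.im| / bracket z.re) ^ ((n : ℝ) - 1 - α) := by
    rw [truncPow, habs, if_pos ((div_le_iff₀ hb).2 h2)]
  set s := |z.im| / bracket z.re with hs
  have hs0 : 0 < s := by positivity
  have hys : |z.im| = bracket z.re * s := by rw [hs]; field_simp
  have hzb : bracket z ≤ 3 * bracket z.re := by
    refine Real.sqrt_le_iff.2 ⟨by positivity, ?_⟩
    have h3 := bracket_sq z.re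
    have h4 : ‖z‖ ^ 2 = z.re ^ 2 + z.im ^ 2 := by
      rw [← Complex.normSq_eq_norm_sq, Complex.normSq_apply]; ring
    rw [Real.norm_eq_abs, sq_abs] at h3
    have h5 : z.im ^ 2 ≤ (2 * bracket z.re) ^ 2 := by rw [← sq_abs]; gcongr
    nlinarith [sq_nonneg z.re]
  have hw : weight α z ≤ 3 ^ α * ((bracket z.re)⁻¹ * (s⁻¹ * s ^ (-α))) := by
    rw [weight]
    calc _ ≤ |z.im|⁻¹ * (3 * bracket z.re / |z.im|) ^ α := by
          have := (bracket_pos z).le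
          gcongr
      _ = |z.im|⁻¹ * (3 * s⁻¹) ^ α := by
          congr 2
          rw [hys]
          field_simp
      _ = _ := by
          rw [Real.mul_rpow (by norm_num) (by positivity), Real.inv_rpow hs0.le,
            ← Real.rpow_neg hs0.le,
            hys, mul_inv]
          ring
  have hpow : s ^ ((n : ℝ) - 1 - α) = s ^ n * (s⁻¹ * s ^ (-α)) := by
    rw [show (n : ℝ) - 1 - α = n + (-1) + (-α) by ring, Real.rpow_add hs0, Real.rpow_add hs0,
      Real.rpow_natCast, Real.rpow_neg_one, mul_assoc]
  calc _ ≤ A * symbolSum (n + 1) f z.re * s ^ n *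
        (3 ^ α * ((bracket z.re)⁻¹ * (s⁻¹ * s ^ (-α)))) :=
        mul_le_mul (h f hf z h2) hw (weight_nonneg _ _) (by positivity)
    _ = _ := by rw [ht, hpow]; ring

lemma continuous_dbar_almostAnalytic {f ψ : ℝ → ℂ} (hf : ContDiff ℝ ∞ f) (hψ : ContDiff ℝ ∞ ψ)
    (n : ℕ) : Continuous (dbar (almostAnalytic n ψ f)) := by
  refine (continuous_congr (dbar_almostAnalytic hf hψ n)).2 ?_
  have h1 : Continuous fun z : ℂ => iteratedDeriv (n + 1) f z.re :=
    (contDiff_iteratedDeriv hf _).continuous.comp Complex.continuous_re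
  have h2 : Continuous fun z : ℂ => bracket z.re := continuous_bracket.comp Complex.continuous_re
  have h3 : Continuous fun z : ℂ => z.im / bracket z.re :=
    Complex.continuous_im.div h2 fun z => (bracket_pos _).ne'
  have h4 : Continuous fun z : ℂ => ψ (z.im / bracket z.re) := hψ.continuous.comp h3
  have h5 : Continuous fun z : ℂ => deriv ψ (z.im / bracket z.re) :=
    Continuous.comp (hψ.continuous_deriv (by simp)) h3
  have h6 : Continuous fun z : ℂ => imTaylor n f z.re z.im :=
    Continuous.comp (g := fun p : ℝ × ℝ => imTaylor n f p.1 p.2)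
      (f := fun z : ℂ => (z.re, z.im)) (contDiff_imTaylor hf n).continuous
      (Complex.continuous_re.prodMk Complex.continuous_im)
  have h7 : Continuous fun z : ℂ => z.im * z.re / bracket z.re ^ 3 :=
    (Complex.continuous_im.mul Complex.continuous_re).div (h2.pow 3)
      fun z => (pow_pos (bracket_pos _) 3).ne'
  have h8 : Continuous fun z : ℂ => 1 / bracket z.re :=
    continuous_const.div h2 fun z => (bracket_pos _).ne'
  have h9 : Continuous fun z : ℂ => (Complex.I * z.im) ^ n :=
    (continuous_const.mul (Complex.continuous_ofReal.comp Complex.continuous_im)).pow n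
  exact continuous_const.mul ((((h1.mul h9).div_const _).mul h4).add (h6.mul (h5.mul
    ((Complex.continuous_ofReal.comp h7).neg.add
      (continuous_const.mul (Complex.continuous_ofReal.comp h8))))))

lemma integrable_dbar_mul_weight {f ψ : ℝ → ℂ} {ρ α : ℝ} (hα : 0 ≤ α) (hψ : IsCutoffAt ρ ψ)
    {n : ℕ} (hn : α < n) (hf : ContDiff ℝ ∞ f) (hQ : Integrable (symbolSum (n + 1) f)) :
    Integrable fun z => ‖dbar (almostAnalytic n ψ f) z‖ * weight α z := by
  obtain ⟨A, hA, h⟩ := exists_norm_dbar_mul_weight_le hα hψ n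
  refine ((integrable_mul_truncPow (p := n - 1 - α) (by linarith) hQ).1.const_mul A).mono' ?_
    (ae_of_all _ fun z => ?_)
  · exact (continuous_dbar_almostAnalytic hf hψ.smooth n).norm.aestronglyMeasurable.mul
      (measurable_weight α).aestronglyMeasurable
  · rw [Real.norm_of_nonneg (mul_nonneg (norm_nonneg _) (weight_nonneg _ _))]
    exact h f hf z

lemma exists_integral_dbar_mul_weight_le {ψ : ℝ → ℂ} {ρ α : ℝ} (hα : 0 ≤ α)
    (hψ : IsCutoffAt ρ ψ) {n : ℕ} (hn : α < n) :
    ∃ C : ℝ, 0 ≤ C ∧ ∀ f : ℝ → ℂ, ContDiff ℝ ∞ f → Integrable (symbolSum (n + 1) f) →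
      ∫ z, ‖dbar (almostAnalytic n ψ f) z‖ * weight α z ≤ C * ∫ x, symbolSum (n + 1) f x := by
  obtain ⟨A, hA, h⟩ := exists_norm_dbar_mul_weight_le hα hψ n
  refine ⟨A * ∫ s, truncPow (n - 1 - α) s,
    mul_nonneg hA (integral_nonneg fun s => truncPow_nonneg _ _), fun f hf hQ => ?_⟩
  have hk := integrable_mul_truncPow (p := n - 1 - α) (by linarith) hQ
  refine (integral_mono (integrable_dbar_mul_weight hα hψ hn hf hQ) (hk.1.const_mul A)
    (h f hf)).trans (le_of_eq ?_)
  rw [integral_const_mul, hk.2]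
  ring

/-- A function on `ℂ \ ℝ` that behaves like a resolvent: holomorphic, with growth at most
`c |Im z|⁻¹ (⟨z⟩ / |Im z|)^α`. -/
structure IsResolventLike {Y : Type*} [NormedAddCommGroup Y] [NormedSpace ℂ Y] (α c : ℝ)
    (R : ℂ → Y) : Prop where
  differentiableAt : ∀ z : ℂ, z.im ≠ 0 → DifferentiableAt ℂ R z
  bound : ∀ z : ℂ, z.im ≠ 0 → ‖R z‖ ≤ c * weight α z

lemma ae_im_ne_zero : ∀ᵐ z : ℂ, z.im ≠ 0 := by
  have h : ∀ᵐ q : ℝ × ℝ, q.2 ≠ 0 := by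
    rw [Measure.volume_eq_prod]
    exact Measure.quasiMeasurePreserving_snd.ae (Measure.ae_ne volume 0)
  exact Complex.volume_preserving_equiv_real_prod.quasiMeasurePreserving.ae h

lemma isOpen_im_ne_zero : IsOpen {z : ℂ | z.im ≠ 0} :=
  isOpen_ne_fun Complex.continuous_im continuous_const

section ResolventLike

lemma aestronglyMeasurable_of_continuousOn_im_ne_zero {Y : Type*} [NormedAddCommGroup Y]
    {R : ℂ → Y} (hR : ContinuousOn R {z : ℂ | z.im ≠ 0}) :
    AEStronglyMeasurable R := by
  have h := hR.aestronglyMeasurable (μ := volume) isOpen_im_ne_zero.measurableSet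
  have h' : (volume : Measure ℂ).restrict {z : ℂ | z.im ≠ 0} = volume :=
    Measure.restrict_eq_self_of_ae_mem ae_im_ne_zero
  rwa [h'] at h

variable {Y : Type*} [NormedAddCommGroup Y] [NormedSpace ℂ Y] {α c : ℝ} {R : ℂ → Y}

lemma IsResolventLike.aestronglyMeasurable (hR : IsResolventLike α c R) :
    AEStronglyMeasurable R :=
  aestronglyMeasurable_of_continuousOn_im_ne_zero fun z hz =>
    (hR.differentiableAt z hz).continuousAt.continuousWithinAt

lemma IsResolventLike.integrable_smul (hR : IsResolventLike α c R) {u : ℂ → ℂ}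
    (hu : AEStronglyMeasurable u) (h : Integrable fun z => ‖u z‖ * weight α z) :
    Integrable fun z => u z • R z := by
  refine (h.const_mul c).mono' (hu.smul hR.aestronglyMeasurable) ?_
  filter_upwards [ae_im_ne_zero] with z hz
  rw [norm_smul]
  calc _ ≤ ‖u z‖ * (c * weight α z) := by gcongr; exact hR.bound z hz
    _ = _ := by ring

lemma IsResolventLike.norm_integral_smul_le (hR : IsResolventLike α c R) {u : ℂ → ℂ}
    (h : Integrable fun z => ‖u z‖ * weight α z) :
    ‖∫ z, u z • R z‖ ≤ c * ∫ z, ‖u z‖ * weight α z := by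
  rw [← integral_const_mul]
  refine norm_integral_le_of_norm_le (h.const_mul c) ?_
  filter_upwards [ae_im_ne_zero] with z hz
  rw [norm_smul]
  calc _ ≤ ‖u z‖ * (c * weight α z) := by gcongr; exact hR.bound z hz
    _ = _ := by ring

end ResolventLike

/-! ### Boundary values of the Helffer–Sjöstrand integral -/

/-- `F` is a compactly supported `C¹` function of `(x, y)`. -/
structure IsCompactC1 (F : ℝ → ℝ → ℂ) : Prop where
  contDiff : ContDiff ℝ 1 fun p : ℝ × ℝ => F p.1 p.2
  eq_zero : ∃ M : ℝ, 0 < M ∧ ∀ x y, M < |x| ∨ M < |y| → F x y = 0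

section Green

variable {F : ℝ → ℝ → ℂ}

lemma hasFDerivAt_comp_re_im (hF : ContDiff ℝ 1 fun p : ℝ × ℝ => F p.1 p.2) (z : ℂ) :
    ∃ F' : ℂ →L[ℝ] ℂ, HasFDerivAt (fun z : ℂ => F z.re z.im) F' z ∧
      2 * dbar F z = F' 1 + Complex.I * F' Complex.I := by
  have h1 := (hF.differentiable (by simp) (z.re, z.im)).hasFDerivAt
  set D := fderiv ℝ (fun p : ℝ × ℝ => F p.1 p.2) (z.re, z.im)
  have h2 : HasFDerivAt (fun z : ℂ => (z.re, z.im)) (Complex.reCLM.prod Complex.imCLM) z :=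
    Complex.reCLM.hasFDerivAt.prodMk Complex.imCLM.hasFDerivAt
  refine ⟨D.comp (Complex.reCLM.prod Complex.imCLM),
    HasFDerivAt.comp (g := fun p : ℝ × ℝ => F p.1 p.2) z h1 h2, ?_⟩
  have h3 : HasDerivAt (fun x => F x z.im) (D (1, 0)) z.re :=
    HasFDerivAt.comp_hasDerivAt (f := fun x : ℝ => (x, z.im)) z.re h1
      ((hasDerivAt_id z.re).prodMk (hasDerivAt_const z.re z.im))
  have h4 : HasDerivAt (fun y => F z.re y) (D (0, 1)) z.im :=
    HasFDerivAt.comp_hasDerivAt (f := fun y : ℝ => (z.re, y)) z.im h1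
      ((hasDerivAt_const z.im z.re).prodMk (hasDerivAt_id z.im))
  rw [dbar, h3.deriv, h4.deriv]
  simp

lemma continuous_dbar (hF : ContDiff ℝ 1 fun p : ℝ × ℝ => F p.1 p.2) : Continuous (dbar F) := by
  have hc : ContDiff ℝ 1 fun z : ℂ => F z.re z.im :=
    ContDiff.comp (g := fun p : ℝ × ℝ => F p.1 p.2) (f := fun z : ℂ => (z.re, z.im)) hF
      (Complex.reCLM.contDiff.prodMk Complex.imCLM.contDiff)
  have hd := hc.continuous_fderiv (by simp)
  have : dbar F = fun z => 1 / 2 * (fderiv ℝ (fun z : ℂ => F z.re z.im) z 1 +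
      Complex.I * fderiv ℝ (fun z : ℂ => F z.re z.im) z Complex.I) := by
    ext z
    obtain ⟨F', h, h'⟩ := hasFDerivAt_comp_re_im hF z
    rw [h.fderiv, ← h']
    ring
  rw [this]
  exact continuous_const.mul ((hd.clm_apply continuous_const).add
    (continuous_const.mul (hd.clm_apply continuous_const)))

lemma dbar_eq_zero_of_bound {M : ℝ} (h : ∀ x y, M < |x| ∨ M < |y| → F x y = 0) {z : ℂ}
    (hz : M < |z.re| ∨ M < |z.im|) : dbar F z = 0 := by
  have h1 : (fun x => F x z.im) =ᶠ[𝓝 z.re] fun _ => 0 := by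
    rcases hz with hz | hz
    · filter_upwards [(continuous_abs.tendsto z.re).eventually_const_lt hz] with x hx
        using h _ _ (Or.inl hx)
    · exact Eventually.of_forall fun x => h _ _ (Or.inr hz)
  have h2 : (fun y => F z.re y) =ᶠ[𝓝 z.im] fun _ => 0 := by
    rcases hz with hz | hz
    · exact Eventually.of_forall fun x => h _ _ (Or.inl hz)
    · filter_upwards [(continuous_abs.tendsto z.im).eventually_const_lt hz] with x hx
        using h _ _ (Or.inr hx)
  rw [dbar, h1.deriv_eq, h2.deriv_eq]
  simp

variable {Y : Type*} [NormedAddCommGroup Y] [NormedSpace ℂ Y] {G : ℂ → Y}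

lemma integral_complex_eq_of_integrable {h : ℂ → Y} (hh : Integrable h) :
    ∫ z, h z = ∫ x : ℝ, ∫ y : ℝ, h (x + y * Complex.I) := by
  have hmp := Complex.volume_preserving_equiv_real_prod.symm
  rw [← hmp.integral_comp Complex.measurableEquivRealProd.symm.measurableEmbedding h,
    Measure.volume_eq_prod, integral_prod]
  · simp [Complex.mk_eq_add_mul_I]
  · exact (hmp.integrable_comp_emb
      Complex.measurableEquivRealProd.symm.measurableEmbedding).2 hh

lemma integrableOn_dbar_smul_strip (hF : IsCompactC1 F) {a b : ℝ}
    (hG : ContinuousOn G {z : ℂ | a ≤ z.im ∧ z.im ≤ b}) :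
    IntegrableOn (fun z => dbar F z • G z) {z : ℂ | a < z.im ∧ z.im ≤ b} := by
  obtain ⟨M, hM, hzero⟩ := hF.eq_zero
  have hcpt : IsCompact (Icc (-M) M ×ℂ Icc a b) := isCompact_Icc.reProdIm isCompact_Icc
  have h1 : IntegrableOn (fun z => dbar F z • G z) (Icc (-M) M ×ℂ Icc a b) :=
    ((continuous_dbar hF.contDiff).continuousOn.smul
      (hG.mono fun z hz => hz.2)).integrableOn_compact hcpt
  have hSm : MeasurableSet {z : ℂ | a < z.im ∧ z.im ≤ b} :=
    (measurableSet_lt measurable_const Complex.measurable_im).inter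
      (measurableSet_le Complex.measurable_im measurable_const)
  refine (integrable_indicator_iff hSm).1 (((integrable_indicator_iff hcpt.measurableSet).2
    h1).indicator hSm |>.congr (ae_of_all _ fun z => ?_))
  by_cases hz : z ∈ {z : ℂ | a < z.im ∧ z.im ≤ b}
  · rw [indicator_of_mem hz, indicator_of_mem hz]
    by_cases hz' : z ∈ Icc (-M) M ×ℂ Icc a b
    · rw [indicator_of_mem hz']
    · rw [indicator_of_notMem hz', dbar_eq_zero_of_bound hzero (Or.inl ?_), zero_smul]
      by_contra! h
      exact hz' ⟨abs_le.1 h, hz.1.le, hz.2⟩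
  · rw [indicator_of_notMem hz, indicator_of_notMem hz]

/-- Green's formula on a strip `a ≤ Im z ≤ b`. -/
lemma integral_dbar_smul_strip (hF : IsCompactC1 F) {a b : ℝ} (hab : a ≤ b)
    (hG : ∀ z : ℂ, a ≤ z.im → z.im ≤ b → DifferentiableAt ℂ G z) :
    (∫ x : ℝ, F x a • G (x + a * Complex.I)) - ∫ x : ℝ, F x b • G (x + b * Complex.I) =
      (2 * Complex.I) • ∫ z in {z : ℂ | a < z.im ∧ z.im ≤ b}, dbar F z • G z := by
  obtain ⟨M, hM, hzero⟩ := hF.eq_zero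
  set L := M + 1 with hL
  have hGc : ContinuousOn G {z : ℂ | a ≤ z.im ∧ z.im ≤ b} := fun z hz =>
    (hG z hz.1 hz.2).continuousAt.continuousWithinAt
  have hLabs : |L| = L := abs_of_pos (by positivity)
  have hset : (uIcc (-L) L ×ℂ uIcc a b) ⊆ {z : ℂ | a ≤ z.im ∧ z.im ≤ b} := by
    intro z hz
    have := hz.2
    rwa [uIcc_of_le hab] at this
  have hcF : Continuous fun z : ℂ => F z.re z.im :=
    hF.contDiff.continuous.comp (Complex.continuous_re.prodMk Complex.continuous_im)
  have hcpt : IsCompact (uIcc (-L) L ×ℂ uIcc a b) := isCompact_uIcc.reProdIm isCompact_uIcc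
  have hcont : ContinuousOn (fun z => dbar F z • G z) (uIcc (-L) L ×ℂ uIcc a b) :=
    (continuous_dbar hF.contDiff).continuousOn.smul (hGc.mono hset)
  choose F' hF' hF'd using fun z => hasFDerivAt_comp_re_im hF.contDiff z
  have hK : ∀ z : ℂ, a ≤ z.im → z.im ≤ b → ∃ K' : ℂ →L[ℝ] Y,
      HasFDerivAt (fun z : ℂ => F z.re z.im • G z) K' z ∧
        Complex.I • K' 1 - K' Complex.I = (2 * Complex.I) • (dbar F z • G z) := by
    intro z h1 h2
    have hg := ((hG z h1 h2).hasDerivAt.hasFDerivAt).restrictScalars ℝ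
    refine ⟨_, (hF' z).smul hg, ?_⟩
    have e : (2 * Complex.I) * dbar F z = Complex.I * F' z 1 - F' z Complex.I := by
      linear_combination Complex.I * hF'd z + F' z Complex.I * Complex.I_mul_I
    rw [smul_smul, e]
    simp [smul_add, smul_smul, sub_smul, mul_comm]
  have hzL : ∀ z : ℂ, L ≤ |z.re| → F z.re z.im = 0 := fun z hz =>
    hzero _ _ (Or.inl (by linarith))
  classical
  let K' : ℂ → ℂ →L[ℝ] Y := fun z =>
    if h : a ≤ z.im ∧ z.im ≤ b then (hK z h.1 h.2).choose else 0
  have hK' : ∀ z : ℂ, a ≤ z.im → z.im ≤ b → HasFDerivAt (fun z : ℂ => F z.re z.im • G z) (K' z) z ∧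
        Complex.I • K' z 1 - K' z Complex.I = (2 * Complex.I) • (dbar F z • G z) := by
    intro z h1 h2
    have : K' z = (hK z h1 h2).choose := dif_pos ⟨h1, h2⟩
    rw [this]
    exact (hK z h1 h2).choose_spec
  have hrect := Complex.integral_boundary_rect_of_continuousOn_of_hasFDerivAt_real
    (fun z : ℂ => F z.re z.im • G z) K' ⟨-L, a⟩ ⟨L, b⟩
    (hcF.continuousOn.smul (hGc.mono hset))
    (fun z hz => by
      have h := hz.2
      simp only [min_eq_left hab, max_eq_right hab] at h
      exact (hK' z h.1.le h.2.le).1)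
    (by
      refine IntegrableOn.congr_fun ((hcont.integrableOn_compact hcpt).smul (2 * Complex.I))
        (fun z hz => ?_) hcpt.measurableSet
      exact ((hK' z (hset hz).1 (hset hz).2).2).symm)
  have hside1 : ∀ y : ℝ, F ((L : ℂ) + y * Complex.I).re ((L : ℂ) + y * Complex.I).im = 0 :=
    fun y => hzL _ (by simp [hLabs])
  have hside2 : ∀ y : ℝ, F (((-L : ℝ) : ℂ) + y * Complex.I).re
      (((-L : ℝ) : ℂ) + y * Complex.I).im = 0 :=
    fun y => hzL _ (by simp [hLabs])
  simp only [hside1, hside2, zero_smul, intervalIntegral.integral_zero, smul_zero, add_zero,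
    sub_zero] at hrect
  have hline : ∀ t : ℝ, (∫ x : ℝ in -L..L, F ((x : ℂ) + t * Complex.I).re
      ((x : ℂ) + t * Complex.I).im • G (x + t * Complex.I)) =
      ∫ x : ℝ, F x t • G (x + t * Complex.I) := by
    intro t
    rw [intervalIntegral.integral_of_le (by linarith)]
    simp only [Complex.add_re, Complex.ofReal_re, Complex.mul_re, Complex.I_re, mul_zero,
      Complex.ofReal_im, Complex.I_im, mul_one, sub_self, add_zero, Complex.add_im, Complex.mul_im,
      zero_add]
    refine setIntegral_eq_integral_of_forall_compl_eq_zero fun x hx => ?_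
    rw [hzero x t (Or.inl ?_), zero_smul]
    by_contra! h
    exact hx ⟨by linarith [(abs_le.1 h).1], by linarith [(abs_le.1 h).2]⟩
  rw [hline a, hline b] at hrect
  rw [hrect]
  -- rewrite the area integral as an iterated integral
  set S : Set ℂ := {z : ℂ | a < z.im ∧ z.im ≤ b} with hS
  have hSm : MeasurableSet S :=
    (measurableSet_lt measurable_const Complex.measurable_im).inter
      (measurableSet_le Complex.measurable_im measurable_const)
  have hint : Integrable (S.indicator fun z => dbar F z • G z) :=
    (integrable_indicator_iff hSm).2 (integrableOn_dbar_smul_strip hF hGc)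
  rw [← integral_indicator hSm, integral_complex_eq_of_integrable hint, ← integral_smul,
    intervalIntegral.integral_of_le (by linarith)]
  have hinner : ∀ x : ℝ, (∫ y : ℝ in a..b, Complex.I • K' (x + y * Complex.I) 1 -
      K' (x + y * Complex.I) Complex.I) =
      (2 * Complex.I) • ∫ y : ℝ, S.indicator (fun z => dbar F z • G z) (x + y * Complex.I) := by
    intro x
    rw [intervalIntegral.integral_of_le hab, ← integral_indicator measurableSet_Ioc,
      ← integral_smul]
    congr 1
    ext y
    by_cases hy : y ∈ Ioc a b
    · have hy' : (x + y * Complex.I : ℂ) ∈ S := by simpa [hS] using hy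
      rw [indicator_of_mem hy, indicator_of_mem hy']
      exact (hK' _ (by simpa using hy.1.le) (by simpa using hy.2)).2
    · have hy' : (x + y * Complex.I : ℂ) ∉ S := by simpa [hS] using hy
      rw [indicator_of_notMem hy, indicator_of_notMem hy', smul_zero]
  simp only [hinner]
  refine setIntegral_eq_integral_of_forall_compl_eq_zero fun x hx => ?_
  have : ∀ y : ℝ, dbar F (x + y * Complex.I) = 0 := by
    intro y
    refine dbar_eq_zero_of_bound hzero (Or.inl ?_)
    by_contra! h
    simp only [Complex.add_re, Complex.ofReal_re, Complex.mul_re, Complex.I_re, mul_zero,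
      Complex.ofReal_im, Complex.I_im, mul_one, sub_self, add_zero] at h
    exact hx ⟨by linarith [(abs_le.1 h).1], by linarith [(abs_le.1 h).2]⟩
  simp [indicator, this]

end Green

section Jump

variable {F : ℝ → ℝ → ℂ} {Y : Type*} [NormedAddCommGroup Y] [NormedSpace ℂ Y] {R : ℂ → Y}
  {α c : ℝ}

/-- The jump `(2πi)⁻¹ (R(x - iε) - R(x + iε))` across the real axis; for a resolvent this is an
approximation of the spectral density. -/
def jump (R : ℂ → Y) (ε x : ℝ) : Y :=
  (1 / (2 * Real.pi * Complex.I) : ℂ) • (R (x - ε * Complex.I) - R (x + ε * Complex.I))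

/-- `R`, moved away from the real axis by `ε` in both half planes. -/
def shiftAway (R : ℂ → Y) (ε : ℝ) (z : ℂ) : Y :=
  if 0 < z.im then R (z + ε * Complex.I) else R (z - ε * Complex.I)

lemma weight_le_weight (hα : 0 ≤ α) {z w : ℂ} (hre : w.re = z.re) (hz : z.im ≠ 0)
    (him : |z.im| ≤ |w.im|) : weight α w ≤ weight α z := by
  have h0 : 0 < |z.im| := abs_pos.2 hz
  have h0' : 0 < |w.im| := h0.trans_le him
  have hn : ∀ u : ℂ, bracket u ^ 2 = 1 + u.re ^ 2 + |u.im| ^ 2 := fun u => by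
    rw [bracket_sq, ← Complex.normSq_eq_norm_sq, Complex.normSq_apply, sq_abs]; ring
  have hsq : |z.im| ^ 2 ≤ |w.im| ^ 2 := by gcongr
  have hb : bracket w / |w.im| ≤ bracket z / |z.im| := by
    rw [div_le_div_iff₀ h0' h0]
    refine (pow_le_pow_iff_left₀ (mul_nonneg (bracket_pos _).le h0.le)
      (mul_nonneg (bracket_pos _).le h0'.le) two_ne_zero).1 ?_
    rw [mul_pow, mul_pow, hn, hn, hre]
    nlinarith [sq_nonneg z.re]
  unfold weight
  have := (bracket_pos w).le
  gcongr

lemma IsResolventLike.nonneg (hR : IsResolventLike α c R) : 0 ≤ c := by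
  have h := (norm_nonneg _).trans (hR.bound Complex.I (by simp))
  have hw : 0 < weight α Complex.I := by
    have := bracket_pos Complex.I
    simp only [weight, Complex.I_im, abs_one, inv_one, one_mul, div_one]
    positivity
  exact nonneg_of_mul_nonneg_left h hw

lemma IsResolventLike.shiftAway (hα : 0 ≤ α) (hR : IsResolventLike α c R) {ε : ℝ} (hε : 0 ≤ ε) :
    IsResolventLike α c (shiftAway R ε) := by
  refine ⟨fun z hz => ?_, fun z hz => ?_⟩
  · rcases lt_or_gt_of_ne hz with h | h
    · have he : HelfferSjostrand.shiftAway R ε =ᶠ[𝓝 z] fun z => R (z - ε * Complex.I) := by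
        filter_upwards [(Complex.continuous_im.tendsto z).eventually_lt_const h] with w hw
        exact if_neg hw.le.not_gt
      refine DifferentiableAt.congr_of_eventuallyEq ?_ he
      refine DifferentiableAt.comp z (hR.differentiableAt _ ?_) (by fun_prop)
      simp only [Complex.sub_im, Complex.mul_im, Complex.ofReal_re, Complex.I_im, mul_one,
        Complex.ofReal_im, Complex.I_re, mul_zero, add_zero]
      linarith
    · have he : HelfferSjostrand.shiftAway R ε =ᶠ[𝓝 z] fun z => R (z + ε * Complex.I) := by
        filter_upwards [(Complex.continuous_im.tendsto z).eventually_const_lt h] with w hw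
        exact if_pos hw
      refine DifferentiableAt.congr_of_eventuallyEq ?_ he
      refine DifferentiableAt.comp z (hR.differentiableAt _ ?_) (by fun_prop)
      simp only [Complex.add_im, Complex.mul_im, Complex.ofReal_re, Complex.I_im, mul_one,
        Complex.ofReal_im, Complex.I_re, mul_zero, add_zero]
      linarith
  · unfold HelfferSjostrand.shiftAway
    split_ifs with h
    · have him : (z + ε * Complex.I).im = z.im + ε := by simp
      refine (hR.bound _ (by rw [him]; linarith)).trans ?_
      refine mul_le_mul_of_nonneg_left (weight_le_weight hα (by simp) hz ?_) hR.nonneg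
      rw [him, abs_of_pos h, abs_of_pos (by linarith)]
      linarith
    · have h' : z.im < 0 := lt_of_le_of_ne (not_lt.1 h) hz
      have him : (z - ε * Complex.I).im = z.im - ε := by simp
      refine (hR.bound _ (by rw [him]; linarith)).trans ?_
      refine mul_le_mul_of_nonneg_left (weight_le_weight hα (by simp) hz ?_) hR.nonneg
      rw [him, abs_of_neg h', abs_of_neg (by linarith)]
      linarith

/-- Green's formula on both half planes: after moving the resolvent away from the real axis, the
Helffer–Sjöstrand integral only sees the boundary values `F(x, 0)`. -/
lemma integral_smul_jump (hF : IsCompactC1 F)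
    (hR : ∀ z : ℂ, z.im ≠ 0 → DifferentiableAt ℂ R z) {ε : ℝ} (hε : 0 < ε) :
    ∫ x : ℝ, F x 0 • jump R ε x =
      (-(1 / Real.pi : ℝ) : ℂ) • ∫ z, dbar F z • shiftAway R ε z := by
  obtain ⟨M, hM, hzero⟩ := hF.eq_zero
  have hFM : ∀ x t : ℝ, |t| = M + 1 → F x t = 0 := fun x t ht => hzero x t (Or.inr (by linarith))
  have hU : ∀ z : ℂ, 0 ≤ z.im → z.im ≤ M + 1 →
      DifferentiableAt ℂ (fun z => R (z + ε * Complex.I)) z := fun z h _ => by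
    refine DifferentiableAt.comp z (hR _ ?_) (by fun_prop)
    simp only [Complex.add_im, Complex.mul_im, Complex.ofReal_re, Complex.I_im, mul_one,
      Complex.ofReal_im, Complex.I_re, mul_zero, add_zero]
    linarith
  have hL : ∀ z : ℂ, -(M + 1) ≤ z.im → z.im ≤ 0 →
      DifferentiableAt ℂ (fun z => R (z - ε * Complex.I)) z := fun z _ h => by
    refine DifferentiableAt.comp z (hR _ ?_) (by fun_prop)
    simp only [Complex.sub_im, Complex.mul_im, Complex.ofReal_re, Complex.I_im, mul_one,
      Complex.ofReal_im, Complex.I_re, mul_zero, add_zero]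
    linarith
  have gU := integral_dbar_smul_strip hF (by linarith : (0 : ℝ) ≤ M + 1) hU
  have gL := integral_dbar_smul_strip hF (by linarith : -(M + 1) ≤ (0 : ℝ)) hL
  have iU := integrableOn_dbar_smul_strip hF fun z hz =>
    (hU z hz.1 hz.2).continuousAt.continuousWithinAt
  have iL := integrableOn_dbar_smul_strip hF fun z hz =>
    (hL z hz.1 hz.2).continuousAt.continuousWithinAt
  simp only [hFM _ (M + 1) (abs_of_pos (by linarith)),
    hFM _ (-(M + 1)) (by rw [abs_neg, abs_of_pos (by linarith)]),
    zero_smul, integral_zero, sub_zero, zero_sub, Complex.ofReal_zero, zero_mul, add_zero] at gU gL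
  set SU : Set ℂ := {z : ℂ | 0 < z.im ∧ z.im ≤ M + 1} with hSU
  set SL : Set ℂ := {z : ℂ | -(M + 1) < z.im ∧ z.im ≤ 0} with hSL
  have mU : MeasurableSet SU := (measurableSet_lt measurable_const Complex.measurable_im).inter
      (measurableSet_le Complex.measurable_im measurable_const)
  have mL : MeasurableSet SL := (measurableSet_lt measurable_const Complex.measurable_im).inter
      (measurableSet_le Complex.measurable_im measurable_const)
  have eU : EqOn (fun z => dbar F z • R (z + ε * Complex.I))
    (fun z => dbar F z • shiftAway R ε z) SU :=
    fun z hz => by simp [shiftAway, hz.1]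
  have eL : EqOn (fun z => dbar F z • R (z - ε * Complex.I))
    (fun z => dbar F z • shiftAway R ε z) SL :=
    fun z hz => by simp [shiftAway, not_lt.2 hz.2]
  rw [setIntegral_congr_fun mU eU] at gU
  rw [setIntegral_congr_fun mL eL] at gL
  have hsplit : ∫ z, dbar F z • shiftAway R ε z =
      (∫ z in SU, dbar F z • shiftAway R ε z) + ∫ z in SL, dbar F z • shiftAway R ε z := by
    rw [← setIntegral_union _ mL (iU.congr_fun eU mU) (iL.congr_fun eL mL)]
    · refine (setIntegral_eq_integral_of_forall_compl_eq_zero fun z hz => ?_).symm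
      rw [dbar_eq_zero_of_bound hzero (Or.inr ?_), zero_smul]
      by_contra! h
      rcases lt_or_ge 0 z.im with h0 | h0
      · exact hz (Or.inl ⟨h0, by linarith [(abs_le.1 h).2]⟩)
      · exact hz (Or.inr ⟨by linarith [(abs_le.1 h).1], h0⟩)
    · exact Set.disjoint_left.2 fun z h1 h2 => absurd h1.1 (not_lt.2 h2.2)
  have cF : Continuous fun x : ℝ => F x 0 :=
    hF.contDiff.continuous.comp (continuous_id.prodMk continuous_const)
  have sF : HasCompactSupport fun x : ℝ => F x 0 := by
    refine HasCompactSupport.intro (isCompact_Icc (a := -M) (b := M)) fun x hx => hzero x 0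
      (Or.inl ?_)
    by_contra! h
    exact hx (abs_le.1 h)
  have iF : ∀ t : ℝ, t ≠ 0 → Integrable fun x : ℝ => F x 0 • R (x + t * Complex.I) := by
    intro t ht
    refine Continuous.integrable_of_hasCompactSupport (cF.smul ?_) sF.smul_right
    refine continuous_iff_continuousAt.2 fun x => ?_
    have : ContinuousAt R (x + t * Complex.I) := (hR _ (by simpa using ht)).continuousAt
    exact ContinuousAt.comp (f := fun x : ℝ => (x + t * Complex.I : ℂ)) this (by fun_prop)
  have iF2 : Integrable fun x : ℝ => F x 0 • R (x - ε * Complex.I) := by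
    simpa [sub_eq_add_neg] using iF (-ε) (neg_ne_zero.2 hε.ne')
  rw [hsplit, smul_add]
  have hj : ∀ x : ℝ, F x 0 • jump R ε x = (1 / (2 * Real.pi * Complex.I) : ℂ) •
      (F x 0 • R (x - ε * Complex.I) - F x 0 • R (x + ε * Complex.I)) := fun x => by
    rw [jump, smul_comm, smul_sub (F x 0)]
  simp only [hj]
  rw [integral_smul, integral_sub iF2 (iF ε hε.ne'), gU,
    show ∫ x : ℝ, F x 0 • R (x - ε * Complex.I) =
        -((2 * Complex.I) • ∫ z in SL, dbar F z • shiftAway R ε z)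
      by rw [← gL, neg_neg], smul_sub, smul_neg, smul_smul, smul_smul]
  have hpi : (Real.pi : ℂ) ≠ 0 := by exact_mod_cast Real.pi_ne_zero
  have : (1 / (2 * Real.pi * Complex.I) : ℂ) * (2 * Complex.I) = (1 / Real.pi : ℝ) := by
    push_cast
    field_simp [Complex.I_ne_zero]
  rw [this, neg_smul, neg_smul]
  abel

/-- For a compactly supported extension `F` of `f = F(·, 0)`, the Helffer–Sjöstrand integral is the
limit of `∫ f(x) (2πi)⁻¹ (R(x - iε) - R(x + iε)) dx`. In particular it depends on `f` only. -/
lemma tendsto_integral_smul_jump (hα : 0 ≤ α) (hF : IsCompactC1 F) (hR : IsResolventLike α c R)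
    (hI : Integrable fun z => ‖dbar F z‖ * weight α z) :
    Tendsto (fun ε : ℝ => ∫ x : ℝ, F x 0 • jump R ε x) (𝓝[>] 0)
      (𝓝 ((-(1 / Real.pi : ℝ) : ℂ) • ∫ z, dbar F z • R z)) := by
  have hev : (fun ε : ℝ => (-(1 / Real.pi : ℝ) : ℂ) • ∫ z, dbar F z • shiftAway R ε z)
      =ᶠ[𝓝[>] 0] fun ε : ℝ => ∫ x : ℝ, F x 0 • jump R ε x := by
    filter_upwards [self_mem_nhdsWithin] with ε hε
    exact (integral_smul_jump hF hR.differentiableAt hε).symm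
  refine Tendsto.congr' hev (Tendsto.const_smul ?_ _)
  refine tendsto_integral_filter_of_dominated_convergence
    (fun z => c * (‖dbar F z‖ * weight α z)) ?_ ?_ (hI.const_mul c) ?_
  · filter_upwards [self_mem_nhdsWithin] with ε hε
    exact (continuous_dbar hF.contDiff).aestronglyMeasurable.smul
      (hR.shiftAway hα (le_of_lt hε)).aestronglyMeasurable
  · filter_upwards [self_mem_nhdsWithin] with ε hε
    filter_upwards [ae_im_ne_zero] with z hz
    rw [norm_smul]
    calc _ ≤ ‖dbar F z‖ * (c * weight α z) := by
          gcongr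
          exact (hR.shiftAway hα (le_of_lt hε)).bound z hz
      _ = _ := by ring
  · filter_upwards [ae_im_ne_zero] with z hz
    refine Tendsto.const_smul ?_ _
    have hc : ContinuousAt R z := (hR.differentiableAt z hz).continuousAt
    unfold shiftAway
    have hplus : Tendsto (fun ε : ℝ => z + ε * Complex.I) (𝓝[>] 0) (𝓝 z) := by
      have : Continuous fun ε : ℝ => z + ε * Complex.I := by fun_prop
      simpa using (this.tendsto 0).mono_left nhdsWithin_le_nhds
    have hminus : Tendsto (fun ε : ℝ => z - ε * Complex.I) (𝓝[>] 0) (𝓝 z) := by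
      have : Continuous fun ε : ℝ => z - ε * Complex.I := by fun_prop
      simpa using (this.tendsto 0).mono_left nhdsWithin_le_nhds
    split_ifs with h
    · exact hc.tendsto.comp hplus
    · exact hc.tendsto.comp hminus

end Jump

/-! ### The Cauchy–Pompeiu formula on the real axis -/

lemma isResolventLike_inv_sub {α : ℝ} (hα : 0 ≤ α) (t : ℝ) :
    IsResolventLike α 1 fun z : ℂ => (z - t)⁻¹ := by
  have hne : ∀ z : ℂ, z.im ≠ 0 → z - t ≠ 0 := fun z hz h => hz (by
    have := congrArg Complex.im h
    simpa using this)
  refine ⟨fun z hz => (differentiableAt_id.sub_const _).inv (hne z hz), fun z hz => ?_⟩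
  have h0 : 0 < |z.im| := abs_pos.2 hz
  have h1 : |z.im| ≤ ‖z - t‖ := by simpa using Complex.abs_im_le_norm (z - t)
  have h2 : 1 ≤ bracket z / |z.im| := by
    rw [one_le_div h0]
    exact (Complex.abs_im_le_norm z).trans (norm_le_bracket z)
  rw [norm_inv, one_mul, weight]
  calc ‖z - t‖⁻¹ ≤ |z.im|⁻¹ := by gcongr
    _ ≤ _ := le_mul_of_one_le_right (by positivity) (Real.one_le_rpow h2 hα)

/-- The Poisson kernel is an approximate identity. -/
lemma tendsto_integral_mul_jump_inv_sub {φ : ℝ → ℂ} (hφ : Continuous φ) {B : ℝ}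
    (hB : ∀ x, ‖φ x‖ ≤ B) (t : ℝ) :
    Tendsto (fun ε : ℝ => ∫ x : ℝ, φ x • jump (fun z : ℂ => (z - t)⁻¹) ε x) (𝓝[>] 0)
      (𝓝 (φ t)) := by
  have hj : ∀ ε : ℝ, 0 < ε → ∫ x : ℝ, φ x • jump (fun z : ℂ => (z - t)⁻¹) ε x =
      ∫ s : ℝ, φ (t + ε * s) * ((Real.pi⁻¹ * (1 + s ^ 2)⁻¹ : ℝ) : ℂ) := by
    intro ε hε
    have h1 : ∀ s : ℝ, φ (t + ε * s) * ((Real.pi⁻¹ * (1 + s ^ 2)⁻¹ : ℝ) : ℂ) =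
        (fun u : ℝ => ε • (φ (t + u) • jump (fun z : ℂ => (z - t)⁻¹) ε (t + u))) (ε * s) := by
      intro s
      have hεc : (ε : ℂ) ≠ 0 := by exact_mod_cast hε.ne'
      have hs : (1 + (s : ℂ) ^ 2) ≠ 0 := by
        have : (1 + s ^ 2 : ℝ) ≠ 0 := by positivity
        exact_mod_cast this
      have hs1 : (s : ℂ) - Complex.I ≠ 0 := fun h => hs (by
        linear_combination (s + Complex.I) * h + Complex.I_sq)
      have hs2 : (s : ℂ) + Complex.I ≠ 0 := fun h => hs (by
        linear_combination (s - Complex.I) * h + Complex.I_sq)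
      simp only [jump, smul_eq_mul, Complex.real_smul]
      push_cast
      rw [show (t : ℂ) + ε * s - ε * Complex.I - t = ε * (s - Complex.I) by ring,
        show (t : ℂ) + ε * s + ε * Complex.I - t = ε * (s + Complex.I) by ring]
      have hI := Complex.I_ne_zero
      have : (1 + (s : ℂ) ^ 2) = (s - Complex.I) * (s + Complex.I) := by
        linear_combination Complex.I_sq
      rw [this]
      field_simp
      ring
    rw [integral_congr_ae (ae_of_all _ h1), Measure.integral_comp_mul_left
      (fun u : ℝ => ε • (φ (t + u) • jump (fun z : ℂ => (z - t)⁻¹) ε (t + u))), integral_smul,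
        smul_smul, abs_inv, abs_of_pos hε,
      inv_mul_cancel₀ hε.ne', one_smul,
      integral_add_left_eq_self (fun u => φ u • jump (fun z : ℂ => (z - t)⁻¹) ε u) t]
  have hlim : Tendsto (fun ε : ℝ => ∫ s : ℝ, φ (t + ε * s) * ((Real.pi⁻¹ * (1 + s ^ 2)⁻¹ : ℝ) : ℂ))
      (𝓝[>] 0) (𝓝 (∫ s : ℝ, φ t * ((Real.pi⁻¹ * (1 + s ^ 2)⁻¹ : ℝ) : ℂ))) := by
    refine tendsto_integral_filter_of_dominated_convergence
      (fun s => B * (Real.pi⁻¹ * (1 + s ^ 2)⁻¹)) ?_ ?_ ?_ ?_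
    · refine Eventually.of_forall fun ε => Continuous.aestronglyMeasurable ?_
      have : Continuous fun s : ℝ => Real.pi⁻¹ * (1 + s ^ 2)⁻¹ :=
        continuous_const.mul ((by fun_prop : Continuous fun s : ℝ => 1 + s ^ 2).inv₀
          fun s => by positivity)
      fun_prop
    · refine Eventually.of_forall fun ε => ae_of_all _ fun s => ?_
      rw [norm_mul, Complex.norm_real, Real.norm_of_nonneg (by positivity)]
      gcongr
      exact hB _
    · exact (integrable_inv_one_add_sq.const_mul _).const_mul _
    · refine ae_of_all _ fun s => Tendsto.mul_const _ ?_
      have : Continuous fun ε : ℝ => φ (t + ε * s) := by fun_prop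
      simpa using (this.tendsto 0).mono_left nhdsWithin_le_nhds
  have hval : ∫ s : ℝ, φ t * ((Real.pi⁻¹ * (1 + s ^ 2)⁻¹ : ℝ) : ℂ) = φ t := by
    rw [integral_const_mul, integral_complex_ofReal, integral_const_mul,
      integral_univ_inv_one_add_sq, inv_mul_cancel₀ Real.pi_ne_zero, Complex.ofReal_one, mul_one]
  rw [hval] at hlim
  refine hlim.congr' ?_
  filter_upwards [self_mem_nhdsWithin] with ε hε
  exact (hj ε hε).symm

/-- The properties of the restriction to the real axis that the dominated convergence arguments
need. -/
lemma IsCompactC1.restrict_real_axis {F : ℝ → ℝ → ℂ} (hF : IsCompactC1 F) :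
    Continuous (fun x : ℝ => F x 0) ∧ HasCompactSupport (fun x : ℝ => F x 0) ∧
      ∃ B : ℝ, ∀ x, ‖F x 0‖ ≤ B := by
  obtain ⟨M, hM, hzero⟩ := hF.eq_zero
  have cF : Continuous fun x : ℝ => F x 0 :=
    hF.contDiff.continuous.comp (continuous_id.prodMk continuous_const)
  have sF : HasCompactSupport fun x : ℝ => F x 0 := by
    refine HasCompactSupport.intro (isCompact_Icc (a := -M) (b := M)) fun x hx => hzero x 0
      (Or.inl ?_)
    by_contra! h
    exact hx (abs_le.1 h)
  exact ⟨cF, sF, sF.exists_bound_of_continuous cF⟩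

lemma integral_dbar_smul_inv_sub {α : ℝ} (hα : 0 ≤ α) {F : ℝ → ℝ → ℂ} (hF : IsCompactC1 F)
    (hI : Integrable fun z => ‖dbar F z‖ * weight α z) (t : ℝ) :
    (-(1 / Real.pi : ℝ) : ℂ) • ∫ z : ℂ, dbar F z • (z - t)⁻¹ = F t 0 := by
  obtain ⟨cF, -, B, hB⟩ := hF.restrict_real_axis
  exact tendsto_nhds_unique (tendsto_integral_smul_jump hα hF (isResolventLike_inv_sub hα t) hI)
    (tendsto_integral_mul_jump_inv_sub cF hB t)

lemma integral_dbar_eq_zero {F : ℝ → ℝ → ℂ} (hF : IsCompactC1 F) : ∫ z : ℂ, dbar F z = 0 := by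
  have h := integral_smul_jump (R := fun _ : ℂ => (1 : ℂ)) hF
    (fun z _ => differentiableAt_const _) one_pos
  have hpi : (-(1 / Real.pi : ℝ) : ℂ) ≠ 0 := by
    simp [Real.pi_ne_zero]
  simpa [jump, shiftAway, hpi, Real.pi_ne_zero] using h.symm

/-! ### Symbols on the line -/

lemma contDiffAt_of_infty {f : ℝ → ℂ} (hf : ContDiff ℝ ∞ f) (n : ℕ) (x : ℝ) :
    ContDiffAt ℝ n f x :=
  hf.contDiffAt.of_le (by exact_mod_cast le_top)

lemma norm_iteratedDeriv_mul_le {f g : ℝ → ℂ} (hf : ContDiff ℝ ∞ f) (hg : ContDiff ℝ ∞ g)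
    {β β' : ℝ} {c d : ℕ → ℝ} {x : ℝ}
    (hc : ∀ n, ‖iteratedDeriv n f x‖ ≤ c n * bracket x ^ (β - n))
    (hd : ∀ n, ‖iteratedDeriv n g x‖ ≤ d n * bracket x ^ (β' - n)) (n : ℕ) :
    ‖iteratedDeriv n (f * g) x‖ ≤
      (∑ i ∈ Finset.range (n + 1), (n.choose i : ℝ) * (c i * d (n - i))) *
        bracket x ^ (β + β' - n) := by
  rw [iteratedDeriv_mul (contDiffAt_of_infty hf n x) (contDiffAt_of_infty hg n x), Finset.sum_mul]
  refine (norm_sum_le _ _).trans (Finset.sum_le_sum fun i hi => ?_)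
  have hi' : i ≤ n := by simpa [Nat.lt_succ_iff] using hi
  have hp : bracket x ^ (β + β' - n) = bracket x ^ (β - i) * bracket x ^ (β' - (n - i : ℕ)) := by
    rw [← Real.rpow_add (bracket_pos x), Nat.cast_sub hi']
    congr 1; ring
  have h3 := mul_le_mul (hc i) (hd (n - i)) (norm_nonneg _) ((norm_nonneg _).trans (hc i))
  rw [norm_mul, norm_mul, hp, Complex.norm_natCast, mul_assoc]
  calc _ ≤ (n.choose i : ℝ) * (c i * bracket x ^ (β - i) *
        (d (n - i) * bracket x ^ (β' - (n - i : ℕ)))) := by gcongr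
    _ = _ := by ring

lemma IsSymbol.mono {β β' : ℝ} (h : β ≤ β') {f : ℝ → ℂ} (hf : IsSymbol β f) : IsSymbol β' f := by
  refine ⟨hf.1, fun n => ?_⟩
  obtain ⟨c, hc⟩ := hf.2 n
  refine ⟨|c|, fun x => (hc x).trans ?_⟩
  have h0 := Real.rpow_pos_of_pos (bracket_pos x) (β - n)
  have h1 : bracket x ^ (β - n) ≤ bracket x ^ (β' - n) :=
    Real.rpow_le_rpow_of_exponent_le (one_le_bracket x) (by linarith)
  exact mul_le_mul (le_abs_self c) h1 h0.le (abs_nonneg c)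

lemma IsSymbol.add {β : ℝ} {f g : ℝ → ℂ} (hf : IsSymbol β f) (hg : IsSymbol β g) :
    IsSymbol β (f + g) := by
  refine ⟨hf.1.add hg.1, fun n => ?_⟩
  obtain ⟨c, hc⟩ := hf.2 n
  obtain ⟨d, hd⟩ := hg.2 n
  refine ⟨c + d, fun x => ?_⟩
  rw [iteratedDeriv_add (contDiffAt_of_infty hf.1 n x) (contDiffAt_of_infty hg.1 n x), add_mul]
  exact (norm_add_le _ _).trans (add_le_add (hc x) (hd x))

lemma IsSymbol.smul {β : ℝ} (a : ℂ) {f : ℝ → ℂ} (hf : IsSymbol β f) : IsSymbol β (a • f) := by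
  refine ⟨hf.1.const_smul a, fun n => ?_⟩
  obtain ⟨c, hc⟩ := hf.2 n
  refine ⟨‖a‖ * c, fun x => ?_⟩
  rw [iteratedDeriv_const_smul_field, norm_smul, mul_assoc]
  exact mul_le_mul_of_nonneg_left (hc x) (norm_nonneg a)

lemma IsSymbol.mul {β β' : ℝ} {f g : ℝ → ℂ} (hf : IsSymbol β f) (hg : IsSymbol β' g) :
    IsSymbol (β + β') (f * g) := by
  choose c hc using hf.2
  choose d hd using hg.2
  exact ⟨hf.1.mul hg.1, fun n => ⟨_, fun x =>
    norm_iteratedDeriv_mul_le hf.1 hg.1 (fun n => hc n x) (fun n => hd n x) n⟩⟩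

lemma SlowDecay.add {f g : ℝ → ℂ} (hf : f ∈ SlowDecay) (hg : g ∈ SlowDecay) :
    f + g ∈ SlowDecay := by
  obtain ⟨β, hβ, hf⟩ := hf
  obtain ⟨β', hβ', hg⟩ := hg
  exact ⟨max β β', max_lt hβ hβ', (hf.mono (le_max_left _ _)).add (hg.mono (le_max_right _ _))⟩

lemma SlowDecay.smul (a : ℂ) {f : ℝ → ℂ} (hf : f ∈ SlowDecay) : a • f ∈ SlowDecay := by
  obtain ⟨β, hβ, hf⟩ := hf
  exact ⟨β, hβ, hf.smul a⟩

lemma SlowDecay.mul {f g : ℝ → ℂ} (hf : f ∈ SlowDecay) (hg : g ∈ SlowDecay) :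
    f * g ∈ SlowDecay := by
  obtain ⟨β, hβ, hf⟩ := hf
  obtain ⟨β', hβ', hg⟩ := hg
  exact ⟨β + β', add_neg hβ hβ', hf.mul hg⟩

lemma SlowDecay.sub {f g : ℝ → ℂ} (hf : f ∈ SlowDecay) (hg : g ∈ SlowDecay) :
    f - g ∈ SlowDecay := by
  have := SlowDecay.add hf (SlowDecay.smul (-1) hg)
  rwa [neg_one_smul, ← sub_eq_add_neg] at this

lemma SlowDecay.contDiff {f : ℝ → ℂ} (hf : f ∈ SlowDecay) : ContDiff ℝ ∞ f := by
  obtain ⟨β, hβ, hf⟩ := hf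
  exact hf.1

lemma iteratedDeriv_eq_zero_of_notMem_tsupport {f : ℝ → ℂ} {x : ℝ} (hx : x ∉ tsupport f) (n : ℕ) :
    iteratedDeriv n f x = 0 := by
  have h := ((notMem_tsupport_iff_eventuallyEq.1 hx).iteratedDeriv n).self_of_nhds
  rw [h]
  have : (0 : ℝ → ℂ) = fun _ => 0 := rfl
  rw [this, iteratedDeriv_const]
  split_ifs <;> rfl

lemma hasCompactSupport_iteratedDeriv {f : ℝ → ℂ} (hs : HasCompactSupport f) (n : ℕ) :
    HasCompactSupport (iteratedDeriv n f) :=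
  HasCompactSupport.intro hs fun _ hx => iteratedDeriv_eq_zero_of_notMem_tsupport hx n

lemma isSymbol_of_hasCompactSupport {f : ℝ → ℂ} (hf : ContDiff ℝ ∞ f) (hs : HasCompactSupport f)
    (β : ℝ) : IsSymbol β f := by
  refine ⟨hf, fun n => ?_⟩
  have hc : Continuous fun x : ℝ => bracket x ^ ((n : ℝ) - β) :=
    continuous_bracket.rpow_const fun x => Or.inl (bracket_pos x).ne'
  have hcont : Continuous fun x : ℝ => bracket x ^ ((n : ℝ) - β) • iteratedDeriv n f x :=
    hc.smul (contDiff_iteratedDeriv hf n).continuous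
  obtain ⟨C, hC⟩ := (hasCompactSupport_iteratedDeriv hs n).smul_left (f := fun x : ℝ =>
    bracket x ^ ((n : ℝ) - β)) |>.exists_bound_of_continuous hcont
  refine ⟨C, fun x => ?_⟩
  have hb := Real.rpow_pos_of_pos (bracket_pos x) ((n : ℝ) - β)
  have h := hC x
  simp only [Pi.smul_apply', norm_smul, Real.norm_of_nonneg hb.le] at h
  rw [show β - n = -((n : ℝ) - β) by ring, Real.rpow_neg (bracket_pos x).le, ← div_eq_mul_inv,
    le_div_iff₀ hb]
  linarith

lemma mem_slowDecay_of_hasCompactSupport {f : ℝ → ℂ} (hf : ContDiff ℝ ∞ f)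
    (hs : HasCompactSupport f) : f ∈ SlowDecay :=
  ⟨-1, by norm_num, isSymbol_of_hasCompactSupport hf hs _⟩

lemma integrable_bracket_rpow {β : ℝ} (hβ : β < 0) :
    Integrable fun x : ℝ => bracket x ^ (β - 1) := by
  have h := integrable_rpow_neg_one_add_norm_sq (E := ℝ) (μ := volume) (r := 1 - β)
    (by rw [Module.finrank_self]; push_cast; linarith)
  refine h.congr (ae_of_all _ fun x => ?_)
  simp only [bracket]
  rw [Real.sqrt_eq_rpow, ← Real.rpow_mul (by positivity)]
  congr 1
  ring

lemma symbolSum_le {f : ℝ → ℂ} {β : ℝ} {c : ℕ → ℝ} {x : ℝ} {k : ℕ}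
    (hc : ∀ n ≤ k, ‖iteratedDeriv n f x‖ ≤ c n * bracket x ^ (β - n)) :
    symbolSum k f x ≤ (∑ r ∈ Finset.range (k + 1), c r) * bracket x ^ (β - 1) := by
  rw [symbolSum, Finset.sum_mul]
  refine Finset.sum_le_sum fun r hr => ?_
  have hr' : r ≤ k := by simpa [Nat.lt_succ_iff] using hr
  have := Real.rpow_nonneg (bracket_pos x).le ((r : ℝ) - 1)
  calc _ ≤ c r * bracket x ^ (β - r) * bracket x ^ ((r : ℝ) - 1) := by gcongr; exact hc r hr'
    _ = _ := by rw [mul_assoc, ← Real.rpow_add (bracket_pos x)]; congr 2; ring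

lemma continuous_symbolSum {f : ℝ → ℂ} (hf : ContDiff ℝ ∞ f) (k : ℕ) :
    Continuous (symbolSum k f) :=
  continuous_finsetSum _ fun r _ => (contDiff_iteratedDeriv hf r).continuous.norm.mul
    (continuous_bracket.rpow_const fun x => Or.inl (bracket_pos x).ne')

lemma integrable_symbolSum {f : ℝ → ℂ} (hf : f ∈ SlowDecay) (k : ℕ) :
    Integrable (symbolSum k f) := by
  obtain ⟨β, hβ, hf⟩ := hf
  choose c hc using hf.2
  refine ((integrable_bracket_rpow hβ).const_mul (∑ r ∈ Finset.range (k + 1), c r)).mono'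
    (continuous_symbolSum hf.1 k).aestronglyMeasurable (ae_of_all _ fun x => ?_)
  rw [Real.norm_of_nonneg (symbolSum_nonneg _ _ _)]
  exact symbolSum_le fun n _ => hc n x

/-- Dilates `χ(x / L)`, `L ≥ 1`, of a cut-off are symbols of order `0` with constants independent of
`L`. -/
lemma IsCutoff.exists_iteratedDeriv_dilate_le {χ : ℝ → ℂ} (hχ : IsCutoff χ) :
    ∃ c : ℕ → ℝ, ∀ L : ℝ, 1 ≤ L → ∀ (n : ℕ) (x : ℝ),
      ‖iteratedDeriv n (fun x => χ (L⁻¹ * x)) x‖ ≤ c n * bracket x ^ ((0 : ℝ) - n) := by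
  have hs := hχ.isCutoffAt.hasCompactSupport
  choose B hB using fun n => (hasCompactSupport_iteratedDeriv hs n).exists_bound_of_continuous
    (contDiff_iteratedDeriv hχ.smooth n).continuous
  refine ⟨fun n => 3 ^ n * B n, fun L hL n x => ?_⟩
  have hL0 : 0 < L := by linarith
  have hb := bracket_pos x
  rw [iteratedDeriv_comp_const_smul (hχ.smooth.of_le (by exact_mod_cast le_top)), norm_smul,
    zero_sub, Real.rpow_neg hb.le, Real.rpow_natCast, norm_pow, norm_inv,
    Real.norm_of_nonneg hL0.le]
  have hB0 : 0 ≤ B n := (norm_nonneg _).trans (hB n 0)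
  by_cases hx : |x| ≤ 2 * L
  · have hbL : bracket x ≤ 3 * L := by
      refine Real.sqrt_le_iff.2 ⟨by positivity, ?_⟩
      have : ‖x‖ ^ 2 ≤ (2 * L) ^ 2 := by rw [Real.norm_eq_abs]; gcongr
      nlinarith
    have h1 : L⁻¹ ≤ 3 * (bracket x)⁻¹ := by
      rw [← div_eq_mul_inv, inv_eq_one_div, div_le_div_iff₀ hL0 hb]
      linarith
    calc _ ≤ (3 * (bracket x)⁻¹) ^ n * B n := by gcongr; exact hB n _
      _ = _ := by rw [mul_pow, inv_pow]; ring
  · have hnot : L⁻¹ * x ∉ tsupport χ := by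
      rw [notMem_tsupport_iff_eventuallyEq]
      have h2 : 2 < |L⁻¹ * x| := by
        rw [abs_mul, abs_of_pos (inv_pos.2 hL0), inv_mul_eq_div, lt_div_iff₀ hL0]
        exact not_le.1 hx
      filter_upwards [(continuous_abs.tendsto _).eventually_const_lt h2] with t ht
      exact hχ.zero t ht.le
    rw [iteratedDeriv_eq_zero_of_notMem_tsupport hnot, norm_zero, mul_zero]
    positivity

/-- `f` multiplied by the cut-off `χ(x / (m + 1))`. -/
def cutMul (χ : ℝ → ℂ) (m : ℕ) (f : ℝ → ℂ) : ℝ → ℂ :=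
  (fun x => χ (((m : ℝ) + 1)⁻¹ * x)) * f

lemma IsCutoff.contDiff_dilate {χ : ℝ → ℂ} (hχ : IsCutoff χ) (a : ℝ) :
    ContDiff ℝ ∞ fun x => χ (a * x) := hχ.smooth.comp (contDiff_const.mul contDiff_id)

lemma contDiff_cutMul {χ f : ℝ → ℂ} (hχ : IsCutoff χ) (hf : ContDiff ℝ ∞ f) (m : ℕ) :
    ContDiff ℝ ∞ (cutMul χ m f) := (hχ.contDiff_dilate _).mul hf

lemma IsCutoff.hasCompactSupport_dilate {χ : ℝ → ℂ} (hχ : IsCutoff χ) (m : ℕ) :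
    HasCompactSupport fun x => χ (((m : ℝ) + 1)⁻¹ * x) := by
  have hm : (0 : ℝ) < m + 1 := by positivity
  refine HasCompactSupport.intro (isCompact_Icc (a := -(2 * ((m : ℝ) + 1)))
    (b := 2 * ((m : ℝ) + 1))) fun x hx => hχ.zero _ ?_
  rw [abs_mul, abs_of_pos (inv_pos.2 hm), inv_mul_eq_div, le_div_iff₀ hm]
  by_contra! h
  exact hx (abs_le.1 h.le)

lemma hasCompactSupport_cutMul {χ : ℝ → ℂ} (hχ : IsCutoff χ) (f : ℝ → ℂ) (m : ℕ) :
    HasCompactSupport (cutMul χ m f) := (hχ.hasCompactSupport_dilate m).mul_right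

lemma eventually_cutMul_eq {χ : ℝ → ℂ} (hχ : IsCutoff χ) (f : ℝ → ℂ) (x : ℝ) :
    ∀ᶠ m : ℕ in atTop, cutMul χ m f =ᶠ[𝓝 x] f := by
  obtain ⟨N, hN⟩ := exists_nat_gt |x|
  filter_upwards [eventually_ge_atTop N] with m hm
  have hm0 : (0 : ℝ) < m + 1 := by positivity
  have hlt : |x| < m + 1 := by
    have : (N : ℝ) ≤ m := by exact_mod_cast hm
    linarith
  filter_upwards [(continuous_abs.tendsto x).eventually_lt_const hlt] with t ht
  have : χ (((m : ℝ) + 1)⁻¹ * t) = 1 := by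
    refine hχ.one _ ?_
    rw [abs_mul, abs_of_pos (inv_pos.2 hm0), inv_mul_eq_div, div_le_one hm0]
    exact ht.le
  simp [cutMul, this]

/-! ### The Helffer–Sjöstrand integral as a function of the symbol -/

section Op

variable {Y : Type*} [NormedAddCommGroup Y] [NormedSpace ℂ Y] {R : ℂ → Y} {α c ρ : ℝ}
  {ψ f g : ℝ → ℂ} {n : ℕ}

/-- The Helffer–Sjöstrand integral `-(1/π) ∬ ∂f̃/∂z̄ R(z) dx dy` for a function `R` on `ℂ \ ℝ`. -/
def hsOp (R : ℂ → Y) (n : ℕ) (ψ f : ℝ → ℂ) : Y :=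
  (-(1 / Real.pi : ℝ) : ℂ) • ∫ z : ℂ, dbar (almostAnalytic n ψ f) z • R z

lemma integrable_hsOp (hα : 0 ≤ α) (hR : IsResolventLike α c R) (hψ : IsCutoffAt ρ ψ)
    (hn : α < n) (hf : f ∈ SlowDecay) :
    Integrable fun z : ℂ => dbar (almostAnalytic n ψ f) z • R z :=
  hR.integrable_smul (continuous_dbar_almostAnalytic (SlowDecay.contDiff hf) hψ.smooth
    n).aestronglyMeasurable
    (integrable_dbar_mul_weight hα hψ hn (SlowDecay.contDiff hf) (integrable_symbolSum hf _))

lemma imTaylor_add (hf : ContDiff ℝ ∞ f) (hg : ContDiff ℝ ∞ g) (n : ℕ) (x y : ℝ) :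
    imTaylor n (f + g) x y = imTaylor n f x y + imTaylor n g x y := by
  simp only [imTaylor, ← Finset.sum_add_distrib]
  refine Finset.sum_congr rfl fun r _ => ?_
  rw [iteratedDeriv_add (contDiffAt_of_infty hf r x) (contDiffAt_of_infty hg r x)]
  ring

lemma imTaylor_smul (a : ℂ) (n : ℕ) (x y : ℝ) :
    imTaylor n (a • f) x y = a * imTaylor n f x y := by
  simp only [imTaylor, Finset.mul_sum]
  refine Finset.sum_congr rfl fun r _ => ?_
  rw [iteratedDeriv_const_smul_field, smul_eq_mul]
  ring

lemma dbar_almostAnalytic_add (hψ : ContDiff ℝ ∞ ψ) (hf : ContDiff ℝ ∞ f) (hg : ContDiff ℝ ∞ g)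
    (n : ℕ) (z : ℂ) : dbar (almostAnalytic n ψ (f + g)) z =
      dbar (almostAnalytic n ψ f) z + dbar (almostAnalytic n ψ g) z := by
  rw [dbar_almostAnalytic (f := f + g) (hf.add hg) hψ, dbar_almostAnalytic hf hψ,
    dbar_almostAnalytic hg hψ,
    imTaylor_add hf hg, iteratedDeriv_add (contDiffAt_of_infty hf _ _) (contDiffAt_of_infty hg _ _)]
  ring

lemma dbar_almostAnalytic_smul (hψ : ContDiff ℝ ∞ ψ) (hf : ContDiff ℝ ∞ f) (a : ℂ)
    (n : ℕ) (z : ℂ) : dbar (almostAnalytic n ψ (a • f)) z =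
      a * dbar (almostAnalytic n ψ f) z := by
  rw [dbar_almostAnalytic (f := a • f) (hf.const_smul a) hψ, dbar_almostAnalytic hf hψ,
    imTaylor_smul, iteratedDeriv_const_smul_field, smul_eq_mul]
  ring

lemma hsOp_add (hα : 0 ≤ α) (hR : IsResolventLike α c R) (hψ : IsCutoffAt ρ ψ)
    (hn : α < n) (hf : f ∈ SlowDecay) (hg : g ∈ SlowDecay) :
    hsOp R n ψ (f + g) = hsOp R n ψ f + hsOp R n ψ g := by
  simp only [hsOp, ← smul_add]
  rw [← integral_add (integrable_hsOp hα hR hψ hn hf) (integrable_hsOp hα hR hψ hn hg)]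
  simp only [dbar_almostAnalytic_add hψ.smooth (SlowDecay.contDiff hf) (SlowDecay.contDiff hg),
    add_smul]

lemma hsOp_smul (hψ : IsCutoffAt ρ ψ) (hf : f ∈ SlowDecay) (a : ℂ) :
    hsOp R n ψ (a • f) = a • hsOp R n ψ f := by
  simp only [hsOp, dbar_almostAnalytic_smul hψ.smooth (SlowDecay.contDiff hf), mul_smul,
    integral_smul]
  rw [smul_comm]

lemma exists_norm_hsOp_le (hα : 0 ≤ α) (hψ : IsCutoffAt ρ ψ) (hn : α < n) :
    ∃ C : ℝ, 0 ≤ C ∧ ∀ (Y : Type*) [NormedAddCommGroup Y] [NormedSpace ℂ Y] (R : ℂ → Y) (c : ℝ),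
      IsResolventLike α c R → ∀ f ∈ SlowDecay,
      ‖hsOp R n ψ f‖ ≤ c * C * ∫ x, symbolSum (n + 1) f x := by
  obtain ⟨C, hC, h⟩ := exists_integral_dbar_mul_weight_le hα hψ hn
  refine ⟨1 / Real.pi * C, by positivity, fun Y _ _ R c hR f hf => ?_⟩
  have hI := integrable_dbar_mul_weight hα hψ hn (SlowDecay.contDiff hf) (integrable_symbolSum hf _)
  have hc := hR.nonneg
  have hp : ‖(-(1 / Real.pi : ℝ) : ℂ)‖ = 1 / Real.pi := by
    rw [norm_neg, Complex.norm_real, Real.norm_of_nonneg (by positivity)]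
  rw [hsOp, norm_smul, hp]
  calc _ ≤ 1 / Real.pi * (c * (C * ∫ x, symbolSum (n + 1) f x)) := by
        gcongr
        refine (hR.norm_integral_smul_le hI).trans ?_
        gcongr
        exact h f (SlowDecay.contDiff hf) (integrable_symbolSum hf _)
    _ = _ := by ring

/-- Dominated convergence for the Helffer–Sjöstrand integral. -/
lemma tendsto_hsOp (hα : 0 ≤ α) (hR : IsResolventLike α c R) (hψ : IsCutoffAt ρ ψ) (hn : α < n)
    {ι : Type*} {l : Filter ι} [l.IsCountablyGenerated] {u : ι → ℝ → ℂ}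
    (hu : ∀ᶠ i in l, ContDiff ℝ ∞ (u i)) (hf : ContDiff ℝ ∞ f) {Q : ℝ → ℝ} (hQ : Integrable Q)
    (hb : ∀ᶠ i in l, ∀ x, symbolSum (n + 1) (u i) x ≤ Q x)
    (hlim : ∀ r ≤ n + 1, ∀ x,
      Tendsto (fun i => iteratedDeriv r (u i) x) l (𝓝 (iteratedDeriv r f x))) :
    Tendsto (fun i => hsOp R n ψ (u i)) l (𝓝 (hsOp R n ψ f)) := by
  obtain ⟨A, hA, h⟩ := exists_norm_dbar_mul_weight_le hα hψ n
  have hc := hR.nonneg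
  have hk := (integrable_mul_truncPow (p := n - 1 - α) (by linarith) hQ).1.const_mul (c * A)
  refine Tendsto.const_smul (tendsto_integral_filter_of_dominated_convergence _ ?_ ?_ hk ?_) _
  · filter_upwards [hu] with i hi
    exact (continuous_dbar_almostAnalytic hi hψ.smooth n).aestronglyMeasurable.smul
      hR.aestronglyMeasurable
  · filter_upwards [hu, hb] with i hi hbi
    filter_upwards [ae_im_ne_zero] with z hz
    rw [norm_smul]
    have h0 := truncPow_nonneg (n - 1 - α) (z.im / bracket z.re)
    have hbz := bracket_pos z.re
    calc _ ≤ ‖dbar (almostAnalytic n ψ (u i)) z‖ * (c * weight α z) := by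
          gcongr; exact hR.bound z hz
      _ = c * (‖dbar (almostAnalytic n ψ (u i)) z‖ * weight α z) := by ring
      _ ≤ c * (A * (Q z.re *
          ((bracket z.re)⁻¹ * truncPow (n - 1 - α) (z.im / bracket z.re)))) := by
          refine mul_le_mul_of_nonneg_left ((h _ hi z).trans ?_) hc
          gcongr
          exact hbi z.re
      _ = _ := by ring
  · refine ae_of_all _ fun z => Tendsto.smul_const ?_ _
    rw [dbar_almostAnalytic hf hψ.smooth]
    have hT : Tendsto (fun i => imTaylor n (u i) z.re z.im) l (𝓝 (imTaylor n f z.re z.im)) := by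
      refine tendsto_finsetSum _ fun r hr => Tendsto.div_const (Tendsto.mul_const _ ?_) _
      exact hlim r (by have := Finset.mem_range.1 hr; omega) _
    refine Tendsto.congr' (f₁ := fun i => 1 / 2 *
      (iteratedDeriv (n + 1) (u i) z.re * (Complex.I * z.im) ^ n / (n.factorial : ℂ) *
        ψ (z.im / bracket z.re) +
      imTaylor n (u i) z.re z.im * (deriv ψ (z.im / bracket z.re) *
        (-(z.im * z.re / bracket z.re ^ 3 : ℝ) + Complex.I * (1 / bracket z.re : ℝ))))) ?_ ?_
    · filter_upwards [hu] with i hi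
      rw [dbar_almostAnalytic hi hψ.smooth]
    · exact ((((hlim (n + 1) le_rfl z.re).mul_const _).div_const _).mul_const _ |>.add
        (hT.mul_const _)).const_mul _

lemma tendsto_hsOp_cutMul (hα : 0 ≤ α) (hR : IsResolventLike α c R) (hψ : IsCutoffAt ρ ψ)
    (hn : α < n) {χ : ℝ → ℂ} (hχ : IsCutoff χ) (hf : f ∈ SlowDecay) :
    Tendsto (fun m => hsOp R n ψ (cutMul χ m f)) atTop (𝓝 (hsOp R n ψ f)) := by
  obtain ⟨β, hβ, hf⟩ := hf
  choose d hd using hf.2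
  obtain ⟨e, he⟩ := hχ.exists_iteratedDeriv_dilate_le
  refine tendsto_hsOp hα hR hψ hn (Eventually.of_forall fun m => contDiff_cutMul hχ hf.1 m) hf.1
    ((integrable_bracket_rpow hβ).const_mul (∑ r ∈ Finset.range (n + 1 + 1),
      ∑ i ∈ Finset.range (r + 1), (r.choose i : ℝ) * (e i * d (r - i))))
    (Eventually.of_forall fun m x => ?_) fun r _ x => ?_
  · refine symbolSum_le fun r _ => ?_
    have := norm_iteratedDeriv_mul_le (hχ.contDiff_dilate (((m : ℝ) + 1)⁻¹)) hf.1
      (β := 0) (β' := β) (c := e) (d := d) (x := x)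
      (fun j => he _ (by linarith [(m.cast_nonneg : (0 : ℝ) ≤ m)]) j x)
      (fun j => hd j x) r
    rwa [zero_add] at this
  · refine tendsto_const_nhds.congr' ?_
    filter_upwards [eventually_cutMul_eq hχ f x] with m hm
    exact ((hm.iteratedDeriv r).self_of_nhds).symm

lemma almostAnalytic_zero (hψ : IsCutoffAt ρ ψ) (n : ℕ) (f : ℝ → ℂ) (x : ℝ) :
    almostAnalytic n ψ f x 0 = f x := by
  have h1 : ψ (0 / bracket x) = 1 := hψ.one _ (by simpa using hψ.pos.le)
  rw [almostAnalytic, h1, mul_one, Finset.sum_range_succ']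
  simp

lemma isCompactC1_almostAnalytic (hψ : IsCutoffAt ρ ψ) (hf : ContDiff ℝ ∞ f)
    (hs : HasCompactSupport f) (n : ℕ) : IsCompactC1 (almostAnalytic n ψ f) := by
  refine ⟨(contDiff_almostAnalytic hf hψ.smooth n).of_le (by exact_mod_cast le_top), ?_⟩
  obtain ⟨M, hM⟩ := hs.isBounded.exists_norm_le
  set N := max M 0
  refine ⟨2 * bracket N, by have := bracket_pos N; positivity, fun x y hxy => ?_⟩
  by_cases hx : x ∈ tsupport f
  · have hxN : ‖x‖ ≤ N := (hM x hx).trans (le_max_left _ _)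
    have hN : ‖N‖ = N := Real.norm_of_nonneg (le_max_right _ _)
    have hb : bracket x ≤ bracket N := by
      unfold bracket
      gcongr
      rw [hN]; exact hxN
    rcases hxy with h | h
    · have h1 : N ≤ bracket N := by simpa [hN] using norm_le_bracket N
      have h2 : |x| ≤ N := hxN
      linarith [one_le_bracket N]
    · have h2 : 2 ≤ |y / bracket x| := by
        rw [abs_div, abs_of_pos (bracket_pos x), le_div_iff₀ (bracket_pos x)]
        linarith
      rw [almostAnalytic, hψ.zero _ h2, mul_zero]
  · simp [almostAnalytic, iteratedDeriv_eq_zero_of_notMem_tsupport hx]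

lemma tendsto_jump_hsOp (hα : 0 ≤ α) (hR : IsResolventLike α c R) (hψ : IsCutoffAt ρ ψ)
    (hn : α < n) (hf : ContDiff ℝ ∞ f) (hs : HasCompactSupport f) :
    Tendsto (fun ε : ℝ => ∫ x : ℝ, f x • jump R ε x) (𝓝[>] 0) (𝓝 (hsOp R n ψ f)) := by
  have h := tendsto_integral_smul_jump hα (isCompactC1_almostAnalytic hψ hf hs n) hR
    (integrable_dbar_mul_weight hα hψ hn hf
      (integrable_symbolSum (mem_slowDecay_of_hasCompactSupport hf hs) _))
  unfold hsOp
  simpa only [almostAnalytic_zero hψ] using h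

lemma exists_isCutoff : ∃ χ : ℝ → ℂ, IsCutoff χ := by
  let b : ContDiffBump (0 : ℝ) := ⟨1, 2, by norm_num, by norm_num⟩
  refine ⟨fun x => (b x : ℂ), Complex.ofRealCLM.contDiff.comp b.contDiff, fun s hs => ?_,
    fun s hs => ?_⟩
  · have : b s = 1 := b.one_of_mem_closedBall (by simpa using hs)
    simp [this]
  · have : b s = 0 := b.zero_of_le_dist (by simpa using hs)
    simp [this]

/-- The Helffer–Sjöstrand integral depends neither on the order `n` nor on the cut-off. -/
lemma hsOp_eq_hsOp (hα : 0 ≤ α) (hR : IsResolventLike α c R) (hψ : IsCutoffAt ρ ψ) (hn : α < n)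
    {ρ' : ℝ} {ψ' : ℝ → ℂ} {n' : ℕ} (hψ' : IsCutoffAt ρ' ψ') (hn' : α < n') (hf : f ∈ SlowDecay) :
    hsOp R n ψ f = hsOp R n' ψ' f := by
  obtain ⟨χ, hχ⟩ := exists_isCutoff
  have hm : ∀ m, hsOp R n ψ (cutMul χ m f) = hsOp R n' ψ' (cutMul χ m f) := fun m =>
    tendsto_nhds_unique
      (tendsto_jump_hsOp hα hR hψ hn (contDiff_cutMul hχ (SlowDecay.contDiff hf) m)
        (hasCompactSupport_cutMul hχ f m))
      (tendsto_jump_hsOp hα hR hψ' hn' (contDiff_cutMul hχ (SlowDecay.contDiff hf) m)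
        (hasCompactSupport_cutMul hχ f m))
  have h := tendsto_hsOp_cutMul hα hR hψ hn hχ hf
  simp only [hm] at h
  exact tendsto_nhds_unique h (tendsto_hsOp_cutMul hα hR hψ' hn' hχ hf)

/-- Where `R` is continuous across the real axis, it does not jump. -/
lemma hsOp_eq_zero_of_continuousOn (hα : 0 ≤ α) (hR : IsResolventLike α c R)
    (hψ : IsCutoffAt ρ ψ) (hn : α < n) (hf : ContDiff ℝ ∞ f) (hs : HasCompactSupport f)
    {U : Set ℂ} (hU : IsOpen U) (hRU : ContinuousOn R U)
    (hfU : ∀ x ∈ tsupport f, (x : ℂ) ∈ U) : hsOp R n ψ f = 0 := by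
  refine tendsto_nhds_unique (tendsto_jump_hsOp hα hR hψ hn hf hs) ?_
  set K : Set ℂ := (fun x : ℝ => (x : ℂ)) '' tsupport f
  have hK : IsCompact K := hs.isCompact.image Complex.continuous_ofReal
  obtain ⟨δ, hδ, hKδ⟩ := hK.exists_cthickening_subset_open hU
    (by rintro _ ⟨x, hx, rfl⟩; exact hfU x hx)
  obtain ⟨B, hB⟩ := (hK.cthickening (r := δ)).exists_bound_of_continuousOn (hRU.mono hKδ)
  have hmem : ∀ x ∈ tsupport f, ∀ t : ℝ, |t| ≤ δ →
      (x + t * Complex.I : ℂ) ∈ Metric.cthickening δ K := by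
    intro x hx t ht
    refine Metric.mem_cthickening_of_dist_le _ (x : ℂ) δ K ⟨x, hx, rfl⟩ ?_
    rw [dist_eq_norm]
    simpa using ht
  have hsub : ∀ x ε : ℝ, (x - ε * Complex.I : ℂ) = x + (-ε : ℝ) * Complex.I := fun x ε => by
    push_cast; ring
  have hlim : Tendsto (fun ε : ℝ => ∫ x : ℝ, f x • jump R ε x) (𝓝[>] 0) (𝓝 (∫ x : ℝ, (0 : Y))) := by
    obtain ⟨Bf, hBf⟩ := hs.exists_bound_of_continuous hf.continuous
    refine tendsto_integral_filter_of_dominated_convergence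
      (fun x => ‖f x‖ * (‖(1 / (2 * Real.pi * Complex.I) : ℂ)‖ * (B + B))) ?_ ?_ ?_ ?_
    · filter_upwards [self_mem_nhdsWithin] with ε hε
      refine hf.continuous.aestronglyMeasurable.smul (Continuous.aestronglyMeasurable ?_)
      have hc : ∀ t : ℝ, t ≠ 0 → Continuous fun x : ℝ => R (x + t * Complex.I) := fun t ht =>
        continuous_iff_continuousAt.2 fun x => ContinuousAt.comp
          (f := fun x : ℝ => (x + t * Complex.I : ℂ))
          (hR.differentiableAt _ (by simpa using ht)).continuousAt (by fun_prop)
      unfold jump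
      simp only [hsub]
      exact ((hc _ (neg_ne_zero.2 (ne_of_gt hε))).sub (hc _ (ne_of_gt hε))).const_smul _
    · filter_upwards [Ioo_mem_nhdsGT hδ] with ε hε
      refine ae_of_all _ fun x => ?_
      rw [norm_smul]
      by_cases hx : x ∈ tsupport f
      · gcongr
        rw [jump, norm_smul]
        gcongr
        refine (norm_sub_le _ _).trans (add_le_add (hB _ ?_) (hB _ ?_))
        · rw [hsub]
          exact hmem x hx _ (by rw [abs_neg, abs_of_pos hε.1]; exact hε.2.le)
        · exact hmem x hx _ (by rw [abs_of_pos hε.1]; exact hε.2.le)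
      · rw [image_eq_zero_of_notMem_tsupport hx, norm_zero, zero_mul, zero_mul]
    · exact (hf.continuous.integrable_of_hasCompactSupport hs).norm.mul_const _
    · refine ae_of_all _ fun x => ?_
      by_cases hx : x ∈ tsupport f
      · have hRc : ContinuousAt R x := hRU.continuousAt (hU.mem_nhds (hfU x hx))
        have h1 : Tendsto (fun ε : ℝ => R (x - ε * Complex.I)) (𝓝[>] 0) (𝓝 (R x)) := by
          refine hRc.tendsto.comp ?_
          have : Continuous fun ε : ℝ => (x - ε * Complex.I : ℂ) := by fun_prop
          simpa using (this.tendsto 0).mono_left nhdsWithin_le_nhds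
        have h2 : Tendsto (fun ε : ℝ => R (x + ε * Complex.I)) (𝓝[>] 0) (𝓝 (R x)) := by
          refine hRc.tendsto.comp ?_
          have : Continuous fun ε : ℝ => (x + ε * Complex.I : ℂ) := by fun_prop
          simpa using (this.tendsto 0).mono_left nhdsWithin_le_nhds
        have h3 := ((h1.sub h2).const_smul (1 / (2 * Real.pi * Complex.I) : ℂ)).const_smul (f x)
        simpa [jump] using h3
      · simp [image_eq_zero_of_notMem_tsupport hx]
  simpa using hlim

lemma bracket_le_two_mul_bracket_add {x δ : ℝ} (h0 : 0 ≤ δ) (h1 : δ ≤ 1) :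
    bracket x ≤ 2 * bracket (x + δ) := by
  have h : |x| ≤ |x + δ| + 1 := by
    calc |x| = |(x + δ) - δ| := by ring_nf
      _ ≤ |x + δ| + |δ| := abs_sub _ _
      _ ≤ _ := by rw [abs_of_nonneg h0]; linarith
  refine Real.sqrt_le_iff.2 ⟨by have := bracket_pos (x + δ); positivity, ?_⟩
  rw [mul_pow, bracket_sq, Real.norm_eq_abs, Real.norm_eq_abs]
  nlinarith [abs_nonneg x, abs_nonneg (x + δ), sq_nonneg (|x + δ| - 1)]

lemma tendsto_hsOp_translate (hα : 0 ≤ α) (hR : IsResolventLike α c R) (hψ : IsCutoffAt ρ ψ)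
    (hn : α < n) (hf : f ∈ SlowDecay) :
    Tendsto (fun δ : ℝ => hsOp R n ψ fun x => f (x + δ)) (𝓝[>] 0) (𝓝 (hsOp R n ψ f)) := by
  obtain ⟨β, hβ, hf⟩ := hf
  choose d hd using hf.2
  have hd0 : ∀ r, 0 ≤ d r := fun r => by
    have h1 := (norm_nonneg _).trans (hd r 0)
    exact nonneg_of_mul_nonneg_left h1 (Real.rpow_pos_of_pos (bracket_pos _) _)
  refine tendsto_hsOp hα hR hψ hn
    (Eventually.of_forall fun δ => hf.1.comp (contDiff_id.add contDiff_const)) hf.1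
    ((integrable_bracket_rpow hβ).const_mul
      (∑ r ∈ Finset.range (n + 1 + 1), d r * (2 : ℝ) ^ ((r : ℝ) - β))) ?_ fun r _ x => ?_
  · filter_upwards [Ioo_mem_nhdsGT one_pos] with δ hδ x
    refine symbolSum_le fun r _ => ?_
    rw [iteratedDeriv_comp_add_const]
    refine (hd r (x + δ)).trans ?_
    rw [mul_assoc]
    refine mul_le_mul_of_nonneg_left ?_ (hd0 r)
    have hb := bracket_pos x
    have hb' := bracket_pos (x + δ)
    have hle := bracket_le_two_mul_bracket_add (x := x) hδ.1.le hδ.2.le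
    have h2 : (bracket x / 2) ^ (β - r) = (2 : ℝ) ^ ((r : ℝ) - β) * bracket x ^ (β - r) := by
      rw [Real.div_rpow hb.le (by norm_num), show (r : ℝ) - β = -(β - r) by ring,
        Real.rpow_neg (by norm_num), div_eq_inv_mul]
    rw [← h2]
    refine Real.rpow_le_rpow_of_nonpos (by positivity) (by linarith) ?_
    have : (0 : ℝ) ≤ r := r.cast_nonneg
    linarith
  · rw [show (fun δ : ℝ => iteratedDeriv r (fun x => f (x + δ)) x) =
      fun δ : ℝ => iteratedDeriv r f (x + δ) from funext fun δ => by
        rw [iteratedDeriv_comp_add_const]]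
    have : Continuous fun δ : ℝ => iteratedDeriv r f (x + δ) :=
      (contDiff_iteratedDeriv hf.1 r).continuous.comp (by fun_prop)
    simpa using (this.tendsto 0).mono_left nhdsWithin_le_nhds

/-- If `R` is continuous near the negative half line, then the Helffer–Sjöstrand integral only sees
the values of `f` on `[0, ∞)`: a function vanishing there is a limit of translates supported in
`(-∞, 0)`. -/
lemma hsOp_eq_zero_of_eqOn_Ici (hα : 0 ≤ α) (hR : IsResolventLike α c R)
    (hψ : IsCutoffAt ρ ψ) (hn : α < n) (hf : f ∈ SlowDecay) (hf0 : ∀ x, 0 ≤ x → f x = 0)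
    {U : Set ℂ} (hU : IsOpen U) (hRU : ContinuousOn R U)
    (hneg : ∀ x : ℝ, x < 0 → (x : ℂ) ∈ U) : hsOp R n ψ f = 0 := by
  obtain ⟨χ, hχ⟩ := exists_isCutoff
  refine tendsto_nhds_unique (tendsto_hsOp_cutMul hα hR hψ hn hχ hf) ?_
  refine tendsto_const_nhds.congr fun m => Eq.symm ?_
  have hc := contDiff_cutMul hχ (SlowDecay.contDiff hf) m
  have hs := hasCompactSupport_cutMul hχ f m
  refine tendsto_nhds_unique
    (tendsto_hsOp_translate hα hR hψ hn (mem_slowDecay_of_hasCompactSupport hc hs)) ?_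
  refine tendsto_const_nhds.congr' ?_
  filter_upwards [self_mem_nhdsWithin] with δ hδ
  have hδ0 : (0 : ℝ) < δ := hδ
  refine (hsOp_eq_zero_of_continuousOn hα hR hψ hn (hc.comp (contDiff_id.add contDiff_const))
    (hs.comp_homeomorph (Homeomorph.addRight δ)) hU hRU fun x hx => hneg x ?_).symm
  have hsub : tsupport (cutMul χ m f ∘ (Homeomorph.addRight δ)) ⊆ Iic (-δ) := by
    refine closure_minimal (fun y hy => ?_) isClosed_Iic
    by_contra! h
    refine hy ?_
    have : 0 ≤ y + δ := by
      have := not_le.1 (show ¬ y ≤ -δ from h)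
      linarith
    simp [cutMul, hf0 _ this]
  have := hsub hx
  rw [mem_Iic] at this
  linarith

end Op

/-! ### Resolvent functions as symbols -/

/-- The function `x ↦ (w - x)⁻¹`. -/
def resFun (w : ℂ) (x : ℝ) : ℂ := (w - x)⁻¹

lemma sub_ofReal_ne_zero {w : ℂ} (hw : w.im ≠ 0) (x : ℝ) : w - x ≠ 0 := fun h => hw (by
  have := congrArg Complex.im h
  simpa using this)

lemma contDiff_resFun {w : ℂ} (hw : w.im ≠ 0) : ContDiff ℝ ∞ (resFun w) :=
  (contDiff_const.sub Complex.ofRealCLM.contDiff).inv (sub_ofReal_ne_zero hw)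

lemma iteratedDeriv_resFun {w : ℂ} (hw : w.im ≠ 0) (n : ℕ) :
    iteratedDeriv n (resFun w) = fun x : ℝ => (n.factorial : ℂ) * ((w - x) ^ (n + 1))⁻¹ := by
  induction n with
  | zero => ext x; simp [resFun]
  | succ n ih =>
    ext x
    rw [iteratedDeriv_succ, ih]
    have h0 := sub_ofReal_ne_zero hw x
    have h1 : HasDerivAt (fun x : ℝ => w - (x : ℂ)) (-1) x := by
      simpa using (Complex.ofRealCLM.hasDerivAt (x := x)).const_sub w
    have h2 := ((h1.fun_pow (n + 1)).fun_inv (pow_ne_zero _ h0)).const_mul (n.factorial : ℂ)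
    rw [h2.deriv, Nat.factorial_succ]
    push_cast
    field_simp
    ring

/-- `⟨x⟩ |Im w| ≤ 3 ⟨w⟩ |w - x|`. -/
lemma bracket_mul_abs_im_le (w : ℂ) (x : ℝ) : bracket x * |w.im| ≤ 3 * bracket w * ‖w - x‖ := by
  have h1 : |w.im| ≤ ‖w - x‖ := by simpa using Complex.abs_im_le_norm (w - x)
  have h2 : |w.im| ≤ bracket w := (Complex.abs_im_le_norm w).trans (norm_le_bracket w)
  have h3 : |x| ≤ ‖w‖ + ‖w - x‖ := by
    calc |x| = ‖w - (w - x)‖ := by simp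
      _ ≤ _ := norm_sub_le _ _
  have h4 : bracket x ≤ 1 + |x| := by
    refine Real.sqrt_le_iff.2 ⟨by positivity, ?_⟩
    rw [Real.norm_eq_abs]
    nlinarith [abs_nonneg x]
  have h5 := norm_le_bracket w
  have h6 := one_le_bracket w
  have h7 := norm_nonneg (w - x)
  have h8 := abs_nonneg w.im
  calc bracket x * |w.im| ≤ (1 + ‖w‖ + ‖w - x‖) * |w.im| := by gcongr; linarith
    _ = (1 + ‖w‖) * |w.im| + ‖w - x‖ * |w.im| := by ring
    _ ≤ (bracket w + bracket w) * ‖w - x‖ + ‖w - x‖ * bracket w := by gcongr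
    _ = _ := by ring

lemma norm_iteratedDeriv_resFun_le {w : ℂ} (hw : w.im ≠ 0) (n : ℕ) (x : ℝ) :
    ‖iteratedDeriv n (resFun w) x‖ ≤
      (n.factorial * (3 * (bracket w / |w.im|)) ^ (n + 1)) * bracket x ^ ((-1 : ℝ) - n) := by
  have h0 : 0 < ‖w - x‖ := norm_pos_iff.2 (sub_ofReal_ne_zero hw x)
  have h1 : 0 < |w.im| := abs_pos.2 hw
  have hb := bracket_pos x
  have hle : ‖w - x‖⁻¹ ≤ 3 * (bracket w / |w.im|) * (bracket x)⁻¹ := by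
    have := bracket_mul_abs_im_le w x
    rw [← div_eq_mul_inv, mul_div_assoc', inv_eq_one_div, div_div,
      div_le_div_iff₀ h0 (by positivity)]
    linarith
  rw [iteratedDeriv_resFun hw, norm_mul, Complex.norm_natCast, norm_inv, norm_pow, ← inv_pow,
    show (-1 : ℝ) - n = -((n + 1 : ℕ) : ℝ) by push_cast; ring, Real.rpow_neg hb.le,
    Real.rpow_natCast, mul_assoc, ← inv_pow, ← mul_pow]
  gcongr

lemma resFun_mem_slowDecay {w : ℂ} (hw : w.im ≠ 0) : resFun w ∈ SlowDecay :=
  ⟨-1, by norm_num, contDiff_resFun hw, fun n => ⟨_, norm_iteratedDeriv_resFun_le hw n⟩⟩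

/-! ### Multiplication by a resolvent function -/

/-- A cut-off so narrow that almost analytic extensions vanish near a given nonreal point. -/
lemma exists_isCutoffAt_eventually_eq_zero {w : ℂ} (hw : w.im ≠ 0) :
    ∃ (ρ : ℝ) (ψ : ℝ → ℂ), IsCutoffAt ρ ψ ∧
      ∀ (n : ℕ) (f : ℝ → ℂ), ∀ᶠ z in 𝓝 w, almostAnalytic n ψ f z.re z.im = 0 := by
  obtain ⟨χ, hχ⟩ := exists_isCutoff
  have h0 : 0 < |w.im / bracket w.re| := abs_pos.2 (div_ne_zero hw (bracket_pos _).ne')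
  set l : ℝ := max 1 (3 / |w.im / bracket w.re|) with hl
  have hl1 : 1 ≤ l := le_max_left _ _
  have hl0 : 0 < l := by linarith
  have hl3 : 3 ≤ l * |w.im / bracket w.re| := by
    have := le_max_right 1 (3 / |w.im / bracket w.re|)
    rwa [div_le_iff₀ h0] at this
  refine ⟨l⁻¹, fun s => χ (l * s), ⟨hχ.contDiff_dilate l, by positivity, fun s hs => hχ.one _ ?_,
    fun s hs => hχ.zero _ ?_⟩, fun n f => ?_⟩
  · rw [abs_mul, abs_of_pos hl0]
    calc l * |s| ≤ l * l⁻¹ := by gcongr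
      _ = 1 := mul_inv_cancel₀ hl0.ne'
  · rw [abs_mul, abs_of_pos hl0]
    nlinarith [abs_nonneg s]
  · have hc : Continuous fun z : ℂ => l * |z.im / bracket z.re| :=
      continuous_const.mul (Complex.continuous_im.div
        (continuous_bracket.comp Complex.continuous_re) fun z => (bracket_pos _).ne').abs
    have h2 : 2 < l * |w.im / bracket w.re| := by linarith
    filter_upwards [(hc.tendsto w).eventually_const_lt h2] with z hz
    rw [almostAnalytic, hχ.zero _, mul_zero]
    rw [abs_mul, abs_of_pos hl0]
    exact hz.le

lemma continuousAt_mk_re_im {P : ℂ → Prop} {w : ℂ} (h : ∀ᶠ z in 𝓝 w, P z) :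
    (∀ᶠ x : ℝ in 𝓝 w.re, P ⟨x, w.im⟩) ∧ ∀ᶠ y : ℝ in 𝓝 w.im, P ⟨w.re, y⟩ := by
  have c1 : Continuous fun x : ℝ => (⟨x, w.im⟩ : ℂ) := by
    simp only [Complex.mk_eq_add_mul_I]; fun_prop
  have c2 : Continuous fun y : ℝ => (⟨w.re, y⟩ : ℂ) := by
    simp only [Complex.mk_eq_add_mul_I]; fun_prop
  exact ⟨(c1.tendsto w.re).eventually h, (c2.tendsto w.im).eventually h⟩

lemma dbar_eq_zero_of_eventually {F : ℝ → ℝ → ℂ} {w : ℂ} (h : ∀ᶠ z in 𝓝 w, F z.re z.im = 0) :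
    dbar F w = 0 := by
  obtain ⟨h1, h2⟩ := continuousAt_mk_re_im h
  have e1 : (fun x => F x w.im) =ᶠ[𝓝 w.re] fun _ => 0 := h1
  have e2 : (fun y => F w.re y) =ᶠ[𝓝 w.im] fun _ => 0 := h2
  rw [dbar, e1.deriv_eq, e2.deriv_eq]
  simp

/-- `∂̄` commutes with multiplication by a holomorphic function. -/
lemma dbar_mul_holomorphic {F : ℝ → ℝ → ℂ} (hF : ContDiff ℝ 1 fun p : ℝ × ℝ => F p.1 p.2)
    {g : ℂ → ℂ} {z : ℂ} (hg : DifferentiableAt ℂ g z) :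
    dbar (fun x y => F x y * g ⟨x, y⟩) z = dbar F z * g z := by
  have hFd := hF.differentiable (by simp)
  have h1 : DifferentiableAt ℝ (fun x => F x z.im) z.re :=
    DifferentiableAt.comp (g := fun p : ℝ × ℝ => F p.1 p.2) (f := fun x : ℝ => (x, z.im)) z.re
      (hFd _) (by fun_prop)
  have h2 : DifferentiableAt ℝ (fun y => F z.re y) z.im :=
    DifferentiableAt.comp (g := fun p : ℝ × ℝ => F p.1 p.2) (f := fun y : ℝ => (z.re, y)) z.im
      (hFd _) (by fun_prop)
  have c1 : HasDerivAt (fun x : ℝ => (⟨x, z.im⟩ : ℂ)) 1 z.re := by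
    simp only [Complex.mk_eq_add_mul_I]
    simpa using (Complex.ofRealCLM.hasDerivAt (x := z.re)).add_const (z.im * Complex.I)
  have c2 : HasDerivAt (fun y : ℝ => (⟨z.re, y⟩ : ℂ)) Complex.I z.im := by
    simp only [Complex.mk_eq_add_mul_I]
    simpa using ((Complex.ofRealCLM.hasDerivAt (x := z.im)).mul_const Complex.I).const_add
      (z.re : ℂ)
  have g1 : HasDerivAt (fun x : ℝ => g ⟨x, z.im⟩) (deriv g z) z.re := by
    simpa [Function.comp_def] using HasDerivAt.scomp z.re (g₁ := g)
      (h := fun x : ℝ => (⟨x, z.im⟩ : ℂ))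
      hg.hasDerivAt c1
  have g2 : HasDerivAt (fun y : ℝ => g ⟨z.re, y⟩) (Complex.I * deriv g z) z.im := by
    simpa [Function.comp_def] using HasDerivAt.scomp z.im (g₁ := g)
      (h := fun y : ℝ => (⟨z.re, y⟩ : ℂ))
      hg.hasDerivAt c2
  rw [dbar, dbar, (h1.hasDerivAt.fun_mul g1).deriv, (h2.hasDerivAt.fun_mul g2).deriv]
  linear_combination (1 / 2) * F z.re z.im * deriv g z * Complex.I_mul_I

lemma IsCompactC1.integrable_dbar {F : ℝ → ℝ → ℂ} (hF : IsCompactC1 F) : Integrable (dbar F) := by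
  obtain ⟨M, hM, hzero⟩ := hF.eq_zero
  refine (continuous_dbar hF.contDiff).integrable_of_hasCompactSupport
    (HasCompactSupport.intro (isCompact_Icc.reProdIm isCompact_Icc : IsCompact
      (Icc (-M) M ×ℂ Icc (-M) M)) fun z hz => dbar_eq_zero_of_bound hzero ?_)
  by_contra! h
  exact hz ⟨abs_le.1 h.1, abs_le.1 h.2⟩

/-- The product of a compactly supported extension with `(w - z)⁻¹` is again such an extension, as
soon as the former vanishes near `w`. -/
lemma IsCompactC1.mul_inv_sub {F : ℝ → ℝ → ℂ} (hF : IsCompactC1 F) {w : ℂ}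
    (hw : ∀ᶠ z in 𝓝 w, F z.re z.im = 0) :
    IsCompactC1 (fun x y => F x y * (w - ⟨x, y⟩)⁻¹) ∧
      (∀ z, dbar (fun x y => F x y * (w - ⟨x, y⟩)⁻¹) z = dbar F z * (w - z)⁻¹) ∧
      ∃ B : ℝ, ∀ z, ‖dbar F z * (w - z)⁻¹‖ ≤ B * ‖dbar F z‖ := by
  have hc2 : Continuous fun p : ℝ × ℝ => (⟨p.1, p.2⟩ : ℂ) := by
    simp only [Complex.mk_eq_add_mul_I]; fun_prop
  refine ⟨⟨contDiff_iff_contDiffAt.2 fun p => ?_, ?_⟩, fun z => ?_, ?_⟩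
  · by_cases hp : (⟨p.1, p.2⟩ : ℂ) = w
    · have hev : (fun p : ℝ × ℝ => F p.1 p.2 * (w - ⟨p.1, p.2⟩)⁻¹) =ᶠ[𝓝 p] fun _ => 0 := by
        have := hc2.tendsto p
        rw [hp] at this
        filter_upwards [this.eventually hw] with q hq
        have hq' : F q.1 q.2 = 0 := hq
        rw [hq', zero_mul]
      exact contDiffAt_const.congr_of_eventuallyEq hev
    · refine hF.contDiff.contDiffAt.mul (ContDiffAt.inv ?_ (sub_ne_zero.2 (Ne.symm hp)))
      simp only [Complex.mk_eq_add_mul_I]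
      exact contDiffAt_const.sub ((Complex.ofRealCLM.contDiff.comp contDiff_fst).add
        ((Complex.ofRealCLM.contDiff.comp contDiff_snd).mul contDiff_const)).contDiffAt
  · obtain ⟨M, hM, hzero⟩ := hF.eq_zero
    exact ⟨M, hM, fun x y h => by rw [hzero x y h, zero_mul]⟩
  · by_cases hz : z = w
    · subst hz
      rw [dbar_eq_zero_of_eventually hw, zero_mul]
      refine dbar_eq_zero_of_eventually ?_
      filter_upwards [hw] with u hu
      rw [hu, zero_mul]
    · exact dbar_mul_holomorphic hF.contDiff (g := fun z => (w - z)⁻¹)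
        ((differentiableAt_const w |>.sub differentiableAt_id).inv (sub_ne_zero.2 (Ne.symm hz)))
  · obtain ⟨δ, hδ, hball⟩ := Metric.eventually_nhds_iff_ball.1 hw.eventually_nhds
    refine ⟨δ⁻¹, fun z => ?_⟩
    by_cases hz : z ∈ Metric.ball w δ
    · rw [dbar_eq_zero_of_eventually (hball z hz)]
      simp
    · have : δ ≤ ‖w - z‖ := by
        rw [Metric.mem_ball, not_lt, dist_comm, dist_eq_norm] at hz
        exact hz
      rw [norm_mul, norm_inv, mul_comm]
      gcongr

section Resolvent

variable {X : Type*} [NormedAddCommGroup X] [NormedSpace ℂ X]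
  {H : X →ₗ.[ℂ] X} {α c ρ : ℝ} {ψ f g : ℝ → ℂ} {n : ℕ}

/-- Off the spectrum, `(w - z)⁻¹ R(z) = R(w) R(z) + (w - z)⁻¹ R(w)`. -/
lemma inv_sub_smul_resolv {z w : ℂ} (hz : z ∉ spec H) (hw : w ∉ spec H) (hzw : z ≠ w) :
    (w - z)⁻¹ • resolv H z = resolv H w * resolv H z + (w - z)⁻¹ • resolv H w := by
  have h := resolv_sub_resolv hw hz
  have hne : w - z ≠ 0 := sub_ne_zero.2 (Ne.symm hzw)
  have h2 : resolv H w * resolv H z = -((w - z)⁻¹ • (resolv H w - resolv H z)) := by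
    rw [h, smul_smul, show (w - z)⁻¹ * (z - w) = -1 by field_simp; ring, neg_one_smul, neg_neg]
  rw [h2, smul_sub]
  abel

variable [CompleteSpace X]

/-- `f(H)` for `f(x) = (w - x)⁻¹ g(x)` is `(w - H)⁻¹ g(H)`. -/
lemma hsOp_resFun_mul (hα : 0 ≤ α) (hR : IsResolventLike α c (resolv H))
    (hspec : ∀ z : ℂ, z.im ≠ 0 → z ∉ spec H) (hψ : IsCutoffAt ρ ψ) (hn : α < n)
    (hg : ContDiff ℝ ∞ g) (hs : HasCompactSupport g) {w : ℂ} (hw : w.im ≠ 0) :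
    hsOp (resolv H) n ψ (resFun w * g) = resolv H w * hsOp (resolv H) n ψ g := by
  obtain ⟨ρ', ψ', hψ', hev⟩ := exists_isCutoffAt_eventually_eq_zero hw
  have hgS := mem_slowDecay_of_hasCompactSupport hg hs
  set F := almostAnalytic n ψ' g with hF
  have hFc : IsCompactC1 F := isCompactC1_almostAnalytic hψ' hg hs n
  obtain ⟨hF2, hd, B, hB⟩ := hFc.mul_inv_sub (hev n g)
  set F2 : ℝ → ℝ → ℂ := fun x y => F x y * (w - ⟨x, y⟩)⁻¹
  have hI := integrable_dbar_mul_weight hα hψ' hn hg (integrable_symbolSum hgS _)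
  have hI2 : Integrable fun z => ‖dbar F2 z‖ * weight α z := by
    refine (hI.const_mul B).mono' ((continuous_dbar hF2.contDiff).norm.aestronglyMeasurable.mul
      (measurable_weight α).aestronglyMeasurable) (ae_of_all _ fun z => ?_)
    rw [Real.norm_of_nonneg (mul_nonneg (norm_nonneg _) (weight_nonneg _ _)), hd z, ← mul_assoc]
    exact mul_le_mul_of_nonneg_right (hB z) (weight_nonneg _ _)
  have hlim := tendsto_integral_smul_jump hα hF2 hR hI2
  have hax : ∀ x : ℝ, F2 x 0 = (resFun w * g) x := fun x => by
    have : (⟨x, 0⟩ : ℂ) = x := rfl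
    simp only [F2, F, almostAnalytic_zero hψ', Pi.mul_apply, resFun, this]
    ring
  simp only [hax] at hlim
  rw [tendsto_nhds_unique (tendsto_jump_hsOp (f := resFun w * g) hα hR hψ hn
    ((contDiff_resFun hw).mul hg)
    hs.mul_left) hlim, hsOp_eq_hsOp hα hR hψ hn hψ' hn hgS]
  have i1 : Integrable fun z => dbar F z • resolv H z :=
    integrable_hsOp hα hR hψ' hn hgS
  have i2 : Integrable fun z => dbar F2 z • resolv H w := hF2.integrable_dbar.smul_const _
  have hae : (fun z => dbar F2 z • resolv H z) =ᵐ[volume]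
      fun z => resolv H w * (dbar F z • resolv H z) + dbar F2 z • resolv H w := by
    filter_upwards [ae_im_ne_zero, Measure.ae_ne volume w] with z hz hzw
    rw [hd z, mul_smul, inv_sub_smul_resolv (hspec z hz) (hspec w hw) hzw, smul_add, mul_smul,
      mul_smul_comm]
  have i1' : Integrable fun z => resolv H w * (dbar F z • resolv H z) :=
    (ContinuousLinearMap.mul ℂ (X →L[ℂ] X) (resolv H w)).integrable_comp i1
  rw [integral_congr_ae hae, integral_add i1' i2, integral_smul_const, integral_dbar_eq_zero hF2,
    zero_smul, add_zero, hsOp, mul_smul_comm]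
  congr 1
  exact (ContinuousLinearMap.mul ℂ (X →L[ℂ] X) (resolv H w)).integral_comp_comm i1

end Resolvent

/-! ### The value on resolvent functions -/

/-- The dilate `F(x / L, y / L)`, written with `a = 1 / L`. -/
lemma IsCompactC1.dilate {F : ℝ → ℝ → ℂ} (hF : IsCompactC1 F) {a : ℝ} (ha : 0 < a) :
    IsCompactC1 (fun x y => F (a * x) (a * y)) ∧
      ∀ z : ℂ, dbar (fun x y => F (a * x) (a * y)) z = a * dbar F (a • z) := by
  refine ⟨⟨?_, ?_⟩, fun z => ?_⟩
  · exact ContDiff.comp (g := fun p : ℝ × ℝ => F p.1 p.2)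
      (f := fun p : ℝ × ℝ => (a * p.1, a * p.2)) hF.contDiff (by fun_prop)
  · obtain ⟨M, hM, hzero⟩ := hF.eq_zero
    have hmul : ∀ t : ℝ, a⁻¹ * M < |t| → M < |a * t| := fun t ht => by
      rw [abs_mul, abs_of_pos ha]
      rwa [inv_mul_eq_div, div_lt_iff₀' ha] at ht
    exact ⟨a⁻¹ * M, by positivity, fun x y h => hzero _ _ (h.imp (hmul x) (hmul y))⟩
  · have h1 := deriv_comp_mul_left a (fun x => F x (a * z.im)) z.re
    have h2 := deriv_comp_mul_left a (fun y => F (a * z.re) y) z.im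
    rw [dbar, dbar, h1, h2, Complex.smul_re, Complex.smul_im, smul_eq_mul, smul_eq_mul,
      Complex.real_smul, Complex.real_smul]
    ring

lemma weight_le_mul_weight_smul {α : ℝ} (hα : 0 ≤ α) {a : ℝ} (ha : 0 < a) (ha1 : a ≤ 1) {z : ℂ}
    (hz : z.im ≠ 0) : weight α z ≤ a * weight α (a • z) := by
  have h0 : 0 < |z.im| := abs_pos.2 hz
  have hb := bracket_pos z
  have him : |(a • z).im| = a * |z.im| := by
    rw [Complex.smul_im, smul_eq_mul, abs_mul, abs_of_pos ha]
  have hbz : a * bracket z ≤ bracket (a • z) := by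
    refine Real.le_sqrt_of_sq_le ?_
    rw [mul_pow, bracket_sq, norm_smul, Real.norm_of_nonneg ha.le]
    nlinarith
  unfold weight
  rw [him]
  calc |z.im|⁻¹ * (bracket z / |z.im|) ^ α
      ≤ |z.im|⁻¹ * (bracket (a • z) / (a * |z.im|)) ^ α := by
        gcongr ?_ * ?_ ^ α
        rw [div_le_div_iff₀ h0 (by positivity)]
        nlinarith
    _ = _ := by field_simp

lemma weight_mul_inv_le {α : ℝ} {z : ℂ} (hz : z.im ≠ 0) :
    weight α z * |z.im|⁻¹ ≤ weight (α + 1) z := by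
  have h0 : 0 < |z.im| := abs_pos.2 hz
  have hb := bracket_pos z
  unfold weight
  rw [Real.rpow_add_one (by positivity), mul_assoc]
  gcongr
  rw [inv_eq_one_div]
  gcongr
  exact one_le_bracket z

section Resolvent

variable {X : Type*} [NormedAddCommGroup X] [NormedSpace ℂ X] [CompleteSpace X]
  {H : X →ₗ.[ℂ] X} {α c ρ : ℝ} {ψ f g : ℝ → ℂ} {n : ℕ}

/-- `χ(H / L) → 1` on the domain of `H`. The almost analytic extensions `F(z / L)` of `χ(x / L)` are
used, so that the `∂̄`-derivative is concentrated at distance about `L` from the origin; there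
`R(z) R(-1) = (-1 - z)⁻¹ (R(z) - R(-1))` gains a factor `1 / L` in the term with `R(z)`, while the
term with `R(-1)` is evaluated by the Cauchy–Pompeiu formula at the point `-1`. -/
lemma exists_norm_hsOp_dilate_mul_sub_le (hα : 0 ≤ α) (hR : IsResolventLike α c (resolv H))
    (hspec : ∀ z : ℂ, z.im ≠ 0 → z ∉ spec H) (h1 : (-1 : ℂ) ∉ spec H) (hψ : IsCutoffAt ρ ψ)
    (hn : α < n) {χ : ℝ → ℂ} (hχ : IsCutoff χ) :
    ∃ C : ℝ, ∀ m : ℕ, ‖hsOp (resolv H) n ψ (fun x => χ (((m : ℝ) + 1)⁻¹ * x)) * resolv H (-1) -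
      resolv H (-1)‖ ≤ C * ((m : ℝ) + 1)⁻¹ := by
  have hc := hR.nonneg
  obtain ⟨N, hN⟩ := exists_nat_gt (α + 1)
  set T := resolv H (-1)
  have hχs := hχ.isCutoffAt.hasCompactSupport
  set F := almostAnalytic N χ χ with hF
  have hFc : IsCompactC1 F := isCompactC1_almostAnalytic hχ.isCutoffAt hχ.smooth hχs N
  have hQ := integrable_symbolSum (mem_slowDecay_of_hasCompactSupport hχ.smooth hχs) (N + 1)
  have hI1 : Integrable fun z => ‖dbar F z‖ * weight (α + 1) z :=
    integrable_dbar_mul_weight (by linarith) hχ.isCutoffAt hN hχ.smooth hQ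
  have hI0 : Integrable fun z => ‖dbar F z‖ * weight α z :=
    integrable_dbar_mul_weight hα hχ.isCutoffAt (by linarith) hχ.smooth hQ
  refine ⟨‖(-(1 / Real.pi : ℝ) : ℂ)‖ * (c * ∫ z, ‖dbar F z‖ * weight (α + 1) z), fun m => ?_⟩
  set a : ℝ := ((m : ℝ) + 1)⁻¹ with ha_def
  have ha : 0 < a := by positivity
  have ha1 : a ≤ 1 := inv_le_one_of_one_le₀ (by linarith [(m.cast_nonneg : (0 : ℝ) ≤ m)])
  obtain ⟨hFa, hda⟩ := hFc.dilate ha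
  set Fa : ℝ → ℝ → ℂ := fun x y => F (a * x) (a * y) with hFa_def
  have hnorm : ∀ z, ‖dbar Fa z‖ = a * ‖dbar F (a • z)‖ := fun z => by
    rw [hda z, norm_mul, Complex.norm_real, Real.norm_of_nonneg ha.le]
  have hIa : Integrable fun z => ‖dbar Fa z‖ * weight α z := by
    refine ((hI0.comp_smul ha.ne').const_mul (a * a)).mono'
      ((continuous_dbar hFa.contDiff).norm.aestronglyMeasurable.mul
        (measurable_weight α).aestronglyMeasurable) ?_
    filter_upwards [ae_im_ne_zero] with z hz
    rw [Real.norm_of_nonneg (mul_nonneg (norm_nonneg _) (weight_nonneg _ _)), hnorm]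
    calc _ ≤ a * ‖dbar F (a • z)‖ * (a * weight α (a • z)) := by
          gcongr; exact weight_le_mul_weight_smul hα ha ha1 hz
      _ = _ := by ring
  have hax : ∀ x : ℝ, Fa x 0 = χ (a * x) := fun x => by
    simp only [Fa, F, mul_zero, almostAnalytic_zero hχ.isCutoffAt]
  have hlim := tendsto_integral_smul_jump hα hFa hR hIa
  simp only [hax] at hlim
  rw [tendsto_nhds_unique (tendsto_jump_hsOp hα hR hψ hn (hχ.contDiff_dilate a)
    (hχ.hasCompactSupport_dilate m)) hlim]
  have i1 : Integrable fun z => dbar Fa z • resolv H z :=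
    hR.integrable_smul (continuous_dbar hFa.contDiff).aestronglyMeasurable hIa
  -- the two parts of `R(z) R(-1)`
  have hcp : (-(1 / Real.pi : ℝ) : ℂ) • ∫ z : ℂ, dbar Fa z • (z - (-1 : ℝ))⁻¹ = 1 := by
    rw [integral_dbar_smul_inv_sub hα hFa hIa (-1), hax]
    refine hχ.one _ ?_
    rw [abs_mul, abs_neg, abs_one, mul_one, abs_of_pos ha]
    exact ha1
  have i2 : Integrable fun z : ℂ => dbar Fa z • (z - (-1 : ℝ))⁻¹ :=
    (isResolventLike_inv_sub hα (-1)).integrable_smul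
      (continuous_dbar hFa.contDiff).aestronglyMeasurable hIa
  have i3 : Integrable fun z : ℂ => (dbar Fa z • resolv H z) * T :=
    ((ContinuousLinearMap.mul ℂ (X →L[ℂ] X)).flip T).integrable_comp i1
  have hsplit : (fun z : ℂ => (dbar Fa z • resolv H z) * T) =ᵐ[volume] fun z : ℂ =>
      (dbar Fa z • (z - (-1 : ℝ))⁻¹) • T - (dbar Fa z • (z - (-1 : ℝ))⁻¹) • resolv H z := by
    filter_upwards [ae_im_ne_zero] with z hz
    have hzw : z ≠ -1 := fun h => hz (by rw [h]; simp)
    have hz1 : z + 1 ≠ 0 := fun h => hzw (eq_neg_of_add_eq_zero_left h)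
    have hz2 : -1 - z ≠ 0 := fun h => hz1 (by linear_combination -h)
    have h := resolv_sub_resolv (hspec z hz) h1
    have hT : resolv H z * T = (-1 - z)⁻¹ • (resolv H z - T) := by
      rw [h, smul_smul, inv_mul_cancel₀ hz2, one_smul]
    rw [smul_mul_assoc, hT, ← smul_sub, smul_smul]
    have : (-1 - z)⁻¹ = -(z - (-1 : ℝ))⁻¹ := by
      rw [show -1 - z = -(z - (-1 : ℝ)) by push_cast; ring, inv_neg]
    rw [this, smul_eq_mul, mul_neg, neg_smul, ← smul_neg, neg_sub]
  have i4 : Integrable fun z : ℂ => (dbar Fa z • (z - (-1 : ℝ))⁻¹) • resolv H z := by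
    have := (i2.smul_const T).sub (i3.congr hsplit)
    refine this.congr (ae_of_all _ fun z => ?_)
    simp
  have hmulT : (∫ z, dbar Fa z • resolv H z) * T = ∫ z, (dbar Fa z • resolv H z) * T :=
    (((ContinuousLinearMap.mul ℂ (X →L[ℂ] X)).flip T).integral_comp_comm i1).symm
  rw [smul_mul_assoc, hmulT, integral_congr_ae hsplit, integral_sub (i2.smul_const T) i4,
    integral_smul_const, smul_sub, ← smul_assoc, hcp, one_smul, sub_sub_cancel_left, norm_neg,
    norm_smul, mul_assoc]
  refine mul_le_mul_of_nonneg_left ?_ (norm_nonneg _)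
  -- the remainder is of order `1 / L`
  have hbound : ∀ᵐ z : ℂ, ‖(dbar Fa z • (z - (-1 : ℝ))⁻¹) • resolv H z‖ ≤
      (c * a ^ 3) * (‖dbar F (a • z)‖ * weight (α + 1) (a • z)) := by
    filter_upwards [ae_im_ne_zero] with z hz
    have h0 : 0 < |z.im| := abs_pos.2 hz
    have him : |(a • z).im| = a * |z.im| := by
      rw [Complex.smul_im, smul_eq_mul, abs_mul, abs_of_pos ha]
    have hz' : (a • z).im ≠ 0 := by
      rw [← abs_pos, him]; positivity
    have hinv : ‖(z - (-1 : ℝ))⁻¹‖ ≤ a * |(a • z).im|⁻¹ := by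
      rw [norm_inv, him, mul_inv, ← mul_assoc, mul_inv_cancel₀ ha.ne', one_mul]
      gcongr
      simpa using Complex.abs_im_le_norm (z - (-1 : ℝ))
    rw [norm_smul, norm_smul, hnorm]
    calc _ ≤ a * ‖dbar F (a • z)‖ * (a * |(a • z).im|⁻¹) * (c * (a * weight α (a • z))) := by
          gcongr
          exact (hR.bound z hz).trans (by gcongr; exact weight_le_mul_weight_smul hα ha ha1 hz)
      _ = c * a ^ 3 * (‖dbar F (a • z)‖ * (weight α (a • z) * |(a • z).im|⁻¹)) := by ring
      _ ≤ _ := by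
          gcongr
          exact weight_mul_inv_le hz'
  refine (norm_integral_le_of_norm_le ((hI1.comp_smul ha.ne').const_mul (c * a ^ 3)) hbound).trans
    (le_of_eq ?_)
  rw [integral_const_mul, Measure.integral_comp_smul volume
    (fun z => ‖dbar F z‖ * weight (α + 1) z), Complex.finrank_real_complex, smul_eq_mul,
    abs_of_pos (by positivity)]
  field_simp

/-- The functions `χ(x / L) (w - x)⁻¹` give `(w - H)⁻¹ χ(H / L)`, and
`χ(H / L) u → u` for `u` in the domain of `H`, which is dense. -/
lemma hsOp_resFun (hα : 0 ≤ α) (hR : IsResolventLike α c (resolv H))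
    (hspec : ∀ z : ℂ, z.im ≠ 0 → z ∉ spec H) (h1 : (-1 : ℂ) ∉ spec H)
    (hdense : Dense (H.domain : Set X)) (hψ : IsCutoffAt ρ ψ) (hn : α < n) {w : ℂ}
    (hw : w.im ≠ 0) : hsOp (resolv H) n ψ (resFun w) = resolv H w := by
  obtain ⟨χ, hχ⟩ := exists_isCutoff
  have hlim1 := tendsto_hsOp_cutMul hα hR hψ hn hχ (resFun_mem_slowDecay hw)
  have hcut : ∀ m, hsOp (resolv H) n ψ (cutMul χ m (resFun w)) =
      resolv H w * hsOp (resolv H) n ψ (fun x => χ (((m : ℝ) + 1)⁻¹ * x)) := fun m => by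
    rw [← hsOp_resFun_mul hα hR hspec hψ hn (hχ.contDiff_dilate _)
      (hχ.hasCompactSupport_dilate m) hw,
      cutMul, mul_comm]
  obtain ⟨C, hC⟩ := exists_norm_hsOp_dilate_mul_sub_le hα hR hspec h1 hψ hn hχ
  have hz : Tendsto (fun m : ℕ => C * ((m : ℝ) + 1)⁻¹) atTop (𝓝 0) := by
    have := (tendsto_one_div_add_atTop_nhds_zero_nat (𝕜 := ℝ)).const_mul C
    simpa using this
  have hlim2 : Tendsto (fun m : ℕ => hsOp (resolv H) n ψ (fun x => χ (((m : ℝ) + 1)⁻¹ * x)) *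
      resolv H (-1)) atTop (𝓝 (resolv H (-1))) :=
    tendsto_iff_norm_sub_tendsto_zero.2 (squeeze_zero (fun _ => norm_nonneg _) hC hz)
  have hlim3 := hlim1.mul_const (resolv H (-1))
  simp only [hcut, mul_assoc] at hlim3
  have heq := tendsto_nhds_unique hlim3 (hlim2.const_mul (resolv H w))
  refine DFunLike.coe_injective (Continuous.ext_on hdense (ContinuousLinearMap.continuous _)
    (ContinuousLinearMap.continuous _) fun u hu => ?_)
  have hu' := (isResolventAt_resolv h1).1 ⟨u, hu⟩
  have h := congrArg (fun A : X →L[ℂ] X => A ((-1 : ℂ) • u - H ⟨u, hu⟩)) heq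
  simp only [mul_apply_eq_comp] at h
  rwa [hu'] at h

end Resolvent

/-! ### Multiplicativity -/

section Resolvent

/-- The norms of `r_z g` grow at most polynomially in `⟨z⟩ / |Im z|`. -/
lemma exists_integral_symbolSum_resFun_mul_le {g : ℝ → ℂ} (hg : ContDiff ℝ ∞ g)
    (hs : HasCompactSupport g) (k : ℕ) :
    ∃ D : ℝ, 0 ≤ D ∧ ∀ z : ℂ, z.im ≠ 0 →
      ∫ x, symbolSum k (resFun z * g) x ≤ D * (bracket z / |z.im|) ^ (k + 1) := by
  choose d hd using (isSymbol_of_hasCompactSupport hg hs (-1)).2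
  set D : ℝ := ∑ r ∈ Finset.range (k + 1), ∑ i ∈ Finset.range (r + 1),
    (r.choose i : ℝ) * (i.factorial * 3 ^ (i + 1) * d (r - i)) with hD
  have hd0 : ∀ r, 0 ≤ d r := fun r => nonneg_of_mul_nonneg_left
    ((norm_nonneg _).trans (hd r 0)) (Real.rpow_pos_of_pos (bracket_pos _) _)
  have hD0 : 0 ≤ D := Finset.sum_nonneg fun r _ => Finset.sum_nonneg fun i _ => by
    have := hd0 (r - i)
    positivity
  have hint := (integrable_bracket_rpow (β := -1 + -1) (by norm_num))
  refine ⟨D * ∫ x : ℝ, bracket x ^ ((-1 + -1 : ℝ) - 1), mul_nonneg hD0 (integral_nonneg fun x =>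
    Real.rpow_nonneg (bracket_pos x).le _), fun z hz => ?_⟩
  set q : ℝ := bracket z / |z.im| with hq
  have h0 : 0 < |z.im| := abs_pos.2 hz
  have hq1 : 1 ≤ q := by
    rw [hq, one_le_div h0]
    exact (Complex.abs_im_le_norm z).trans (norm_le_bracket z)
  have hmem : resFun z * g ∈ SlowDecay :=
    mem_slowDecay_of_hasCompactSupport ((contDiff_resFun hz).mul hg) hs.mul_left
  calc _ ≤ ∫ x : ℝ, D * q ^ (k + 1) * bracket x ^ ((-1 + -1 : ℝ) - 1) := by
        refine integral_mono (integrable_symbolSum hmem k) (hint.const_mul _) fun x => ?_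
        refine (symbolSum_le fun r _ => norm_iteratedDeriv_mul_le (contDiff_resFun hz) hg
          (fun i => norm_iteratedDeriv_resFun_le hz i x) (fun i => hd i x) r).trans ?_
        refine mul_le_mul_of_nonneg_right ?_ (Real.rpow_nonneg (bracket_pos x).le _)
        rw [hD, Finset.sum_mul]
        refine Finset.sum_le_sum fun r hr => ?_
        rw [Finset.sum_mul]
        refine Finset.sum_le_sum fun i hi => ?_
        have hik : i + 1 ≤ k + 1 := by
          have := Finset.mem_range.1 hr
          have := Finset.mem_range.1 hi
          omega
        have hdi := hd0 (r - i)
        calc _ = (r.choose i : ℝ) * (i.factorial * 3 ^ (i + 1) * d (r - i)) * q ^ (i + 1) := by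
              rw [mul_pow]; ring
          _ ≤ _ := by gcongr
    _ = _ := by rw [integral_const_mul]; ring

variable {X : Type*} [NormedAddCommGroup X] [NormedSpace ℂ X] [CompleteSpace X]
  {H : X →ₗ.[ℂ] X} {α c ρ : ℝ} {ψ f g : ℝ → ℂ} {n : ℕ}

lemma continuous_jump {Y : Type*} [NormedAddCommGroup Y] [NormedSpace ℂ Y] {R : ℂ → Y}
    (hR : IsResolventLike α c R) {ε : ℝ} (hε : ε ≠ 0) : Continuous (jump R ε) := by
  have hc : ∀ t : ℝ, t ≠ 0 → Continuous fun x : ℝ => R (x + t * Complex.I) := fun t ht =>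
    continuous_iff_continuousAt.2 fun x => ContinuousAt.comp
      (f := fun x : ℝ => (x + t * Complex.I : ℂ))
      (hR.differentiableAt _ (by simpa using ht)).continuousAt (by fun_prop)
  have hsub : ∀ x : ℝ, (x - ε * Complex.I : ℂ) = x + (-ε : ℝ) * Complex.I := fun x => by
    push_cast; ring
  unfold jump
  simp only [hsub]
  exact ((hc _ (neg_ne_zero.2 hε)).sub (hc _ hε)).const_smul _

/-- Fubini and the Cauchy–Pompeiu formula on the real axis. -/
lemma integral_dbar_smul_integral_resFun {Y : Type*} [NormedAddCommGroup Y] [NormedSpace ℂ Y]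
    [CompleteSpace Y] {R : ℂ → Y} (hR : IsResolventLike α c R) {F : ℝ → ℝ → ℂ}
    (hF : IsCompactC1 F) (hI : Integrable fun z => ‖dbar F z‖ * weight 0 z)
    (hg : Continuous g) (hs : HasCompactSupport g) {ε : ℝ} (hε : ε ≠ 0) :
    (-(1 / Real.pi : ℝ) : ℂ) • ∫ z, dbar F z • ∫ x : ℝ, (resFun z * g) x • jump R ε x =
      ∫ x : ℝ, (F x 0 * g x) • jump R ε x := by
  have hj := continuous_jump hR hε
  have hgj : Integrable fun x => g x • jump R ε x :=
    (hg.smul hj).integrable_of_hasCompactSupport hs.smul_right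
  have hint : Integrable (Function.uncurry fun (z : ℂ) (x : ℝ) =>
      (dbar F z * resFun z x) • (g x • jump R ε x)) (volume.prod volume) := by
    refine (hI.mul_prod hgj.norm).mono' ?_ ?_
    · refine AEStronglyMeasurable.smul (Measurable.aestronglyMeasurable ?_)
        (hgj.aestronglyMeasurable.comp_snd)
      have h1 : Measurable (dbar F) := (continuous_dbar hF.contDiff).measurable
      unfold resFun
      exact (h1.comp measurable_fst).mul ((measurable_fst.sub
        (Complex.measurable_ofReal.comp measurable_snd)).inv)
    · filter_upwards [Measure.quasiMeasurePreserving_fst.ae ae_im_ne_zero] with p hp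
      have h0 : 0 < |p.1.im| := abs_pos.2 hp
      simp only [Function.uncurry]
      rw [norm_smul, norm_mul]
      gcongr
      simp only [weight, Real.rpow_zero, mul_one]
      rw [resFun, norm_inv]
      gcongr
      simpa using Complex.abs_im_le_norm (p.1 - p.2)
  have e1 : ∀ z : ℂ, dbar F z • ∫ x : ℝ, (resFun z * g) x • jump R ε x =
      ∫ x : ℝ, (dbar F z * resFun z x) • (g x • jump R ε x) := fun z => by
    rw [← integral_smul]
    simp only [Pi.mul_apply, mul_smul]
  simp only [e1]
  rw [integral_integral_swap hint, ← integral_smul]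
  refine integral_congr_ae (ae_of_all _ fun x => ?_)
  simp only
  rw [integral_smul_const, ← smul_assoc]
  have := integral_dbar_smul_inv_sub le_rfl hF hI x
  simp only [smul_eq_mul] at this ⊢
  rw [show (fun z => dbar F z * resFun z x) = fun z : ℂ => dbar F z * (z - x)⁻¹ from rfl, this,
    mul_smul]

/-- By the resolvent rule, `R(z) g(H)` is the limit of the integrals of `(z - x)⁻¹ g(x)` against the
jump of `R`. Inserting this into the integral for `f(H)` and exchanging the order of integration,
the Cauchy–Pompeiu formula evaluates the `z`-integral to `f(x)`. -/
lemma hsOp_mul_of_hasCompactSupport (hα : 0 ≤ α) (hR : IsResolventLike α c (resolv H))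
    (hspec : ∀ z : ℂ, z.im ≠ 0 → z ∉ spec H) (hψ : IsCutoffAt ρ ψ) (hn : α < n)
    (hf : ContDiff ℝ ∞ f) (hfs : HasCompactSupport f) (hg : ContDiff ℝ ∞ g)
    (hgs : HasCompactSupport g) :
    hsOp (resolv H) n ψ f * hsOp (resolv H) n ψ g = hsOp (resolv H) n ψ (f * g) := by
  have hc := hR.nonneg
  have hfS := mem_slowDecay_of_hasCompactSupport hf hfs
  -- an extension of `f` of order `n + 2` compensates the growth of the norms of `r_z g`
  have hN : (n : ℝ) + 1 < (n + 2 : ℕ) := by push_cast; linarith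
  set F := almostAnalytic (n + 2) ψ f with hF
  have hFc : IsCompactC1 F := isCompactC1_almostAnalytic hψ hf hfs _
  have hQ := integrable_symbolSum hfS (n + 2 + 1)
  have hI : Integrable fun z => ‖dbar F z‖ * weight (n + 1) z :=
    integrable_dbar_mul_weight (by positivity) hψ hN hf hQ
  have hI0 : Integrable fun z => ‖dbar F z‖ * weight 0 z :=
    integrable_dbar_mul_weight le_rfl hψ (by positivity) hf hQ
  obtain ⟨C, hC, hCb⟩ := exists_norm_hsOp_le hα hψ hn
  obtain ⟨D, hD, hDb⟩ := exists_integral_symbolSum_resFun_mul_le hg hgs (n + 1)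
  obtain ⟨M, hM, hzero⟩ := hFc.eq_zero
  -- on the support of `F`, `⟨z⟩ ≤ K`
  set K : ℝ := 1 + (M + M) with hK
  have hbK : ∀ z : ℂ, dbar F z ≠ 0 → bracket z ≤ K := by
    intro z hz
    have h : ¬ (M < |z.re| ∨ M < |z.im|) := fun h => hz (dbar_eq_zero_of_bound hzero h)
    push Not at h
    have h3 : ‖z‖ ≤ M + M := (Complex.norm_le_abs_re_add_abs_im z).trans (add_le_add h.1 h.2)
    refine Real.sqrt_le_iff.2 ⟨by positivity, ?_⟩
    nlinarith [norm_nonneg z]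
  have hjump : ∀ z : ℂ, z.im ≠ 0 → Tendsto
      (fun ε : ℝ => ∫ x : ℝ, (resFun z * g) x • jump (resolv H) ε x) (𝓝[>] 0)
      (𝓝 (resolv H z * hsOp (resolv H) n ψ g)) := fun z hz => by
    rw [← hsOp_resFun_mul hα hR hspec hψ hn hg hgs hz]
    exact tendsto_jump_hsOp hα hR hψ hn (f := resFun z * g) ((contDiff_resFun hz).mul hg)
      hgs.mul_left
  have hbound : ∀ ε : ℝ, 0 < ε → ∀ z : ℂ, z.im ≠ 0 →
      ‖dbar F z • ∫ x : ℝ, (resFun z * g) x • jump (resolv H) ε x‖ ≤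
        c * C * D * K * (‖dbar F z‖ * weight (n + 1) z) := by
    intro ε hε z hz
    have h0 : 0 < |z.im| := abs_pos.2 hz
    have hrg : ContDiff ℝ ∞ (resFun z * g) := (contDiff_resFun hz).mul hg
    have hrs : HasCompactSupport (resFun z * g) := hgs.mul_left
    have h1 : ∫ x : ℝ, (resFun z * g) x • jump (resolv H) ε x =
        hsOp (shiftAway (resolv H) ε) n ψ (resFun z * g) := by
      have := integral_smul_jump (isCompactC1_almostAnalytic hψ hrg hrs n) hR.differentiableAt hε
      unfold hsOp
      simpa only [almostAnalytic_zero hψ] using this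
    by_cases hd : dbar F z = 0
    · simp [hd]
    have h2 := hCb _ _ _ (hR.shiftAway hα hε.le) _ (mem_slowDecay_of_hasCompactSupport hrg hrs)
    have hb := bracket_pos z
    have hw : (bracket z / |z.im|) ^ (n + 1 + 1) ≤ K * weight (n + 1) z := by
      have e : (bracket z / |z.im|) ^ (n + 1 + 1) = bracket z * weight (n + 1) z := by
        rw [weight, show ((n : ℝ) + 1) = ((n + 1 : ℕ) : ℝ) by push_cast; ring, Real.rpow_natCast,
          pow_succ]
        ring
      rw [e]
      exact mul_le_mul_of_nonneg_right (hbK z hd) (weight_nonneg _ _)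
    rw [norm_smul, h1]
    calc _ ≤ ‖dbar F z‖ * (c * C * (D * (K * weight (n + 1) z))) := by
          gcongr
          refine h2.trans ?_
          gcongr
          exact (hDb z hz).trans (by gcongr)
      _ = _ := by ring
  have i1 : Integrable fun z => dbar F z • resolv H z :=
    integrable_hsOp hα hR hψ (by push_cast; linarith) hfS
  have hlim : Tendsto (fun ε : ℝ => (-(1 / Real.pi : ℝ) : ℂ) • ∫ z, dbar F z •
      ∫ x : ℝ, (resFun z * g) x • jump (resolv H) ε x) (𝓝[>] 0)
      (𝓝 ((-(1 / Real.pi : ℝ) : ℂ) • ∫ z, dbar F z • (resolv H z * hsOp (resolv H) n ψ g))) := by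
    refine Tendsto.const_smul (tendsto_integral_filter_of_dominated_convergence _ ?_ ?_
      (hI.const_mul (c * C * D * K)) ?_) _
    · filter_upwards [self_mem_nhdsWithin] with ε hε
      have hε0 : (0 : ℝ) < ε := hε
      have hmeas : AEStronglyMeasurable (Function.uncurry fun (z : ℂ) (x : ℝ) =>
          (resFun z * g) x • jump (resolv H) ε x) (volume.prod volume) := by
        have h1 : Measurable fun p : ℂ × ℝ => resFun p.1 p.2 * g p.2 :=
          ((measurable_fst.sub (Complex.measurable_ofReal.comp measurable_snd)).inv).mul
            (hg.continuous.measurable.comp measurable_snd)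
        exact h1.aestronglyMeasurable.smul
          ((continuous_jump hR hε0.ne').aestronglyMeasurable.comp_snd)
      exact (continuous_dbar hFc.contDiff).aestronglyMeasurable.smul hmeas.integral_prod_right'
    · filter_upwards [self_mem_nhdsWithin] with ε hε
      filter_upwards [ae_im_ne_zero] with z hz
      exact hbound ε hε z hz
    · filter_upwards [ae_im_ne_zero] with z hz
      exact (hjump z hz).const_smul _
  have hval : hsOp (resolv H) n ψ f * hsOp (resolv H) n ψ g =
      (-(1 / Real.pi : ℝ) : ℂ) • ∫ z, dbar F z • (resolv H z * hsOp (resolv H) n ψ g) := by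
    rw [hsOp_eq_hsOp hα hR hψ hn hψ (n' := n + 2) (by push_cast; linarith) hfS]
    conv_lhs => rw [hsOp]
    rw [smul_mul_assoc]
    congr 1
    simp only [← smul_mul_assoc]
    exact (((ContinuousLinearMap.mul ℂ (X →L[ℂ] X)).flip
      (hsOp (resolv H) n ψ g)).integral_comp_comm i1).symm
  rw [hval]
  refine tendsto_nhds_unique hlim ((tendsto_jump_hsOp hα hR hψ hn (f := f * g) (hf.mul hg)
    hfs.mul_right).congr' ?_)
  filter_upwards [self_mem_nhdsWithin] with ε hε
  rw [integral_dbar_smul_integral_resFun hR hFc hI0 hg.continuous hgs (ne_of_gt hε)]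
  simp only [hF, almostAnalytic_zero hψ, Pi.mul_apply]

lemma hsOp_mul (hα : 0 ≤ α) (hR : IsResolventLike α c (resolv H))
    (hspec : ∀ z : ℂ, z.im ≠ 0 → z ∉ spec H) (hψ : IsCutoffAt ρ ψ) (hn : α < n)
    (hf : f ∈ SlowDecay) (hg : g ∈ SlowDecay) :
    hsOp (resolv H) n ψ f * hsOp (resolv H) n ψ g = hsOp (resolv H) n ψ (f * g) := by
  obtain ⟨χ, hχ⟩ := exists_isCutoff
  have hχ2 : IsCutoff (χ * χ) := ⟨hχ.smooth.mul hχ.smooth,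
    fun s hs => by simp [hχ.one s hs], fun s hs => by simp [hχ.zero s hs]⟩
  have h := (tendsto_hsOp_cutMul hα hR hψ hn hχ hf).mul (tendsto_hsOp_cutMul hα hR hψ hn hχ hg)
  have e : ∀ m, hsOp (resolv H) n ψ (cutMul χ m f) * hsOp (resolv H) n ψ (cutMul χ m g) =
      hsOp (resolv H) n ψ (cutMul (χ * χ) m (f * g)) := fun m => by
    rw [hsOp_mul_of_hasCompactSupport hα hR hspec hψ hn
      (contDiff_cutMul hχ (SlowDecay.contDiff hf) m) (hasCompactSupport_cutMul hχ f m)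
      (contDiff_cutMul hχ (SlowDecay.contDiff hg) m) (hasCompactSupport_cutMul hχ g m)]
    congr 1
    ext x
    simp only [cutMul, Pi.mul_apply]
    ring
  simp only [e] at h
  exact tendsto_nhds_unique h
    (tendsto_hsOp_cutMul hα hR hψ hn hχ2 (SlowDecay.mul hf hg))

end Resolvent

/-! ### Existence of Seeley data -/

/-- The weights at the nodes `-8ᵏ`, up to normalisation. They are chosen so that
`c_k = d_k (1 + 8ᵏ)` satisfies `c_{k+1} (8^{k+1} - 1) = -8 c_k`; these are the coefficients of an
entire function vanishing at every `8ⁿ`. -/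
def seeleyWeight : ℕ → ℝ
  | 0 => 1
  | k + 1 => -(8 * (1 + 8 ^ k) / ((8 ^ (k + 1) - 1) * (1 + 8 ^ (k + 1)))) * seeleyWeight k

lemma abs_seeleyWeight_succ_le (k : ℕ) :
    |seeleyWeight (k + 1)| ≤ 8 / (7 * 8 ^ k) * (2 / 9) * |seeleyWeight k| := by
  have h8 : (1 : ℝ) ≤ 8 ^ k := one_le_pow₀ (by norm_num)
  have hs : (8 : ℝ) ^ (k + 1) = 8 * 8 ^ k := by ring
  rw [seeleyWeight, abs_mul, abs_neg]
  refine mul_le_mul_of_nonneg_right ?_ (abs_nonneg _)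
  have h1 : 0 < (8 : ℝ) ^ (k + 1) - 1 := by rw [hs]; linarith
  rw [abs_of_nonneg (by positivity), mul_div_mul_comm]
  have e1 : 8 / ((8 : ℝ) ^ (k + 1) - 1) ≤ 8 / (7 * 8 ^ k) := by
    gcongr
    rw [hs]; linarith
  have e2 : (1 + (8 : ℝ) ^ k) / (1 + 8 ^ (k + 1)) ≤ 2 / 9 := by
    rw [div_le_div_iff₀ (by positivity) (by norm_num), hs]
    linarith
  exact mul_le_mul e1 e2 (by positivity) (by positivity)

lemma summable_seeleyWeight (n : ℕ) : Summable fun k => seeleyWeight k * (8 ^ k) ^ n := by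
  refine summable_of_ratio_norm_eventually_le (r := 1 / 2) (by norm_num) ?_
  filter_upwards [eventually_ge_atTop n] with k hk
  have h := abs_seeleyWeight_succ_le k
  have hpow : (8 : ℝ) ^ n ≤ 8 ^ k := pow_le_pow_right₀ (by norm_num) hk
  have h8 : (0 : ℝ) < 8 ^ k := by positivity
  have p1 : (0 : ℝ) ≤ (8 ^ (k + 1)) ^ n := by positivity
  have p2 : (0 : ℝ) ≤ (8 ^ k) ^ n := by positivity
  rw [norm_mul, norm_mul, Real.norm_of_nonneg p1, Real.norm_of_nonneg p2, Real.norm_eq_abs,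
    Real.norm_eq_abs]
  have e : ((8 : ℝ) ^ (k + 1)) ^ n = 8 ^ n * (8 ^ k) ^ n := by
    rw [pow_succ, mul_pow]; ring
  calc |seeleyWeight (k + 1)| * ((8 : ℝ) ^ (k + 1)) ^ n
      ≤ 8 / (7 * 8 ^ k) * (2 / 9) * |seeleyWeight k| * (8 ^ k * (8 ^ k) ^ n) := by
        rw [e]; gcongr
    _ = 16 / 63 * (|seeleyWeight k| * (8 ^ k) ^ n) := by field_simp; ring
    _ ≤ _ := by
        have : 0 ≤ |seeleyWeight k| * ((8 : ℝ) ^ k) ^ n := by positivity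
        linarith

lemma seeleyWeight_recurrence (k : ℕ) :
    seeleyWeight (k + 1) * (1 + 8 ^ (k + 1)) * (8 ^ (k + 1) - 1) =
      -8 * (seeleyWeight k * (1 + 8 ^ k)) := by
  have h8 : (1 : ℝ) ≤ 8 ^ k := one_le_pow₀ (by norm_num)
  have hs : (8 : ℝ) ^ (k + 1) = 8 * 8 ^ k := by ring
  have h1 : (8 : ℝ) ^ (k + 1) - 1 ≠ 0 := by rw [hs]; linarith
  have h2 : 1 + (8 : ℝ) ^ (k + 1) ≠ 0 := by positivity
  rw [seeleyWeight]
  field_simp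

/-- The power sums of `c_k = d_k (1 + 8ᵏ)` satisfy `e₀ = 0` and `e_{n+1} = (1 - 8^{n+1}) e_n`, hence
vanish; this says that the power sums of `d_k` alternate. -/
lemma tsum_seeleyWeight_succ (n : ℕ) :
    ∑' k, seeleyWeight k * (8 ^ k) ^ (n + 1) = -∑' k, seeleyWeight k * (8 ^ k) ^ n := by
  set c : ℕ → ℝ := fun k => seeleyWeight k * (1 + 8 ^ k) with hc
  have hcs : ∀ n, Summable fun k => c k * (8 ^ k) ^ n := fun n => by
    refine ((summable_seeleyWeight n).add (summable_seeleyWeight (n + 1))).congr fun k => ?_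
    simp only [hc]; ring
  have hce : ∀ n, ∑' k, c k * (8 ^ k) ^ n =
      ∑' k, seeleyWeight k * (8 ^ k) ^ n + ∑' k, seeleyWeight k * (8 ^ k) ^ (n + 1) := fun n => by
    rw [← (summable_seeleyWeight n).tsum_add (summable_seeleyWeight (n + 1))]
    refine tsum_congr fun k => ?_
    simp only [hc]; ring
  have hrec : ∀ k, c (k + 1) * (8 ^ (k + 1) - 1) = -8 * c k := seeleyWeight_recurrence
  have hinv : Summable fun k => c k * ((8 : ℝ) ^ k)⁻¹ := by
    refine Summable.of_norm_bounded (hcs 0).norm fun k => ?_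
    have h8 : (1 : ℝ) ≤ 8 ^ k := one_le_pow₀ (by norm_num)
    rw [norm_mul, norm_inv, pow_zero, mul_one, Real.norm_of_nonneg (zero_le_one.trans h8)]
    exact mul_le_of_le_one_right (norm_nonneg _) (inv_le_one_of_one_le₀ h8)
  have h0 : ∑' k, c k * (8 ^ k) ^ 0 = 0 := by
    have e1 := (hcs 0).tsum_eq_zero_add
    have e2 := hinv.tsum_eq_zero_add
    have e3 : ∑' k, c (k + 1) * ((8 : ℝ) ^ (k + 1)) ^ 0 - ∑' k, c (k + 1) * ((8 : ℝ) ^ (k + 1))⁻¹ =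
        -∑' k, c k * ((8 : ℝ) ^ k)⁻¹ := by
      rw [← ((summable_nat_add_iff 1).2 (hcs 0)).tsum_sub ((summable_nat_add_iff 1).2 hinv),
        ← tsum_neg]
      refine tsum_congr fun k => ?_
      have := hrec k
      generalize c (k + 1) = u at this ⊢
      generalize c k = v at this ⊢
      rw [pow_succ] at this ⊢
      field_simp
      linear_combination this
    simp only [pow_zero, inv_one] at e1 e2 e3 ⊢
    linarith
  have hstep : ∀ n, ∑' k, c k * (8 ^ k) ^ (n + 1) =
      (1 - 8 ^ (n + 1)) * ∑' k, c k * (8 ^ k) ^ n := by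
    intro n
    have e1 := (hcs n).tsum_eq_zero_add
    have e2 := (hcs (n + 1)).tsum_eq_zero_add
    have e3 : ∑' k, c (k + 1) * ((8 : ℝ) ^ (k + 1)) ^ (n + 1) -
        ∑' k, c (k + 1) * ((8 : ℝ) ^ (k + 1)) ^ n =
          -8 ^ (n + 1) * ∑' k, c k * ((8 : ℝ) ^ k) ^ n := by
      rw [← ((summable_nat_add_iff 1).2 (hcs (n + 1))).tsum_sub ((summable_nat_add_iff 1).2
        (hcs n)),
        ← tsum_mul_left]
      refine tsum_congr fun k => ?_
      have := hrec k
      have e : ((8 : ℝ) ^ (k + 1)) ^ n = 8 ^ n * (8 ^ k) ^ n := by rw [pow_succ, mul_pow]; ring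
      rw [pow_succ ((8 : ℝ) ^ (k + 1)), e]
      linear_combination (8 ^ n * (8 ^ k) ^ n) * this
    simp only [pow_zero, one_pow, mul_one] at e1 e2
    linarith
  have hzero : ∀ n, ∑' k, c k * (8 ^ k) ^ n = 0 := fun n => by
    induction n with
    | zero => exact h0
    | succ n ih => rw [hstep, ih, mul_zero]
  have := hce n
  rw [hzero] at this
  linarith

lemma tsum_seeleyWeight_pos : 0 < ∑' k, seeleyWeight k * (8 ^ k) ^ 0 := by
  simp only [pow_zero, mul_one]
  have hb : ∀ k, |seeleyWeight k| ≤ (1 / 3) ^ k := fun k => by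
    induction k with
    | zero => simp [seeleyWeight]
    | succ k ih =>
      refine (abs_seeleyWeight_succ_le k).trans ?_
      have h8 : (1 : ℝ) ≤ 8 ^ k := one_le_pow₀ (by norm_num)
      have : 8 / (7 * (8 : ℝ) ^ k) * (2 / 9) ≤ 1 / 3 := by
        rw [div_mul_div_comm, div_le_div_iff₀ (by positivity) (by norm_num)]
        linarith
      rw [pow_succ, mul_comm ((1 / 3 : ℝ) ^ k)]
      gcongr
  have hs : Summable seeleyWeight := by simpa using summable_seeleyWeight 0
  rw [hs.tsum_eq_zero_add]
  have hg : Summable fun k : ℕ => (1 / 3 : ℝ) ^ (k + 1) :=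
    (summable_nat_add_iff 1).2 (summable_geometric_of_lt_one (by norm_num) (by norm_num))
  have h1 : ‖∑' k, seeleyWeight (k + 1)‖ ≤ ∑' k : ℕ, (1 / 3 : ℝ) ^ (k + 1) :=
    tsum_of_norm_bounded hg.hasSum fun k => hb (k + 1)
  have h2 : ∑' k : ℕ, (1 / 3 : ℝ) ^ (k + 1) = 1 / 2 := by
    simp only [pow_succ]
    rw [tsum_mul_right, tsum_geometric_of_lt_one (by norm_num) (by norm_num)]
    norm_num
  rw [h2] at h1
  have h3 := (abs_le.1 h1).1
  have h4 : seeleyWeight 0 = 1 := rfl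
  linarith

/-- The normalised weights have moments `∑ a_k (8ᵏ)ⁿ = (-1)ⁿ`, as required for the nodes `-8ᵏ`. -/
theorem exists_isSeeleyData : ∃ (a b : ℕ → ℝ) (φ : ℝ → ℂ), IsSeeleyData a b φ := by
  set m := ∑' k, seeleyWeight k * (8 ^ k) ^ 0 with hm
  have hm0 : m ≠ 0 := tsum_seeleyWeight_pos.ne'
  have hmn : ∀ n, ∑' k, seeleyWeight k * (8 ^ k) ^ n = (-1) ^ n * m := fun n => by
    induction n with
    | zero => simp [hm]
    | succ n ih => rw [tsum_seeleyWeight_succ, ih]; ring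
  let B : ContDiffBump (1 / 2 : ℝ) := ⟨1 / 2, 3 / 2, by norm_num, by norm_num⟩
  refine ⟨fun k => seeleyWeight k / m, fun k => -8 ^ k, fun x => (B x : ℂ), ?_⟩
  refine ⟨fun k => by simp, fun n => ?_, fun n => ?_, ?_, Complex.ofRealCLM.contDiff.comp
    B.contDiff,
    fun x hx => ?_, fun x hx => ?_, fun x hx => ?_⟩
  · refine ((summable_seeleyWeight n).abs.div_const |m|).congr fun k => ?_
    rw [abs_div, abs_mul, abs_neg, abs_of_pos (by positivity : (0 : ℝ) < (8 ^ k) ^ n),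
      abs_of_pos (by positivity : (0 : ℝ) < 8 ^ k)]
    ring
  · have : ∀ k, seeleyWeight k / m * (-(8 : ℝ) ^ k) ^ n =
        ((-1) ^ n / m) * (seeleyWeight k * (8 ^ k) ^ n) := fun k => by
      rw [neg_pow]; ring
    simp only [this]
    rw [tsum_mul_left, hmn, div_mul_eq_mul_div, ← mul_assoc, ← mul_pow]
    simp [hm0]
  · exact tendsto_neg_atTop_atBot.comp (tendsto_pow_atTop_atTop_of_one_lt (by norm_num))
  · have : B x = 1 := B.one_of_mem_closedBall (by
      rw [mem_closedBall_iff_norm, Real.norm_eq_abs, abs_le]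
      constructor <;> norm_num [B] <;> linarith [hx.1, hx.2])
    simp [this]
  · have : B x = 0 := B.zero_of_le_dist (by
      rw [Real.dist_eq, abs_of_nonneg (by linarith)]
      norm_num [B]; linarith)
    simp [this]
  · have : B x = 0 := B.zero_of_le_dist (by
      rw [Real.dist_eq, abs_of_nonpos (by linarith)]
      norm_num [B]; linarith)
    simp [this]

/-! ### Smoothness of Seeley's extension -/

section Seeley

lemma hasDerivWithinAt_iteratedDerivWithin_Ici {F : ℝ → ℂ} (hF : ContDiffOn ℝ ∞ F (Ici 0)) (n : ℕ)
    {x : ℝ} (hx : x ∈ Ici (0 : ℝ)) :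
    HasDerivWithinAt (iteratedDerivWithin n F (Ici 0)) (iteratedDerivWithin (n + 1) F (Ici 0) x)
      (Ici 0) x := by
  have hd : DifferentiableOn ℝ (iteratedDerivWithin n F (Ici 0)) (Ici 0) :=
    hF.differentiableOn_iteratedDerivWithin (by exact_mod_cast WithTop.coe_lt_top _)
      (uniqueDiffOn_Ici 0)
  rw [iteratedDerivWithin_succ]
  exact (hd x hx).hasDerivWithinAt

lemma continuousOn_iteratedDerivWithin_Ici {F : ℝ → ℂ} (hF : ContDiffOn ℝ ∞ F (Ici 0)) (n : ℕ) :
    ContinuousOn (iteratedDerivWithin n F (Ici 0)) (Ici 0) := fun _ hx =>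
  (hasDerivWithinAt_iteratedDerivWithin_Ici hF n hx).continuousWithinAt

/-- The `n`-th derivative on `[0, ∞)` of the localised function `φ f`, from which the terms of
Seeley's extension arise by scaling. -/
def localDeriv (φ : ℝ → ℂ) (n : ℕ) (f : Ici (0 : ℝ) → ℂ) (t : ℝ) : ℂ :=
  iteratedDerivWithin n (φ * IciExtend f) (Ici 0) t

/-- The series `∑ a_k b_kⁿ (φ f)⁽ⁿ⁾(b_k x)` that gives the `n`-th derivative of Seeley's extension
at `x < 0`. -/
def seeleySum (a b : ℕ → ℝ) (φ : ℝ → ℂ) (n : ℕ) (f : Ici (0 : ℝ) → ℂ) (x : ℝ) : ℂ :=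
  ∑' k, ((a k * b k ^ n : ℝ) : ℂ) * localDeriv φ n f (b k * x)

variable {a b : ℕ → ℝ} {φ : ℝ → ℂ} {f : Ici (0 : ℝ) → ℂ}

lemma IsSeeleyData.contDiffOn (hS : IsSeeleyData a b φ)
    (hf : ContDiffOn ℝ ∞ (IciExtend f) (Ici 0)) :
    ContDiffOn ℝ ∞ (φ * IciExtend f) (Ici 0) :=
  hS.smooth.contDiffOn.mul hf

lemma localDeriv_eq_zero (hS : IsSeeleyData a b φ) (n : ℕ) {t : ℝ} (ht : 2 < t) :
    localDeriv φ n f t = 0 := by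
  have h : φ * IciExtend f =ᶠ[𝓝[Ici 0] t] fun _ => 0 := by
    refine nhdsWithin_le_nhds ?_
    filter_upwards [lt_mem_nhds ht] with s hs
    simp [hS.zero_right s hs.le]
  rw [localDeriv, h.iteratedDerivWithin_eq (by simp [hS.zero_right t ht.le]),
    iteratedDerivWithin_const]
  split_ifs <;> rfl

lemma localDeriv_zero_right (hS : IsSeeleyData a b φ) (n : ℕ) :
    localDeriv φ n f 0 = halfDeriv n f 0 := by
  have h : φ * IciExtend f =ᶠ[𝓝[Ici 0] 0] IciExtend f := by
    filter_upwards [self_mem_nhdsWithin, nhdsWithin_le_nhds (gt_mem_nhds one_pos)] with s hs hs1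
    simp [hS.one s ⟨hs, le_of_lt hs1⟩]
  exact h.iteratedDerivWithin_eq (h.self_of_nhdsWithin self_mem_Ici)

lemma exists_norm_localDeriv_le (hS : IsSeeleyData a b φ)
    (hf : ContDiffOn ℝ ∞ (IciExtend f) (Ici 0)) (n : ℕ) :
    ∃ B, ∀ t ∈ Ici (0 : ℝ), ‖localDeriv φ n f t‖ ≤ B := by
  obtain ⟨B, hB⟩ := (isCompact_Icc (a := (0 : ℝ)) (b := 2)).exists_bound_of_continuousOn
    ((continuousOn_iteratedDerivWithin_Ici (hS.contDiffOn hf) n).mono Icc_subset_Ici_self)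
  refine ⟨B, fun t ht => ?_⟩
  rcases le_or_gt t 2 with h | h
  · exact hB t ⟨ht, h⟩
  · rw [localDeriv_eq_zero hS n h, norm_zero]
    exact (norm_nonneg _).trans (hB 0 (by norm_num))

lemma IsSeeleyData.mul_mem_Ici (hS : IsSeeleyData a b φ) (k : ℕ) {x : ℝ} (hx : x ≤ 0) :
    b k * x ∈ Ici (0 : ℝ) :=
  mul_nonneg_of_nonpos_of_nonpos (hS.neg k).le hx

lemma norm_seeleySum_term_le {n : ℕ} {B : ℝ} (hS : IsSeeleyData a b φ)
    (hB : ∀ t ∈ Ici (0 : ℝ), ‖localDeriv φ n f t‖ ≤ B) (k : ℕ) {x : ℝ} (hx : x ≤ 0) :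
    ‖((a k * b k ^ n : ℝ) : ℂ) * localDeriv φ n f (b k * x)‖ ≤ |a k| * |b k| ^ n * B := by
  rw [norm_mul, Complex.norm_real, Real.norm_eq_abs, abs_mul, abs_pow]
  exact mul_le_mul_of_nonneg_left (hB _ (hS.mul_mem_Ici k hx)) (by positivity)

lemma continuousOn_seeleySum (hS : IsSeeleyData a b φ)
    (hf : ContDiffOn ℝ ∞ (IciExtend f) (Ici 0)) (n : ℕ) :
    ContinuousOn (seeleySum a b φ n f) (Iic 0) := by
  obtain ⟨B, hB⟩ := exists_norm_localDeriv_le hS hf n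
  refine continuousOn_tsum (fun k => ?_) ((hS.summable n).mul_right B)
    fun k x hx => norm_seeleySum_term_le hS hB k hx
  exact continuousOn_const.mul ((continuousOn_iteratedDerivWithin_Ici (hS.contDiffOn hf) n).comp
    (continuousOn_const.mul continuousOn_id) fun x hx => hS.mul_mem_Ici k hx)

lemma hasDerivAt_seeleySum (hS : IsSeeleyData a b φ)
    (hf : ContDiffOn ℝ ∞ (IciExtend f) (Ici 0)) (n : ℕ) {x : ℝ} (hx : x < 0) :
    HasDerivAt (seeleySum a b φ n f) (seeleySum a b φ (n + 1) f x) x := by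
  obtain ⟨B, hB⟩ := exists_norm_localDeriv_le hS hf n
  obtain ⟨B', hB'⟩ := exists_norm_localDeriv_le hS hf (n + 1)
  refine hasDerivAt_tsum_of_isPreconnected (t := Iio 0)
    (g' := fun k y => ((a k * b k ^ (n + 1) : ℝ) : ℂ) * localDeriv φ (n + 1) f (b k * y))
    ((hS.summable (n + 1)).mul_right B')
    isOpen_Iio isPreconnected_Iio (fun k y hy => ?_)
    (fun k y hy => norm_seeleySum_term_le hS hB' k (le_of_lt (mem_Iio.1 hy))) hx
    (Summable.of_norm_bounded ((hS.summable n).mul_right B)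
      fun k => norm_seeleySum_term_le hS hB k hx.le) hx
  have hpos : 0 < b k * y := mul_pos_of_neg_of_neg (hS.neg k) hy
  have h1 := (hasDerivWithinAt_iteratedDerivWithin_Ici (hS.contDiffOn hf) n hpos.le).hasDerivAt
    (Ici_mem_nhds hpos)
  have h2 : HasDerivAt (fun y => b k * y) (b k) y := by
    simpa using (hasDerivAt_id y).const_mul (b k)
  have h3 := (h1.scomp y h2).const_mul ((a k * b k ^ n : ℝ) : ℂ)
  convert! h3 using 1
  rw [localDeriv, Complex.real_smul]
  push_cast
  ring

/-- The moment conditions make the one-sided derivatives at `0` agree. -/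
lemma seeleySum_zero_right (hS : IsSeeleyData a b φ) (n : ℕ) :
    seeleySum a b φ n f 0 = halfDeriv n f 0 := by
  simp only [seeleySum, mul_zero, localDeriv_zero_right hS]
  rw [tsum_mul_right, ← Complex.ofReal_tsum, hS.moment, Complex.ofReal_one, one_mul]

/-- The function that is the `n`-th derivative of Seeley's extension. -/
def seeleyDeriv (a b : ℕ → ℝ) (φ : ℝ → ℂ) (n : ℕ) (f : Ici (0 : ℝ) → ℂ) (x : ℝ) : ℂ :=
  if x < 0 then seeleySum a b φ n f x else halfDeriv n f x

lemma seeleyDeriv_of_neg {n : ℕ} {x : ℝ} (hx : x < 0) :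
    seeleyDeriv a b φ n f x = seeleySum a b φ n f x := if_pos hx

lemma seeleyDeriv_of_nonneg {n : ℕ} {x : ℝ} (hx : 0 ≤ x) :
    seeleyDeriv a b φ n f x = halfDeriv n f x := if_neg hx.not_gt

lemma seeleyDeriv_of_nonpos (hS : IsSeeleyData a b φ) {n : ℕ} {x : ℝ} (hx : x ≤ 0) :
    seeleyDeriv a b φ n f x = seeleySum a b φ n f x := by
  rcases hx.lt_or_eq with h | rfl
  · exact seeleyDeriv_of_neg h
  · rw [seeleyDeriv_of_nonneg le_rfl, seeleySum_zero_right hS]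

lemma seeleyDeriv_zero : seeleyDeriv a b φ 0 f = seeley a b φ f := by
  ext x
  by_cases hx : x < 0
  · simp [seeleyDeriv, seeley, hx, seeleySum, localDeriv]
  · simp [seeleyDeriv, seeley, hx, halfDeriv]

lemma seeley_of_nonneg {x : ℝ} (hx : 0 ≤ x) : seeley a b φ f x = f ⟨x, hx⟩ := by
  rw [seeley, if_neg hx.not_gt, IciExtend_of_mem f hx]

lemma hasDerivAt_seeleyDeriv (hS : IsSeeleyData a b φ)
    (hf : ContDiffOn ℝ ∞ (IciExtend f) (Ici 0)) (n : ℕ) (x : ℝ) :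
    HasDerivAt (seeleyDeriv a b φ n f) (seeleyDeriv a b φ (n + 1) f x) x := by
  have hright : ∀ {y : ℝ}, 0 ≤ y → HasDerivWithinAt (seeleyDeriv a b φ n f)
      (seeleyDeriv a b φ (n + 1) f y) (Ici 0) y := fun {y} hy => by
    rw [seeleyDeriv_of_nonneg hy]
    exact (hasDerivWithinAt_iteratedDerivWithin_Ici hf n hy).congr
      (fun z hz => seeleyDeriv_of_nonneg hz) (seeleyDeriv_of_nonneg hy)
  rcases lt_trichotomy x 0 with hx | rfl | hx
  · rw [seeleyDeriv_of_neg hx]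
    refine (hasDerivAt_seeleySum hS hf n hx).congr_of_eventuallyEq ?_
    filter_upwards [gt_mem_nhds hx] with y hy
    exact seeleyDeriv_of_neg hy
  · have hleft : HasDerivWithinAt (seeleySum a b φ n f) (seeleySum a b φ (n + 1) f 0)
        (Iic 0) 0 := by
      refine hasDerivWithinAt_Iic_of_tendsto_deriv (s := Iio 0)
        (fun y hy => (hasDerivAt_seeleySum hS hf n hy).differentiableAt.differentiableWithinAt)
        ((continuousOn_seeleySum hS hf n 0 self_mem_Iic).mono Iio_subset_Iic_self)
        self_mem_nhdsWithin ?_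
      have h := (continuousOn_seeleySum hS hf (n + 1) 0 self_mem_Iic).mono Iio_subset_Iic_self
      refine h.tendsto.congr' ?_
      filter_upwards [self_mem_nhdsWithin] with y hy
      exact (hasDerivAt_seeleySum hS hf n hy).deriv.symm
    rw [← seeleyDeriv_of_nonpos hS le_rfl] at hleft
    have h := (hleft.congr (fun y hy => seeleyDeriv_of_nonpos hS hy)
      (seeleyDeriv_of_nonpos hS le_rfl)).union (hright le_rfl)
    rwa [Iic_union_Ici, hasDerivWithinAt_univ] at h
  · exact (hright hx.le).hasDerivAt (Ici_mem_nhds hx)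

lemma iteratedDeriv_seeley (hS : IsSeeleyData a b φ)
    (hf : ContDiffOn ℝ ∞ (IciExtend f) (Ici 0)) (n : ℕ) :
    iteratedDeriv n (seeley a b φ f) = seeleyDeriv a b φ n f := by
  induction n with
  | zero => rw [iteratedDeriv_zero, seeleyDeriv_zero]
  | succ n ih =>
    rw [iteratedDeriv_succ, ih]
    ext x
    exact (hasDerivAt_seeleyDeriv hS hf n x).deriv

lemma contDiff_seeley (hS : IsSeeleyData a b φ)
    (hf : ContDiffOn ℝ ∞ (IciExtend f) (Ici 0)) : ContDiff ℝ ∞ (seeley a b φ f) := by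
  refine contDiff_of_differentiable_iteratedDeriv fun m _ => ?_
  rw [iteratedDeriv_seeley hS hf]
  exact fun x => (hasDerivAt_seeleyDeriv hS hf m x).differentiableAt

/-- The nodes `b_k` stay away from `0`, since they are negative and tend to `-∞`. -/
lemma IsSeeleyData.exists_le_abs (hS : IsSeeleyData a b φ) : ∃ κ > 0, ∀ k, b k ≤ -κ := by
  obtain ⟨N, hN⟩ := eventually_atTop.1 (hS.tendsto.eventually_le_atBot (-1))
  obtain ⟨m, -, hm⟩ := (Finset.range (N + 1)).exists_max_image b ⟨0, by simp⟩
  refine ⟨min 1 (-b m), lt_min one_pos (neg_pos.2 (hS.neg m)), fun k => ?_⟩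
  rcases le_or_gt N k with h | h
  · have := hN k h
    have := min_le_left 1 (-b m)
    linarith
  · have := hm k (by simp; omega)
    have := min_le_right 1 (-b m)
    linarith

lemma seeleySum_eq_zero (hS : IsSeeleyData a b φ) {κ : ℝ} (hκ : 0 < κ) (hb : ∀ k, b k ≤ -κ) (n : ℕ)
    {x : ℝ} (hx : x < -(2 / κ)) : seeleySum a b φ n f x = 0 := by
  have : ∀ k, localDeriv φ n f (b k * x) = 0 := fun k => by
    refine localDeriv_eq_zero hS n ?_
    have h1 : 2 / κ < -x := by linarith
    rw [div_lt_iff₀ hκ] at h1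
    have h2 : 0 < -x := by have : 0 < 2 / κ := by positivity
                           linarith
    nlinarith [hb k]
  simp [seeleySum, this]

theorem seeley_mem_slowDecay (hS : IsSeeleyData a b φ) (hf : f ∈ SlowDecayPlus) :
    seeley a b φ f ∈ SlowDecay := by
  obtain ⟨β, hβ, hf⟩ := hf
  obtain ⟨κ, hκ, hb⟩ := hS.exists_le_abs
  refine ⟨β, hβ, contDiff_seeley hS hf.1, fun n => ?_⟩
  obtain ⟨c, hc⟩ := hf.2 n
  have hw : Continuous fun x : ℝ => bracket x ^ ((n : ℝ) - β) :=
    continuous_bracket.rpow_const fun x => Or.inl (bracket_pos x).ne'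
  obtain ⟨d, hd⟩ := (isCompact_Icc (a := -(2 / κ)) (b := 0)).exists_bound_of_continuousOn
    (hw.continuousOn.smul ((continuousOn_seeleySum hS hf.1 n).mono Icc_subset_Iic_self))
  have hd0 : 0 ≤ d := (norm_nonneg _).trans (hd 0 ⟨by simpa using by positivity, le_rfl⟩)
  refine ⟨max c d, fun x => ?_⟩
  have hp := Real.rpow_pos_of_pos (bracket_pos x) (β - n)
  rw [iteratedDeriv_seeley hS hf.1]
  rcases lt_or_ge x 0 with hx | hx
  · rw [seeleyDeriv_of_neg hx]
    rcases lt_or_ge x (-(2 / κ)) with hx' | hx'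
    · rw [seeleySum_eq_zero hS hκ hb n hx', norm_zero]
      exact mul_nonneg (hd0.trans (le_max_right _ _)) hp.le
    · have h := hd x ⟨hx', hx.le⟩
      have hq := Real.rpow_pos_of_pos (bracket_pos x) ((n : ℝ) - β)
      simp only [Pi.smul_apply', norm_smul, Real.norm_of_nonneg hq.le] at h
      refine le_trans ?_ (mul_le_mul_of_nonneg_right (le_max_right c d) hp.le)
      rw [show β - n = -((n : ℝ) - β) by ring, Real.rpow_neg (bracket_pos x).le, ← div_eq_mul_inv,
        le_div_iff₀ hq]
      linarith
  · rw [seeleyDeriv_of_nonneg hx]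
    exact (hc x hx).trans (mul_le_mul_of_nonneg_right (le_max_left _ _) hp.le)

/-! ### Norm bounds for Seeley's extension -/

lemma integrable_iteratedDeriv_mul_bracket {g : ℝ → ℂ} (hg : g ∈ SlowDecay) (r : ℕ) :
    Integrable fun x : ℝ => ‖iteratedDeriv r g x‖ * bracket x ^ ((r : ℝ) - 1) := by
  have hc : Continuous fun x : ℝ => ‖iteratedDeriv r g x‖ * bracket x ^ ((r : ℝ) - 1) :=
    (contDiff_iteratedDeriv (SlowDecay.contDiff hg) r).continuous.norm.mul
      (continuous_bracket.rpow_const fun x => Or.inl (bracket_pos x).ne')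
  refine (integrable_symbolSum hg r).mono' hc.aestronglyMeasurable (ae_of_all _ fun x => ?_)
  have hnn : ∀ j : ℕ, 0 ≤ ‖iteratedDeriv j g x‖ * bracket x ^ ((j : ℝ) - 1) := fun j =>
    mul_nonneg (norm_nonneg _) (Real.rpow_nonneg (bracket_pos x).le _)
  rw [Real.norm_of_nonneg (hnn r)]
  exact Finset.single_le_sum (f := fun j : ℕ => ‖iteratedDeriv j g x‖ * bracket x ^ ((j : ℝ) - 1))
    (fun j _ => hnn j) (Finset.self_mem_range_succ r)

lemma integrableOn_halfDeriv (hS : IsSeeleyData a b φ) (hf : f ∈ SlowDecayPlus) (r : ℕ) :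
    IntegrableOn (fun x : ℝ => ‖halfDeriv r f x‖ * bracket x ^ ((r : ℝ) - 1)) (Ici 0) := by
  obtain ⟨β, -, hf'⟩ := id hf
  refine (integrable_iteratedDeriv_mul_bracket (seeley_mem_slowDecay hS hf)
    r).integrableOn.congr_fun
    (fun x hx => ?_) measurableSet_Ici
  simp only [iteratedDeriv_seeley hS hf'.1, seeleyDeriv_of_nonneg (mem_Ici.1 hx)]

/-- The integrand of `halfNorm`. -/
def halfSum (k : ℕ) (f : Ici (0 : ℝ) → ℂ) (x : ℝ) : ℝ :=
  ∑ r ∈ Finset.range (k + 1), ‖halfDeriv r f x‖ * bracket x ^ ((r : ℝ) - 1)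

lemma halfSum_term_nonneg (r : ℕ) (f : Ici (0 : ℝ) → ℂ) (x : ℝ) :
    0 ≤ ‖halfDeriv r f x‖ * bracket x ^ ((r : ℝ) - 1) :=
  mul_nonneg (norm_nonneg _) (Real.rpow_nonneg (bracket_pos x).le _)

lemma integrableOn_halfSum (hS : IsSeeleyData a b φ) (hf : f ∈ SlowDecayPlus) (k : ℕ) :
    IntegrableOn (halfSum k f) (Ici 0) :=
  integrable_finsetSum _ fun r _ => integrableOn_halfDeriv hS hf r

lemma setIntegral_halfSum (hS : IsSeeleyData a b φ) (hf : f ∈ SlowDecayPlus) (k : ℕ) :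
    ∫ x in Ici (0 : ℝ), halfSum k f x = halfNorm k f :=
  integral_finsetSum _ fun r _ => integrableOn_halfDeriv hS hf r

lemma halfNorm_mono {r k : ℕ} (h : r ≤ k) (f : Ici (0 : ℝ) → ℂ) : halfNorm r f ≤ halfNorm k f :=
  Finset.sum_le_sum_of_subset_of_nonneg (Finset.range_mono (by omega)) fun j _ _ =>
    integral_nonneg fun x => halfSum_term_nonneg j f x

/-- Leibniz' rule; the weights `⟨t⟩^{j-1}` are bounded below on the support `[0, 2]`. -/
lemma exists_norm_localDeriv_le_halfSum (hS : IsSeeleyData a b φ) (r : ℕ) :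
    ∃ D ≥ 0, ∀ f ∈ SlowDecayPlus, ∀ t ∈ Ici (0 : ℝ), ‖localDeriv φ r f t‖ ≤ D * halfSum r f t := by
  have hP : ∀ i : ℕ, ∃ P, ∀ t ∈ Icc (0 : ℝ) 2, ‖iteratedDeriv i φ t‖ ≤ P := fun i =>
    isCompact_Icc.exists_bound_of_continuousOn (contDiff_iteratedDeriv hS.smooth
      i).continuous.continuousOn
  choose P hP using hP
  have hP0 : ∀ i, 0 ≤ P i := fun i => (norm_nonneg _).trans (hP i 0 (by norm_num))
  refine ⟨∑ i ∈ Finset.range (r + 1), (r.choose i : ℝ) * (P i * 3),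
    Finset.sum_nonneg fun i _ => mul_nonneg (Nat.cast_nonneg _) (mul_nonneg (hP0 i) (by norm_num)),
    fun f hf t ht => ?_⟩
  obtain ⟨β, -, hf⟩ := hf
  rcases lt_or_ge 2 t with h2 | h2
  · rw [localDeriv_eq_zero hS r h2, norm_zero]
    exact mul_nonneg (Finset.sum_nonneg fun i _ => mul_nonneg (Nat.cast_nonneg _)
      (mul_nonneg (hP0 i) (by norm_num))) (Finset.sum_nonneg fun j _ => halfSum_term_nonneg j f t)
  have hn : (r : WithTop ℕ∞) ≤ ∞ := by exact_mod_cast le_top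
  rw [localDeriv, iteratedDerivWithin_mul ht (uniqueDiffOn_Ici 0)
    (hS.smooth.contDiffAt.of_le hn).contDiffWithinAt ((hf.1 t ht).of_le hn), Finset.sum_mul]
  refine (norm_sum_le _ _).trans (Finset.sum_le_sum fun i hi => ?_)
  rw [iteratedDerivWithin_eq_iteratedDeriv (uniqueDiffOn_Ici 0) (contDiffAt_of_infty hS.smooth i t)
    ht, norm_mul, norm_mul, Complex.norm_natCast, mul_assoc, mul_assoc, mul_assoc]
  have hb : bracket t ≤ 3 := by
    rw [bracket, Real.sqrt_le_iff, Real.norm_eq_abs, sq_abs]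
    exact ⟨by norm_num, by nlinarith [mem_Ici.1 ht]⟩
  have hw : 1 ≤ 3 * bracket t ^ (((r - i : ℕ) : ℝ) - 1) := by
    have h1 : bracket t ^ (-1 : ℝ) ≤ bracket t ^ (((r - i : ℕ) : ℝ) - 1) :=
      Real.rpow_le_rpow_of_exponent_le (one_le_bracket t)
        (by have : (0 : ℝ) ≤ ((r - i : ℕ) : ℝ) := Nat.cast_nonneg _
            linarith)
    rw [Real.rpow_neg_one] at h1
    have h3 : (3 : ℝ)⁻¹ ≤ (bracket t)⁻¹ := inv_anti₀ (bracket_pos t) hb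
    linarith
  have hle : ‖halfDeriv (r - i) f t‖ ≤ 3 * halfSum r f t := by
    have h1 : ‖halfDeriv (r - i) f t‖ * bracket t ^ (((r - i : ℕ) : ℝ) - 1) ≤ halfSum r f t :=
      Finset.single_le_sum (f := fun j : ℕ => ‖halfDeriv j f t‖ * bracket t ^ ((j : ℝ) - 1))
        (fun j _ => halfSum_term_nonneg j f t) (Finset.mem_range.2 (by omega))
    nlinarith [norm_nonneg (halfDeriv (r - i) f t)]
  refine mul_le_mul_of_nonneg_left ?_ (Nat.cast_nonneg _)
  exact mul_le_mul (hP i t ⟨ht, h2⟩) hle (norm_nonneg _) (hP0 i)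

lemma integrableOn_Iic_of_continuousOn {g : ℝ → ℝ} (hg : ContinuousOn g (Iic 0)) {L : ℝ}
    (h0 : ∀ x < -L, g x = 0) : IntegrableOn g (Iic 0) := by
  have h : IntegrableOn g (Icc (-L) 0) := (hg.mono Icc_subset_Iic_self).integrableOn_Icc
  refine h.of_forall_sdiff_eq_zero measurableSet_Iic fun x hx => h0 x ?_
  by_contra! h'
  exact hx.2 ⟨h', hx.1⟩

lemma setIntegral_Iic_comp_mul_left {c : ℝ} (hc : c < 0) (g : ℝ → ℝ) :
    ∫ x in Iic (0 : ℝ), g (c * x) = |c|⁻¹ * ∫ x in Ici (0 : ℝ), g x := by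
  rw [← integral_indicator measurableSet_Iic, ← integral_indicator measurableSet_Ici, ← abs_inv,
    ← smul_eq_mul, ← Measure.integral_comp_mul_left]
  congr 1 with x
  have : c * x ∈ Ici (0 : ℝ) ↔ x ∈ Iic (0 : ℝ) := by
    simp only [mem_Ici, mem_Iic]
    constructor
    · intro h
      by_contra! h'
      nlinarith
    · intro h
      exact mul_nonneg_of_nonpos_of_nonpos hc.le h
  by_cases hx : x ∈ Iic (0 : ℝ)
  · rw [indicator_of_mem hx, indicator_of_mem (this.2 hx)]
  · rw [indicator_of_notMem hx, indicator_of_notMem (fun h => hx (this.1 h))]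

lemma exists_setIntegral_seeleySum_le (hS : IsSeeleyData a b φ) (r : ℕ) :
    ∃ M ≥ 0, ∀ f ∈ SlowDecayPlus, ∫ x in Iic (0 : ℝ),
      ‖seeleySum a b φ r f x‖ * bracket x ^ ((r : ℝ) - 1) ≤ M * halfNorm r f := by
  obtain ⟨κ, hκ, hb⟩ := hS.exists_le_abs
  obtain ⟨D, hD, hle⟩ := exists_norm_localDeriv_le_halfSum hS r
  set W : ℝ := bracket (2 / κ) ^ (r : ℝ) with hW
  have hW0 : 0 ≤ W := Real.rpow_nonneg (bracket_pos _).le _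
  set A : ℝ := ∑' k, |a k| * |b k| ^ r with hA
  have hA0 : 0 ≤ A := tsum_nonneg fun k => by positivity
  refine ⟨W * (A * (κ⁻¹ * D)), by positivity, fun f hf => ?_⟩
  obtain ⟨β, -, hf'⟩ := id hf
  have hcl := continuousOn_iteratedDerivWithin_Ici (hS.contDiffOn hf'.1) r
  obtain ⟨B, hB⟩ := exists_norm_localDeriv_le hS hf'.1 r
  set T : ℕ → ℝ → ℝ := fun k x => |a k| * |b k| ^ r * ‖localDeriv φ r f (b k * x)‖ with hT
  have hT0 : ∀ k x, 0 ≤ T k x := fun k x => by positivity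
  have hTc : ∀ k, ContinuousOn (T k) (Iic 0) := fun k =>
    continuousOn_const.mul (hcl.comp (continuousOn_const.mul continuousOn_id)
      fun x hx => hS.mul_mem_Ici k hx).norm
  have hfar : ∀ k, ∀ x < -(2 / κ), localDeriv φ r f (b k * x) = 0 := fun k x hx => by
    refine localDeriv_eq_zero hS r ?_
    have h0 : 0 < 2 / κ := by positivity
    have h1 : 2 / κ < -x := by linarith
    rw [div_lt_iff₀ hκ] at h1
    nlinarith [hb k]
  have hTfar : ∀ k, ∀ x < -(2 / κ), T k x = 0 := fun k x hx => by simp [hT, hfar k x hx]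
  have hTi : ∀ k, IntegrableOn (T k) (Iic 0) := fun k =>
    integrableOn_Iic_of_continuousOn (hTc k) (hTfar k)
  have hTB : ∀ k, ∀ x ∈ Iic (0 : ℝ), ‖T k x‖ ≤ |a k| * |b k| ^ r * B := fun k x hx => by
    rw [Real.norm_of_nonneg (hT0 k x)]
    exact mul_le_mul_of_nonneg_left (hB _ (hS.mul_mem_Ici k hx)) (by positivity)
  have hsum := (hS.summable r).mul_right B
  have hTsi : IntegrableOn (fun x => ∑' k, T k x) (Iic 0) :=
    integrableOn_Iic_of_continuousOn (L := 2 / κ) (continuousOn_tsum hTc hsum hTB)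
      fun x hx => by simp [hTfar _ x hx]
  -- the integral of a single term, after the substitution `t = b_k x`
  have hI : ∀ k, ∫ x in Iic (0 : ℝ), T k x ≤ |a k| * |b k| ^ r * (κ⁻¹ * D * halfNorm r f) := by
    intro k
    simp only [hT]
    rw [integral_const_mul, setIntegral_Iic_comp_mul_left (hS.neg k)
      (fun t => ‖localDeriv φ r f t‖)]
    refine mul_le_mul_of_nonneg_left ?_ (by positivity)
    rw [mul_assoc]
    have h1 : |b k|⁻¹ ≤ κ⁻¹ := by
      refine inv_anti₀ hκ ?_
      rw [abs_of_neg (hS.neg k)]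
      linarith [hb k]
    refine mul_le_mul h1 ?_ (integral_nonneg fun _ => norm_nonneg _) (by positivity)
    rw [← setIntegral_halfSum hS hf, ← integral_const_mul]
    refine integral_mono_of_nonneg (ae_of_all _ fun _ => norm_nonneg _)
      ((integrableOn_halfSum hS hf r).const_mul D) ?_
    filter_upwards [ae_restrict_mem measurableSet_Ici] with t ht
    exact hle f hf t ht
  have hIs : Summable fun k => ∫ x in Iic (0 : ℝ), ‖T k x‖ := by
    refine Summable.of_nonneg_of_le (fun k => integral_nonneg fun _ => norm_nonneg _) (fun k => ?_)
      ((hS.summable r).mul_right (κ⁻¹ * D * halfNorm r f))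
    simp only [Real.norm_of_nonneg (hT0 _ _)]
    exact hI k
  have hint := hasSum_integral_of_summable_integral_norm hTi hIs
  calc ∫ x in Iic (0 : ℝ), ‖seeleySum a b φ r f x‖ * bracket x ^ ((r : ℝ) - 1)
      ≤ ∫ x in Iic (0 : ℝ), W * ∑' k, T k x := by
        refine integral_mono_of_nonneg (ae_of_all _ fun x => mul_nonneg (norm_nonneg _)
          (Real.rpow_nonneg (bracket_pos x).le _)) (hTsi.const_mul W) ?_
        filter_upwards [ae_restrict_mem measurableSet_Iic] with x hx
        rw [mul_comm]
        rcases lt_or_ge x (-(2 / κ)) with hx' | hx'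
        · rw [seeleySum_eq_zero hS hκ hb r hx', norm_zero, mul_zero]
          exact mul_nonneg hW0 (tsum_nonneg fun k => hT0 k x)
        · refine mul_le_mul ?_ ?_ (norm_nonneg _) hW0
          · have h1 : bracket x ≤ bracket (2 / κ) := by
              refine Real.sqrt_le_sqrt ?_
              have : ‖x‖ ≤ ‖2 / κ‖ := by
                rw [Real.norm_of_nonpos hx, Real.norm_of_nonneg (by positivity)]
                linarith
              gcongr
            exact (Real.rpow_le_rpow_of_exponent_le (one_le_bracket x) (by linarith)).trans
              (Real.rpow_le_rpow (bracket_pos x).le h1 (Nat.cast_nonneg r))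
          · refine tsum_of_norm_bounded (Summable.hasSum (Summable.of_norm_bounded hsum
              fun k => hTB k x hx)) fun k => ?_
            rw [norm_mul, Complex.norm_real, Real.norm_eq_abs, abs_mul, abs_pow]
    _ = W * ∑' k, ∫ x in Iic (0 : ℝ), T k x := by
        rw [integral_const_mul, hint.tsum_eq]
    _ ≤ W * ∑' k, |a k| * |b k| ^ r * (κ⁻¹ * D * halfNorm r f) := by
        refine mul_le_mul_of_nonneg_left ?_ hW0
        exact hint.summable.tsum_le_tsum hI ((hS.summable r).mul_right _)
    _ = _ := by rw [tsum_mul_right]; ring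

theorem exists_integral_symbolSum_seeley_le (hS : IsSeeleyData a b φ) (k : ℕ) :
    ∃ C ≥ 0, ∀ f ∈ SlowDecayPlus, ∫ x, symbolSum k (seeley a b φ f) x ≤ C * halfNorm k f := by
  choose M hM0 hM using exists_setIntegral_seeleySum_le hS
  refine ⟨1 + ∑ r ∈ Finset.range (k + 1), M r,
    add_nonneg zero_le_one (Finset.sum_nonneg fun r _ => hM0 r), fun f hf => ?_⟩
  obtain ⟨β, -, hf'⟩ := id hf
  have hg := seeley_mem_slowDecay hS hf
  have hi := integrable_symbolSum hg k
  rw [← integral_add_compl measurableSet_Ici hi, compl_Ici, ← integral_Iic_eq_integral_Iio, add_mul,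
    one_mul]
  refine add_le_add (le_of_eq ?_) ?_
  · rw [← setIntegral_halfSum hS hf]
    refine setIntegral_congr_fun measurableSet_Ici fun x hx => ?_
    simp only [symbolSum, halfSum, iteratedDeriv_seeley hS hf'.1,
      seeleyDeriv_of_nonneg (mem_Ici.1 hx)]
  · simp only [symbolSum]
    rw [integral_finsetSum _ fun r _ => (integrable_iteratedDeriv_mul_bracket hg r).integrableOn,
      Finset.sum_mul]
    refine Finset.sum_le_sum fun r hr => ?_
    refine le_trans (le_of_eq ?_) ((hM r f hf).trans
      (mul_le_mul_of_nonneg_left (halfNorm_mono (by simpa [Nat.lt_succ_iff] using hr) f) (hM0 r)))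
    refine setIntegral_congr_fun measurableSet_Iic fun x hx => ?_
    simp only [iteratedDeriv_seeley hS hf'.1, seeleyDeriv_of_nonpos hS (mem_Iic.1 hx)]

end Seeley

/-! ### From the line to the half line -/

lemma restrict_mem_slowDecayPlus {f : ℝ → ℂ} (hf : f ∈ SlowDecay) :
    (fun x : Ici (0 : ℝ) => f x) ∈ SlowDecayPlus := by
  obtain ⟨β, hβ, hf⟩ := hf
  have he : EqOn (IciExtend fun x : Ici (0 : ℝ) => f x) f (Ici 0) := fun x hx =>
    IciExtend_of_mem _ hx
  refine ⟨β, hβ, hf.1.contDiffOn.congr he, fun n => ?_⟩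
  obtain ⟨c, hc⟩ := hf.2 n
  refine ⟨c, fun x hx => ?_⟩
  rw [halfDeriv, iteratedDerivWithin_congr he hx,
    iteratedDerivWithin_eq_iteratedDeriv (uniqueDiffOn_Ici 0) (contDiffAt_of_infty hf.1 n x) hx]
  exact hc x

variable {Y : Type*} [NormedAddCommGroup Y] [NormedSpace ℂ Y]
  {R : ℂ → Y} {α c : ℝ}

/-- The Helffer–Sjöstrand integral depends on the values of `f` on `[0, ∞)` only. -/
lemma hsOp_congr_of_eqOn_Ici (hα : 0 ≤ α) (hR : IsResolventLike α c R) {U : Set ℂ}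
    (hU : IsOpen U) (hRU : ContinuousOn R U) (hneg : ∀ x : ℝ, x < 0 → (x : ℂ) ∈ U)
    {f g : ℝ → ℂ} (hf : f ∈ SlowDecay) (hg : g ∈ SlowDecay) (hfg : EqOn f g (Ici 0))
    {n n' : ℕ} {ψ ψ' : ℝ → ℂ} (hn : α < n) (hn' : α < n') (hψ : IsCutoff ψ) (hψ' : IsCutoff ψ') :
    hsOp R n ψ f = hsOp R n' ψ' g := by
  have h0 := hsOp_eq_zero_of_eqOn_Ici hα hR hψ.isCutoffAt hn (SlowDecay.sub hf hg)
    (fun x hx => by simp [hfg hx]) hU hRU hneg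
  have h1 := hsOp_add hα hR hψ.isCutoffAt hn (SlowDecay.sub hf hg) hg
  rw [sub_add_cancel, h0, zero_add] at h1
  rw [h1]
  exact hsOp_eq_hsOp hα hR hψ.isCutoffAt hn hψ'.isCutoffAt hn' hg

/-- Only the values on `[0, ∞)` matter, so `f` can be multiplied by a smooth function that is `1` on
`K` and supported where `R` is continuous. -/
lemma hsOp_eq_zero_of_isCompact (hα : 0 ≤ α) (hR : IsResolventLike α c R) {U : Set ℂ}
    (hU : IsOpen U) (hRU : ContinuousOn R U) (hneg : ∀ x : ℝ, x < 0 → (x : ℂ) ∈ U)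
    {f : ℝ → ℂ} (hf : f ∈ SlowDecay) {K : Set ℝ} (hK : IsCompact K)
    (hKU : ∀ x ∈ K, (x : ℂ) ∈ U) (hfK : ∀ x, 0 ≤ x → x ∉ K → f x = 0)
    {n : ℕ} {ψ : ℝ → ℂ} (hn : α < n) (hψ : IsCutoff ψ) : hsOp R n ψ f = 0 := by
  obtain ⟨L, hL, hKL, hLU⟩ := exists_compact_between hK (hU.preimage Complex.continuous_ofReal) hKU
  obtain ⟨η, h1, h0, -⟩ := exists_contMDiffMap_one_nhds_of_subset_interior (n := ⊤)
    (modelWithCornersSelf ℝ ℝ) hK.isClosed hKL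
  set χ : ℝ → ℂ := fun x => (η x : ℂ) with hχ
  have hχc : ContDiff ℝ ∞ χ := Complex.ofRealCLM.contDiff.comp η.contMDiff.contDiff
  have hsub : tsupport (χ * f) ⊆ L := by
    refine closure_minimal (fun x hx => ?_) hL.isClosed
    by_contra hxL
    exact hx (by simp [hχ, h0 x hxL])
  have hcs : HasCompactSupport (χ * f) := hL.of_isClosed_subset (isClosed_tsupport _) hsub
  have hsm : ContDiff ℝ ∞ (χ * f) := hχc.mul (SlowDecay.contDiff hf)
  have heq : EqOn f (χ * f) (Ici 0) := fun x hx => by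
    by_cases hxK : x ∈ K
    · simp [hχ, (show η x = 1 from h1.self_of_nhdsSet x hxK)]
    · simp [hfK x hx hxK]
  rw [hsOp_congr_of_eqOn_Ici hα hR hU hRU hneg hf (mem_slowDecay_of_hasCompactSupport hsm hcs) heq
    hn hn hψ hψ]
  exact hsOp_eq_zero_of_continuousOn hα hR hψ.isCutoffAt hn hsm hcs hU hRU
    fun x hx => hLU (hsub hx)

end HelfferSjostrand

end

open HelfferSjostrand
theorem mainTheorem1 {X : Type*} [NormedAddCommGroup X] [NormedSpace ℂ X] [CompleteSpace X]
    (H : X →ₗ.[ℂ] X) (hclosed : H.IsClosed) (hdense : Dense (H.domain : Set X))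
    (hspec : spec H ⊆ (fun x : ℝ => (x : ℂ)) '' Set.Ici 0)
    (c α : ℝ) (hα : 0 ≤ α)
    (hres : ∀ z : ℂ, z.im ≠ 0 →
      ‖resolv H z‖ ≤ c * |z.im|⁻¹ * (bracket z / |z.im|) ^ α) :
    ∃ γ : SlowDecayPlus →ₙₐ[ℂ] (X →L[ℂ] X),
      IsFunctionalCalculus H α γ ∧
      (∃ (a b : ℕ → ℝ) (φ : ℝ → ℂ), IsSeeleyData a b φ) ∧
      (∀ (a b : ℕ → ℝ) (φ : ℝ → ℂ), IsSeeleyData a b φ → ∀ f : SlowDecayPlus,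
        seeley a b φ f ∈ SlowDecay ∧ IsHelfferSjostrand H α (seeley a b φ f) (γ f)) ∧
      (∀ f ∈ SlowDecay, ∃ h : (fun x : Set.Ici (0 : ℝ) => f x) ∈ SlowDecayPlus,
        IsHelfferSjostrand H α f (γ ⟨_, h⟩)) := by
  have him : ∀ z : ℂ, z.im ≠ 0 → z ∉ spec H := fun z hz h => by
    obtain ⟨x, -, rfl⟩ := hspec h
    exact hz (Complex.ofReal_im x)
  have hneg : ∀ x : ℝ, x < 0 → (x : ℂ) ∈ (spec H)ᶜ := fun x hx h => by
    obtain ⟨y, hy, hyx⟩ := hspec h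
    rw [← Complex.ofReal_injective hyx] at hx
    exact hx.not_ge hy
  have h1 : (-1 : ℂ) ∉ spec H := by simpa using hneg (-1) (by norm_num)
  have hU : IsOpen (spec H)ᶜ := isClosed_spec.isOpen_compl
  have hRU : ContinuousOn (resolv H) (spec H)ᶜ := fun z hz =>
    (differentiableAt_resolv hz).continuousAt.continuousWithinAt
  have hR : IsResolventLike α c (resolv H) :=
    ⟨fun z hz => differentiableAt_resolv (him z hz),
      fun z hz => (hres z hz).trans_eq (mul_assoc _ _ _)⟩
  obtain ⟨a₀, b₀, φ₀, hS⟩ := exists_isSeeleyData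
  obtain ⟨ψ₀, hψ₀⟩ := exists_isCutoff
  obtain ⟨n₀, hn₀⟩ := exists_nat_gt α
  have hE : ∀ f : SlowDecayPlus, seeley a₀ b₀ φ₀ f ∈ SlowDecay := fun f =>
    seeley_mem_slowDecay hS f.2
  -- the Helffer–Sjöstrand integral of any function in `𝒜` that extends `f` is the one of `ℰ f`
  have key : ∀ (f : SlowDecayPlus) (g : ℝ → ℂ), g ∈ SlowDecay →
      (∀ x : Set.Ici (0 : ℝ), g x = (f : Set.Ici (0 : ℝ) → ℂ) x) → ∀ (n : ℕ) (ψ : ℝ → ℂ), α < n →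
      IsCutoff ψ → hsOp (resolv H) n₀ ψ₀ (seeley a₀ b₀ φ₀ f) = hsOp (resolv H) n ψ g :=
    fun f g hg hfg n ψ hn hψ => hsOp_congr_of_eqOn_Ici hα hR hU hRU hneg (hE f) hg
      (fun x hx => by rw [seeley_of_nonneg hx, ← hfg ⟨x, hx⟩]) hn₀ hn hψ₀ hψ
  have keyHS : ∀ (f : SlowDecayPlus) (g : ℝ → ℂ), g ∈ SlowDecay →
      (∀ x : Set.Ici (0 : ℝ), g x = (f : Set.Ici (0 : ℝ) → ℂ) x) →
      IsHelfferSjostrand H α g (hsOp (resolv H) n₀ ψ₀ (seeley a₀ b₀ φ₀ f)) :=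
    fun f g hg hfg n ψ hn hψ => ⟨integrable_hsOp hα hR hψ.isCutoffAt hn hg,
      key f g hg hfg n ψ hn hψ⟩
  -- sums, multiples and products of the extensions extend the sum, the multiple and the product
  let γ : SlowDecayPlus →ₙₐ[ℂ] (X →L[ℂ] X) :=
    { toFun := fun f => hsOp (resolv H) n₀ ψ₀ (seeley a₀ b₀ φ₀ f)
      map_smul' := fun t f => by
        rw [key _ _ (SlowDecay.smul t (hE f)) (fun x => by simp [seeley_of_nonneg x.2]) n₀ ψ₀
          hn₀ hψ₀,
          hsOp_smul hψ₀.isCutoffAt (hE f)]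
        rfl
      map_zero' := by
        rw [key 0 _ (SlowDecay.smul 0 (hE 0)) (fun x => by simp) n₀ ψ₀ hn₀ hψ₀,
          hsOp_smul hψ₀.isCutoffAt (hE 0), zero_smul]
      map_add' := fun f g => by
        rw [key _ _ (SlowDecay.add (hE f) (hE g)) (fun x => by simp [seeley_of_nonneg x.2]) n₀ ψ₀
          hn₀ hψ₀, hsOp_add hα hR hψ₀.isCutoffAt hn₀ (hE f) (hE g)]
      map_mul' := fun f g => by
        rw [key _ _ (SlowDecay.mul (hE f) (hE g)) (fun x => by simp [seeley_of_nonneg x.2]) n₀ ψ₀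
          hn₀ hψ₀, hsOp_mul hα hR him hψ₀.isCutoffAt hn₀ (hE f) (hE g)] }
  have hγ : ∀ f, γ f = hsOp (resolv H) n₀ ψ₀ (seeley a₀ b₀ φ₀ f) := fun _ => rfl
  refine ⟨γ, ⟨fun n hn => ?_, fun z hz => ?_, fun f hf hfs => ?_⟩, ⟨a₀, b₀, φ₀, hS⟩,
    fun a b φ h f => ?_, fun f hf => ?_⟩
  · obtain ⟨C, hC, hCb⟩ := exists_norm_hsOp_le hα hψ₀.isCutoffAt hn
    obtain ⟨D, -, hDb⟩ := exists_integral_symbolSum_seeley_le hS (n + 1)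
    refine ⟨c * C * D, fun f => ?_⟩
    rw [hγ, hsOp_eq_hsOp hα hR hψ₀.isCutoffAt hn₀ hψ₀.isCutoffAt hn (hE f), mul_assoc]
    exact (hCb _ _ c hR _ (hE f)).trans
      (mul_le_mul_of_nonneg_left (hDb f f.2) (mul_nonneg hR.nonneg hC))
  · refine ⟨restrict_mem_slowDecayPlus (resFun_mem_slowDecay hz), ?_⟩
    rw [hγ, key _ _ (resFun_mem_slowDecay hz) (fun x => rfl) n₀ ψ₀ hn₀ hψ₀,
      hsOp_resFun hα hR him h1 hdense hψ₀.isCutoffAt hn₀ hz]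
  · refine hsOp_eq_zero_of_isCompact hα hR hU hRU hneg (hE f)
      (hf.isCompact.image continuous_subtype_val) ?_ (fun x hx hxK => ?_) hn₀ hψ₀
    · rintro _ ⟨x, hx, rfl⟩
      exact hfs x hx
    · rw [seeley_of_nonneg hx]
      exact image_eq_zero_of_notMem_tsupport fun h => hxK ⟨_, h, rfl⟩
  · have h' := seeley_mem_slowDecay h f.2
    exact ⟨h', keyHS f _ h' fun x => seeley_of_nonneg x.2⟩
  · exact ⟨restrict_mem_slowDecayPlus hf, keyHS _ _ hf fun x => rfl⟩
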